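/- Let $d\ge 0$ be an integer (the dimension of the lattice), let $(V(n))_{n\in\mathbb Z^d}$ be independent real random variables on a probability space $(\Omega,\mathbb P)$, all with the same law $\mu$, and let $(a_n)_{n\in\mathbb Z^d}$ be non-zero real numbers. On $\ell^2(\mathbb Z^d)$ consider $$H^\omega=\Delta+BV^\omega,\qquad (\Delta u)(n)=\sum_{|i|=1}u(n+i),\qquad (BV^\omega u)(n)=a_n\,V(n)(\omega)\,u(n),$$ with domain $\{u\in\ell^2(\mathbb Z^d):(a_nV(n)(\omega)u(n))_n\in\ell^2(\mathbb Z^d)\}$. For a Borel measure $\sigma$ on $\mathbb R$ and $0<\alpha\le 1$ put $$d_\sigma^{\alpha,\infty}=\sup_{x\in\mathbb R}\ \sup_{\epsilon>0}\frac{\sigma((x-\epsilon,x+\epsilon))}{(2\epsilon)^\alpha},$$ and call a probability measure $\sigma$ uniformly $\alpha$-Hölder continuous if the supremum of the same quotient over $x\in\mathbb R$ and $0<\epsilon\le1$ is finite. Suppose that $\mu$ is uniformly $\alpha$-Hölder continuous for some $0<\alpha\le1$. Then every $H^\omega$ is self-adjoint and so has a projection-valued spectral measure $E_{H^\omega}$;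 for each $n$ the measure $\langle\delta_n,E_{H^\omega}(\cdot)\delta_n\rangle$ depends measurably on $\omega$, and $$\nu_n(\cdot)=\mathbb E\,\langle\delta_n,E_{H^\omega}(\cdot)\,\delta_n\rangle$$ is a probability measure. Each $\nu_n$ is uniformly $\alpha$-Hölder continuous, with $$d_{\nu_n}^{\alpha,\infty}\le|a_n|^{-\alpha}\,d_\mu^{\alpha,\infty}.$$ Moreover, if $\beta_n\ge0$, $\sum_n\beta_n=1$ and $\sum_n\beta_n|a_n|^{-\alpha}<\infty$, then $\nu=\sum_n\beta_n\nu_n$ is a uniformly $\alpha$-Hölder continuous probability measure. -/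

import Mathlib

open MeasureTheory ProbabilityTheory Set
open scoped ENNReal

/-! ### Uniform Hölder continuity of measures on the line -/

/-- `sup_{x ∈ ℝ} sup_{0 < ε ≤ 1} μ((x-ε, x+ε)) / (2ε)^α < ∞`. -/
def UniformlyHolder (α : ℝ) (μ : Measure ℝ) : Prop :=
  (⨆ x : ℝ, ⨆ ε ∈ Ioc (0 : ℝ) 1,
    μ (Ioo (x - ε) (x + ε)) / ENNReal.ofReal ((2 * ε) ^ α)) < ∞

/-- `d_μ^{α,∞} = sup_{x ∈ ℝ} sup_{ε > 0} μ((x-ε, x+ε)) / (2ε)^α`, an element of `[0, ∞]`. -/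
noncomputable def holderConst (α : ℝ) (μ : Measure ℝ) : ℝ≥0∞ :=
  ⨆ x : ℝ, ⨆ ε ∈ Ioi (0 : ℝ),
    μ (Ioo (x - ε) (x + ε)) / ENNReal.ofReal ((2 * ε) ^ α)

/-! ### Projection-valued measures and spectral measures of unbounded operators -/

section SpectralMeasure

/-- A projection-valued Borel measure on `ℝ`: orthogonal projections `E(S)` with `E(ℝ) = 1`,
countably additive in the strong operator topology. Values on non-measurable sets are
irrelevant. -/
structure ProjectionValuedMeasure (H : Type*) [NormedAddCommGroup H] [InnerProductSpace ℂ H]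
    [CompleteSpace H] where
  proj : Set ℝ → H →L[ℂ] H
  isStarProjection : ∀ S, MeasurableSet S → IsStarProjection (proj S)
  proj_univ : proj univ = 1
  hasSum_iUnion : ∀ f : ℕ → Set ℝ, (∀ i, MeasurableSet (f i)) →
    Pairwise (Function.onFun Disjoint f) → ∀ x : H,
      HasSum (fun i => proj (f i) x) (proj (⋃ i, f i) x)

variable {H : Type*} [NormedAddCommGroup H] [InnerProductSpace ℂ H] [CompleteSpace H]

namespace ProjectionValuedMeasure

theorem proj_empty (E : ProjectionValuedMeasure H) (x : H) : E.proj ∅ x = 0 := by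
  have h := E.hasSum_iUnion (fun _ => ∅) (fun _ => MeasurableSet.empty)
    (fun _ _ _ => disjoint_bot_left) x
  exact tendsto_nhds_unique tendsto_const_nhds h.summable.tendsto_atTop_zero

theorem inner_nonneg (E : ProjectionValuedMeasure H) (x : H) {S : Set ℝ}
    (hS : MeasurableSet S) : 0 ≤ (inner ℂ x (E.proj S x)).re := by
  have h := E.isStarProjection S hS
  have h1 : E.proj S (E.proj S x) = E.proj S x := by
    conv_rhs => rw [← h.isIdempotentElem.eq]
    rfl
  have h2 : inner ℂ x (E.proj S x) = inner ℂ (E.proj S x) (E.proj S x) := by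
    have h3 := ContinuousLinearMap.adjoint_inner_left (E.proj S) (E.proj S x) x
    rw [← ContinuousLinearMap.star_eq_adjoint, h.isSelfAdjoint.star_eq, h1] at h3
    exact h3.symm
  rw [h2]
  exact inner_self_nonneg (𝕜 := ℂ)

/-- The scalar measure `S ↦ ⟨x, E(S) x⟩`. -/
noncomputable def scalarMeasure (E : ProjectionValuedMeasure H) (x : H) : Measure ℝ :=
  Measure.ofMeasurable (fun S _ => ENNReal.ofReal (inner ℂ x (E.proj S x)).re)
    (by simp [E.proj_empty x])
    (by
      intro f hf hd
      have h := E.hasSum_iUnion f hf hd x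
      have h1 : HasSum (fun i => (inner ℂ x (E.proj (f i) x)).re)
          (inner ℂ x (E.proj (⋃ i, f i) x)).re :=
        Complex.hasSum_re (h.mapL (innerSL ℂ x))
      change ENNReal.ofReal _ = ∑' i, ENNReal.ofReal _
      rw [← h1.tsum_eq, ENNReal.ofReal_tsum_of_nonneg
        (fun i => E.inner_nonneg x (hf i)) h1.summable])

theorem scalarMeasure_apply (E : ProjectionValuedMeasure H) (x : H) {S : Set ℝ}
    (hS : MeasurableSet S) :
    E.scalarMeasure x S = ENNReal.ofReal (inner ℂ x (E.proj S x)).re :=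
  Measure.ofMeasurable_apply S hS

open Classical in
/-- The projection-valued Dirac measure at `0`; it serves only as an inhabitant. -/
noncomputable instance : Inhabited (ProjectionValuedMeasure H) where
  default :=
    { proj := fun S => if (0 : ℝ) ∈ S then 1 else 0
      isStarProjection := by
        intro S _
        split_ifs
        · exact IsStarProjection.one _
        · exact IsStarProjection.zero _
      proj_univ := by simp
      hasSum_iUnion := by
        intro f _ hd x
        by_cases h : ∃ i, (0 : ℝ) ∈ f i
        · obtain ⟨i, hi⟩ := h
          have h0 : (0 : ℝ) ∈ ⋃ i, f i := mem_iUnion.2 ⟨i, hi⟩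
          have hs := hasSum_single (f := fun j => (if (0 : ℝ) ∈ f j then (1 : H →L[ℂ] H) else 0) x)
            i (by
              intro j hj
              have : (0 : ℝ) ∉ f j := fun hj0 => disjoint_left.1 (hd hj) hj0 hi
              simp [this])
          simpa [hi, h0] using hs
        · have h0 : (0 : ℝ) ∉ ⋃ i, f i := by simpa using h
          push Not at h
          simp [h] }

/-- `E` is the spectral measure of the (possibly unbounded) operator `T`, that is
`T = ∫ t dE(t)`: the domain of `T` is `{x | ∫ t² d⟨x, E(t) x⟩ < ∞}`, and
`⟨x, T x⟩ = ∫ t d⟨x, E(t) x⟩` for `x` in the domain. -/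
def IsSpectralMeasureOf (E : ProjectionValuedMeasure H) (T : H →ₗ.[ℂ] H) : Prop :=
  (∀ x : H, x ∈ T.domain ↔ ∫⁻ t, ENNReal.ofReal (t ^ 2) ∂(E.scalarMeasure x) < ∞) ∧
  ∀ x : T.domain, inner ℂ (x : H) (T x) = ((∫ t, t ∂(E.scalarMeasure (x : H)) : ℝ) : ℂ)

end ProjectionValuedMeasure

/-- The spectral measure `E_T` of `T`; meaningful when `T` has one, as every self-adjoint
operator does. -/
noncomputable def spectralMeasure (T : H →ₗ.[ℂ] H) : ProjectionValuedMeasure H :=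
  Classical.epsilon fun E => E.IsSpectralMeasureOf T

/-- The averaged spectral measure `S ↦ 𝔼 ⟨φ, E_{T ω}(S) φ⟩` of a random operator `T`;
meaningful when `ω ↦ ⟨φ, E_{T ω}(·) φ⟩` is measurable. -/
noncomputable def averagedSpectralMeasure {Ω : Type*} [MeasurableSpace Ω] (P : Measure Ω)
    (T : Ω → H →ₗ.[ℂ] H) (φ : H) : Measure ℝ :=
  P.bind fun ω => (spectralMeasure (T ω)).scalarMeasure φ

end SpectralMeasure

/-! ### The operators `Δ + B V` on `ℓ²(ℤ^d)` -/

/-- `ℓ²(ℤ^d)` with complex values. -/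
abbrev LatticeL2 (d : ℕ) : Type := lp (fun _ : Fin d → ℤ => ℂ) 2

theorem memℓp_two_shift {d : ℕ} (u : LatticeL2 d) (i : Fin d → ℤ) :
    Memℓp (fun n => u (n + i)) 2 := by
  have h := lp.memℓp u
  rw [memℓp_gen_iff (by norm_num)] at h ⊢
  exact (Equiv.addRight i).summable_iff.2 h

/-- The translation `(u(n))_n ↦ (u(n + i))_n` on `ℓ²(ℤ^d)`. -/
noncomputable def latticeShift {d : ℕ} (i : Fin d → ℤ) : LatticeL2 d →ₗ[ℂ] LatticeL2 d where
  toFun u := ⟨fun n => u (n + i), memℓp_two_shift u i⟩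
  map_add' _ _ := rfl
  map_smul' _ _ := rfl

/-- `(Δ u)(n) = ∑_{|i| = 1} u(n + i)`, where the `i ∈ ℤ^d` of length one are the `± e_j`. -/
noncomputable def latticeLaplacian (d : ℕ) : LatticeL2 d →ₗ[ℂ] LatticeL2 d :=
  ∑ j : Fin d, (latticeShift (Pi.single j 1) + latticeShift (-Pi.single j 1))

/-- Multiplication by the real sequence `w` on its maximal domain `{u ∈ ℓ² | w u ∈ ℓ²}`. -/
noncomputable def diagonalOperator {d : ℕ} (w : (Fin d → ℤ) → ℝ) : LatticeL2 d →ₗ.[ℂ] LatticeL2 d where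
  domain :=
    { carrier := {u | Memℓp (fun n => (w n : ℂ) * u n) 2}
      zero_mem' := by
        have h : Memℓp (0 : (Fin d → ℤ) → ℂ) 2 := zero_memℓp
        refine (congrArg (fun f => Memℓp f 2) ?_).mp h
        funext n
        simp
      add_mem' := by
        intro u v hu hv
        have h := Memℓp.add hu hv
        refine (congrArg (fun f => Memℓp f 2) ?_).mp h
        funext n
        simp [mul_add]
      smul_mem' := by
        intro c u hu
        have h := Memℓp.const_smul hu c
        refine (congrArg (fun f => Memℓp f 2) ?_).mp h
        funext n
        simp [mul_left_comm] }
  toFun :=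
    { toFun := fun u => ⟨fun n => (w n : ℂ) * (u : LatticeL2 d) n, u.2⟩
      map_add' := by
        intro u v
        ext n
        exact mul_add _ _ _
      map_smul' := by
        intro c u
        ext n
        simp [mul_left_comm] }

/-- `Δ + B V`, where `(B u)(n) = a_n u(n)`, `(V u)(n) = v_n u(n)`, with the domain
`{u ∈ ℓ² | (a_n v_n u(n))_n ∈ ℓ²}`. -/
noncomputable def randomHamiltonian {d : ℕ} (a v : (Fin d → ℤ) → ℝ) : LatticeL2 d →ₗ.[ℂ] LatticeL2 d :=
  latticeLaplacian d +ᵥ diagonalOperator fun n => a n * v n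

/-- The unit vector `δ_n` of `ℓ²(ℤ^d)`. -/
noncomputable def latticeDelta {d : ℕ} (n : Fin d → ℤ) : LatticeL2 d :=
  lp.single 2 n (1 : ℂ)

open scoped Topology ComplexConjugate InnerProductSpace
open Filter

/-! ### Hölder measures and stochastically monotone kernels -/

/-! Fix a site n and freeze the potential at all other sites. By independence, what remains random
is the coupling x = a_n V(n) of the rank one projection onto δ_n. Its law ρ is the image of μ under
multiplication by a_n, with Hölder constant D at most |a_n|^(-α) d_μ. Let κ_x be the spectral
measure at δ_n and F_x(z) = ⟨δ_n, (H_x - z)⁻¹ δ_n⟩ its Stieltjes transform. The resolvent identity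
F_x - F_y = -(x - y) F_x F_y has two consequences.

Spectral averaging (`lintegral_measure_Ioo_le_of_stieltjes`): F_x = 1/(x - w) with w = -1/F_0 in the
upper half-plane, so Im F_x(z) has integral π in x for every z. Letting z approach the real axis
gives ∫ κ_x(I) dx ≤ |I|.

Stochastic monotonicity (`measure_Iic_le_of_stieltjes`): Im (F_x F_y) has nonnegative integral along
every horizontal half-line coming from -∞, so κ_x((-∞, c]) decreases as x grows.

Hence, for an open interval I, κ_x(I) = g(x) - f(x) with f and g decreasing and valued in [0, 1].
The region between the two graphs has an interval J_θ as its section at height θ, and ρ(J_θ) ≤ D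
|J_θ|^α. Integration over 0 < θ < 1 and Jensen's inequality for t^α give ∫ κ_x(I) dρ ≤ D (∫ |J_θ|
dθ)^α = D (∫ κ_x(I) dx)^α ≤ D |I|^α, without loss of constant (`lintegral_kernel_Ioo_le`).

It remains to connect this with operators. `IsSpectralMeasureOf` prescribes only the domain and the
quadratic form, and `spectralMeasure` is an arbitrary choice among the solutions. Existence comes
from the continuous functional calculus of the bounded normal operator (T + i)⁻¹. For any solution
the Stieltjes transform is shown to be the resolvent (`stieltjes_scalarMeasure`), so the choice does
not matter. Measurability in ω holds because the resolvent is continuous in the potential for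
pointwise convergence. -/

theorem measure_Ioo_le_holderConst (α : ℝ) (μ : Measure ℝ) (x : ℝ) {ε : ℝ} (hε : 0 < ε) :
    μ (Ioo (x - ε) (x + ε)) ≤ holderConst α μ * ENNReal.ofReal ((2 * ε) ^ α) := by
  have h0 : 0 < (2 * ε) ^ α := Real.rpow_pos_of_pos (by linarith) _
  rw [← ENNReal.div_le_iff_le_mul (Or.inl (by simpa using h0)) (Or.inl ENNReal.ofReal_ne_top)]
  unfold holderConst
  refine le_iSup_of_le x ?_
  exact le_iSup₂_of_le (f := fun ε (_ : ε ∈ Ioi (0 : ℝ)) =>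
    μ (Ioo (x - ε) (x + ε)) / ENNReal.ofReal ((2 * ε) ^ α)) ε hε le_rfl

theorem holderConst_le_iff {α : ℝ} {μ : Measure ℝ} {D : ℝ≥0∞} :
    holderConst α μ ≤ D ↔ ∀ x ε : ℝ, 0 < ε →
      μ (Ioo (x - ε) (x + ε)) ≤ D * ENNReal.ofReal ((2 * ε) ^ α) := by
  constructor
  · intro h x ε hε
    exact (measure_Ioo_le_holderConst α μ x hε).trans (by gcongr)
  · intro h
    unfold holderConst
    refine iSup_le fun x => iSup₂_le fun ε hε => ?_
    exact ENNReal.div_le_of_le_mul (h x ε hε)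

theorem uniformlyHolder_of_holderConst_lt_top {α : ℝ} {μ : Measure ℝ}
    (h : holderConst α μ < ∞) : UniformlyHolder α μ := by
  refine lt_of_le_of_lt ?_ h
  unfold holderConst
  refine iSup_mono fun x => ?_
  refine iSup_mono fun ε => ?_
  exact iSup_mono' fun hε => ⟨hε.1, le_rfl⟩

/-- Only radii above 1 are new, and there (2ε)^α ≥ 1 while a probability measure has mass at most 1.
-/
theorem UniformlyHolder.holderConst_lt_top {α : ℝ} (hα : 0 < α) {μ : Measure ℝ}
    [IsProbabilityMeasure μ] (h : UniformlyHolder α μ) : holderConst α μ < ∞ := by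
  unfold UniformlyHolder at h
  refine lt_of_le_of_lt ?_ (max_lt h ENNReal.one_lt_top)
  unfold holderConst
  refine iSup_le fun x => iSup₂_le fun ε hε => ?_
  rcases le_total ε 1 with h1 | h1
  · refine le_max_of_le_left ?_
    refine le_iSup_of_le x ?_
    exact le_iSup₂_of_le (f := fun ε (_ : ε ∈ Ioc (0 : ℝ) 1) =>
      μ (Ioo (x - ε) (x + ε)) / ENNReal.ofReal ((2 * ε) ^ α)) ε ⟨hε, h1⟩ le_rfl
  · refine le_max_of_le_right ?_
    refine ENNReal.div_le_of_le_mul ?_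
    rw [one_mul]
    refine prob_le_one.trans ?_
    rw [← ENNReal.ofReal_one]
    exact ENNReal.ofReal_le_ofReal (Real.one_le_rpow (by linarith) hα.le)

/-- Enlarge to an open interval by η on each side and let η tend to 0. Finiteness of the constant
makes the multiplication continuous there. -/
theorem measure_Icc_le_holderConst {α : ℝ} (hα : 0 < α) {μ : Measure ℝ}
    (hD : holderConst α μ < ∞) {a b : ℝ} (hab : a ≤ b) :
    μ (Icc a b) ≤ holderConst α μ * ENNReal.ofReal (b - a) ^ α := by
  have key : ∀ η : ℝ, 0 < η →
      μ (Icc a b) ≤ holderConst α μ * ENNReal.ofReal (b - a + 2 * η) ^ α := by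
    intro η hη
    have h := measure_Ioo_le_holderConst α μ ((a + b) / 2) (ε := (b - a) / 2 + η) (by linarith)
    rw [← ENNReal.ofReal_rpow_of_nonneg (by linarith) hα.le] at h
    refine (measure_mono ?_).trans (h.trans_eq (by ring_nf))
    intro t ht
    exact ⟨by linarith [ht.1], by linarith [ht.2]⟩
  have hc : Continuous fun η : ℝ => ENNReal.ofReal (b - a + 2 * η) ^ α :=
    ENNReal.continuous_rpow_const.comp (ENNReal.continuous_ofReal.comp (by fun_prop))
  have ht : Tendsto (fun η : ℝ => holderConst α μ * ENNReal.ofReal (b - a + 2 * η) ^ α)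
      (𝓝[>] 0) (𝓝 (holderConst α μ * ENNReal.ofReal (b - a) ^ α)) := by
    refine ENNReal.Tendsto.const_mul ?_ (Or.inr hD.ne)
    have := (hc.tendsto 0).mono_left (nhdsWithin_le_nhds (s := Ioi 0))
    simpa using this
  exact ge_of_tendsto ht (eventually_nhdsWithin_of_forall fun η hη => key η hη)

theorem measure_ordConnected_le_holderConst {α : ℝ} (hα : 0 < α) {μ : Measure ℝ}
    (hD : holderConst α μ < ∞) {J : Set ℝ} (hJ : J.OrdConnected) :
    μ J ≤ holderConst α μ * volume J ^ α := by
  have key : ∀ n : ℕ, μ (J ∩ Icc (-n : ℝ) n) ≤ holderConst α μ * volume J ^ α := by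
    intro n
    set K := J ∩ Icc (-n : ℝ) n
    rcases K.eq_empty_or_nonempty with h0 | hne
    · simp [h0]
    have hK : K.OrdConnected := hJ.inter ordConnected_Icc
    have hbb : BddBelow K := ⟨-n, fun x hx => hx.2.1⟩
    have hba : BddAbove K := ⟨n, fun x hx => hx.2.2⟩
    have h1 : K ⊆ Icc (sInf K) (sSup K) := subset_Icc_csInf_csSup hbb hba
    have h2 : Ioo (sInf K) (sSup K) ⊆ K := by
      intro x hx
      obtain ⟨y, hy, hyx⟩ := (csInf_lt_iff hbb hne).1 hx.1
      obtain ⟨z, hz, hxz⟩ := (lt_csSup_iff hba hne).1 hx.2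
      exact hK.out hy hz ⟨hyx.le, hxz.le⟩
    -- The bounded convex set K lies between an open and a closed interval with the same endpoints,
    -- so the closed-interval bound costs nothing in length.
    have h3 : sInf K ≤ sSup K := csInf_le_csSup hne hbb hba
    refine (measure_mono h1).trans ((measure_Icc_le_holderConst hα hD h3).trans ?_)
    gcongr
    rw [← Real.volume_Ioo]
    exact measure_mono (h2.trans inter_subset_left)
  have hU : J = ⋃ n : ℕ, J ∩ Icc (-n : ℝ) n := by
    rw [← inter_iUnion]
    refine (inter_eq_left.2 fun x _ => ?_).symm
    obtain ⟨n, hn⟩ := exists_nat_ge |x|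
    exact mem_iUnion.2 ⟨n, abs_le.1 hn⟩
  have hm : Monotone fun n : ℕ => J ∩ Icc (-n : ℝ) n := by
    intro m n hmn
    have : (m : ℝ) ≤ n := by exact_mod_cast hmn
    exact inter_subset_inter_right _ (Icc_subset_Icc (by linarith) this)
  conv_lhs => rw [hU]
  rw [hm.measure_iUnion]
  exact iSup_le key

/-- Jensen's inequality for the concave power, in the form of monotonicity of L^p norms in p on a
probability space. -/
theorem lintegral_rpow_le_rpow_lintegral {X : Type*} [MeasurableSpace X] (P : Measure X)
    [IsProbabilityMeasure P] {f : X → ℝ≥0∞} (hf : AEMeasurable f P) {α : ℝ} (hα : 0 < α)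
    (hα1 : α ≤ 1) : ∫⁻ x, f x ^ α ∂P ≤ (∫⁻ x, f x ∂P) ^ α := by
  have h := eLpNorm'_le_eLpNorm'_of_exponent_le (f := f) hα hα1 P hf.aestronglyMeasurable
  simp only [eLpNorm', enorm_eq_self, ENNReal.rpow_one, div_one] at h
  have h2 := ENNReal.rpow_le_rpow h hα.le
  rwa [← ENNReal.rpow_mul, one_div, inv_mul_cancel₀ hα.ne', ENNReal.rpow_one] at h2

/-- The region between two decreasing functions has order-connected horizontal sections; the
layer cake formula and Jensen's inequality compare its weight with its area. -/
theorem lintegral_sub_antitone_le {α : ℝ} (hα : 0 < α) (hα1 : α ≤ 1) {μ : Measure ℝ}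
    [SFinite μ] (hD : holderConst α μ < ∞) {f g : ℝ → ℝ} (hf : Antitone f) (hg : Antitone g)
    (hf0 : ∀ x, 0 ≤ f x) (hg1 : ∀ x, g x ≤ 1) :
    ∫⁻ x, ENNReal.ofReal (g x - f x) ∂μ ≤
      holderConst α μ * (∫⁻ x, ENNReal.ofReal (g x - f x)) ^ α := by
  have hms : MeasurableSet (regionBetween f g univ) :=
    measurableSet_regionBetween hf.measurable hg.measurable MeasurableSet.univ
  -- The area of the region for ρ times Lebesgue measure, computed by horizontal slices. Heights
  -- outside (0, 1) contribute nothing because 0 ≤ f and g ≤ 1; the same formula is used for μ and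
  -- for Lebesgue measure.
  have hrep : ∀ ρ : Measure ℝ, SFinite ρ → ∫⁻ x, ENNReal.ofReal (g x - f x) ∂ρ =
      ∫⁻ θ in Ioo (0 : ℝ) 1, ρ ((fun x => (x, θ)) ⁻¹' regionBetween f g univ) := by
    intro ρ _
    have h := volume_regionBetween_eq_lintegral (μ := ρ) hf.measurable.aemeasurable
      hg.measurable.aemeasurable
      MeasurableSet.univ
    rw [Measure.restrict_univ] at h
    refine h.symm.trans ?_
    rw [Measure.prod_apply_symm hms]
    refine (setLIntegral_eq_of_support_subset fun θ hθ => ?_).symm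
    obtain ⟨x, hx⟩ := nonempty_of_measure_ne_zero hθ
    exact ⟨(hf0 x).trans_lt hx.2.1, hx.2.2.trans_le (hg1 x)⟩
  have hoc : ∀ θ, OrdConnected ((fun x => (x, θ)) ⁻¹' regionBetween f g univ) := by
    intro θ
    refine ⟨fun x hx y hy z hz => ⟨trivial, ?_, ?_⟩⟩
    · exact (hf hz.1).trans_lt hx.2.1
    · exact hy.2.2.trans_le (hg hz.2)
  have : IsProbabilityMeasure ((volume : Measure ℝ).restrict (Ioo 0 1)) := ⟨by simp⟩
  rw [hrep μ inferInstance, hrep volume inferInstance]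
  calc ∫⁻ θ in Ioo (0 : ℝ) 1, μ ((fun x => (x, θ)) ⁻¹' regionBetween f g univ)
      ≤ ∫⁻ θ in Ioo (0 : ℝ) 1, holderConst α μ *
          volume ((fun x => (x, θ)) ⁻¹' regionBetween f g univ) ^ α :=
        lintegral_mono fun θ => measure_ordConnected_le_holderConst hα hD (hoc θ)
    _ = holderConst α μ * ∫⁻ θ in Ioo (0 : ℝ) 1,
          volume ((fun x => (x, θ)) ⁻¹' regionBetween f g univ) ^ α :=
        lintegral_const_mul' _ _ hD.ne
    _ ≤ _ := by
        gcongr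
        exact lintegral_rpow_le_rpow_lintegral _
          (measurable_measure_prodMk_right hms).aemeasurable hα hα1

/-- Averaging a stochastically increasing family of probability measures that averages
to at most Lebesgue measure does not increase the Hölder constant. -/
theorem lintegral_kernel_Ioo_le {α : ℝ} (hα : 0 < α) (hα1 : α ≤ 1) {μ : Measure ℝ}
    [SFinite μ] (hD : holderConst α μ < ∞) (κ : ℝ → Measure ℝ)
    [∀ x, IsProbabilityMeasure (κ x)] (hIic : ∀ c, Antitone fun x => κ x (Iic c))
    {a b : ℝ} (hab : a < b) (hvol : ∫⁻ x, κ x (Ioo a b) ≤ ENNReal.ofReal (b - a)) :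
    ∫⁻ x, κ x (Ioo a b) ∂μ ≤ holderConst α μ * ENNReal.ofReal (b - a) ^ α := by
  have hIio : Antitone fun x => κ x (Iio b) := by
    intro x y hxy
    have hU : Iio b = ⋃ n : ℕ, Iic (b - 1 / (n + 1)) := by
      rw [iUnion_Iic_eq_Iio_of_lt_of_tendsto (f := fun n : ℕ => b - 1 / ((n : ℝ) + 1)) (a := b) (F := atTop)]
      · intro n
        have : (0 : ℝ) < 1 / (n + 1) := Nat.one_div_pos_of_nat
        linarith
      · simpa using (tendsto_one_div_add_atTop_nhds_zero_nat (𝕜 := ℝ)).const_sub b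
    have hm : Monotone fun n : ℕ => Iic (b - 1 / ((n : ℝ) + 1)) := by
      intro m n hmn
      refine Iic_subset_Iic.2 (sub_le_sub_left ?_ _)
      exact Nat.one_div_le_one_div hmn
    simp only [hU, hm.measure_iUnion]
    exact iSup_mono fun n => hIic _ hxy
  -- The two monotone functions are the mass of the open half-line up to b and that of the closed
  -- half-line up to a, so atoms at the endpoints are excluded exactly.
  have hsplit : ∀ x, κ x (Ioo a b) =
      ENNReal.ofReal ((κ x).real (Iio b) - (κ x).real (Iic a)) := by
    intro x
    have h : Ioo a b = Iio b \ Iic a := by ext t; simp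
    have hs : Iic a ⊆ Iio b := fun t (ht : t ≤ a) => ht.trans_lt hab
    rw [h, ← measureReal_sdiff hs measurableSet_Iic, ofReal_measureReal]
  simp only [hsplit] at hvol ⊢
  refine (lintegral_sub_antitone_le hα hα1 hD ?_ ?_ ?_ ?_).trans ?_
  · exact fun x y hxy => ENNReal.toReal_mono (measure_ne_top _ _) (hIic a hxy)
  · exact fun x y hxy => ENNReal.toReal_mono (measure_ne_top _ _) (hIio hxy)
  · exact fun x => measureReal_nonneg
  · exact fun x => measureReal_le_one
  · gcongr

/-! ### Stieltjes transforms -/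

/-- The Stieltjes transform `z ↦ ∫ (t - z)⁻¹ dm(t)`. -/
noncomputable def stieltjes (m : Measure ℝ) (z : ℂ) : ℂ := ∫ t, ((t : ℂ) - z)⁻¹ ∂m

/-- The imaginary part of `(t - x - iε)⁻¹`. -/
noncomputable def halfPlanePoisson (ε x t : ℝ) : ℝ := ε / ((x - t) ^ 2 + ε ^ 2)

theorem ofReal_sub_ne_zero {z : ℂ} (hz : z.im ≠ 0) (t : ℝ) : (t : ℂ) - z ≠ 0 := by
  intro h
  apply hz
  have := congrArg Complex.im h
  simpa using this

theorem norm_inv_ofReal_sub_le {z : ℂ} (hz : z.im ≠ 0) (t : ℝ) :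
    ‖((t : ℂ) - z)⁻¹‖ ≤ |z.im|⁻¹ := by
  rw [norm_inv]
  refine inv_anti₀ (abs_pos.2 hz) ?_
  simpa using Complex.abs_im_le_norm ((t : ℂ) - z)

theorem continuous_inv_ofReal_sub {z : ℂ} (hz : z.im ≠ 0) :
    Continuous fun t : ℝ => ((t : ℂ) - z)⁻¹ :=
  Continuous.inv₀ (by fun_prop) (ofReal_sub_ne_zero hz)

theorem integrable_inv_ofReal_sub (m : Measure ℝ) [IsFiniteMeasure m] {z : ℂ} (hz : z.im ≠ 0) :
    Integrable (fun t : ℝ => ((t : ℂ) - z)⁻¹) m :=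
  Integrable.of_bound (continuous_inv_ofReal_sub hz).aestronglyMeasurable |z.im|⁻¹
    (ae_of_all _ (norm_inv_ofReal_sub_le hz))

theorem im_inv_ofReal_sub (z : ℂ) (t : ℝ) :
    (((t : ℂ) - z)⁻¹).im = halfPlanePoisson z.im z.re t := by
  simp only [Complex.inv_im, halfPlanePoisson, Complex.normSq_apply, Complex.sub_im,
    Complex.ofReal_im, Complex.sub_re, Complex.ofReal_re]
  congr 1 <;> ring

theorem im_stieltjes (m : Measure ℝ) [IsFiniteMeasure m] {z : ℂ} (hz : z.im ≠ 0) :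
    (stieltjes m z).im = ∫ t, halfPlanePoisson z.im z.re t ∂m := by
  unfold stieltjes
  rw [← Complex.imCLM_apply, ← ContinuousLinearMap.integral_comp_comm _
    (integrable_inv_ofReal_sub m hz)]
  simp only [Complex.imCLM_apply, im_inv_ofReal_sub]

theorem halfPlanePoisson_pos {ε : ℝ} (hε : 0 < ε) (x t : ℝ) : 0 < halfPlanePoisson ε x t := by
  unfold halfPlanePoisson; positivity

theorem halfPlanePoisson_le {ε : ℝ} (hε : 0 < ε) (x t : ℝ) : halfPlanePoisson ε x t ≤ ε⁻¹ := by
  unfold halfPlanePoisson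
  rw [div_le_iff₀ (by positivity), inv_mul_eq_div, le_div_iff₀ hε]
  nlinarith [sq_nonneg (x - t)]

theorem continuous_halfPlanePoisson {ε : ℝ} (hε : 0 < ε) :
    Continuous fun p : ℝ × ℝ => halfPlanePoisson ε p.1 p.2 := by
  unfold halfPlanePoisson
  exact Continuous.div (by fun_prop) (by fun_prop) (fun p => by positivity)

theorem hasDerivAt_arctan_halfPlanePoisson {ε : ℝ} (hε : 0 < ε) (x t : ℝ) :
    HasDerivAt (fun x => Real.arctan ((x - t) / ε)) (halfPlanePoisson ε x t) x := by
  have h := (((hasDerivAt_id x).sub_const t).div_const ε).arctan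
  refine h.congr_deriv ?_
  unfold halfPlanePoisson
  simp only [id]
  have : (x - t) ^ 2 + ε ^ 2 ≠ 0 := by positivity
  field_simp
  ring

theorem tendsto_arctan_atBot {ε : ℝ} (hε : 0 < ε) (t : ℝ) :
    Tendsto (fun x => Real.arctan ((x - t) / ε)) atBot (𝓝 (-(Real.pi / 2))) := by
  refine (Real.tendsto_arctan_atBot.mono_right nhdsWithin_le_nhds).comp ?_
  exact (tendsto_atBot_add_const_right _ (-t) tendsto_id).atBot_div_const hε

theorem tendsto_arctan_atTop {ε : ℝ} (hε : 0 < ε) (t : ℝ) :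
    Tendsto (fun x => Real.arctan ((x - t) / ε)) atTop (𝓝 (Real.pi / 2)) := by
  refine (Real.tendsto_arctan_atTop.mono_right nhdsWithin_le_nhds).comp ?_
  exact (tendsto_atTop_add_const_right _ (-t) tendsto_id).atTop_div_const hε

theorem integrable_halfPlanePoisson {ε : ℝ} (hε : 0 < ε) (t : ℝ) :
    Integrable fun x => halfPlanePoisson ε x t :=
  by
  have h := (integrable_inv_one_add_sq.comp_div hε.ne').comp_sub_right t
  refine (h.const_mul ε⁻¹).congr (ae_of_all _ fun x => ?_)
  have : (x - t) ^ 2 + ε ^ 2 ≠ 0 := by positivity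
  simp only [halfPlanePoisson]
  field_simp
  ring

theorem integral_halfPlanePoisson {ε : ℝ} (hε : 0 < ε) (t : ℝ) :
    ∫ x, halfPlanePoisson ε x t = Real.pi := by
  rw [integral_of_hasDerivAt_of_tendsto (hasDerivAt_arctan_halfPlanePoisson hε · t)
    (integrable_halfPlanePoisson hε t) (tendsto_arctan_atBot hε t) (tendsto_arctan_atTop hε t)]
  ring

theorem integral_Iic_halfPlanePoisson {ε : ℝ} (hε : 0 < ε) (c t : ℝ) :
    ∫ x in Iic c, halfPlanePoisson ε x t = Real.arctan ((c - t) / ε) + Real.pi / 2 := by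
  rw [integral_Iic_of_hasDerivAt_of_tendsto'
    (fun x _ => hasDerivAt_arctan_halfPlanePoisson hε x t)
    (integrable_halfPlanePoisson hε t).integrableOn (tendsto_arctan_atBot hε t)]
  ring

theorem integrable_prod_halfPlanePoisson {ε : ℝ} (hε : 0 < ε) (m : Measure ℝ) [IsFiniteMeasure m] :
    Integrable (fun p : ℝ × ℝ => halfPlanePoisson ε p.1 p.2) (volume.prod m) := by
  rw [integrable_prod_iff' (continuous_halfPlanePoisson hε).aestronglyMeasurable]
  refine ⟨ae_of_all _ fun t => integrable_halfPlanePoisson hε t, ?_⟩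
  simp only [Real.norm_of_nonneg (halfPlanePoisson_pos hε _ _).le, integral_halfPlanePoisson hε]
  exact integrable_const _

/-- Integrating the imaginary part of the Stieltjes transform along a half-line gives a smoothed
distribution function. -/
theorem integral_Iic_im_stieltjes (m : Measure ℝ) [IsFiniteMeasure m] {ε : ℝ} (hε : 0 < ε)
    (c : ℝ) : ∫ x in Iic c, (stieltjes m ⟨x, ε⟩).im =
      ∫ t, (Real.arctan ((c - t) / ε) + Real.pi / 2) ∂m := by
  simp only [im_stieltjes m (z := ⟨_, ε⟩) hε.ne']
  rw [integral_integral_swap]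
  · simp only [integral_Iic_halfPlanePoisson hε]
  · exact (integrable_prod_halfPlanePoisson hε m).mono_measure
      (Measure.prod_mono Measure.restrict_le_self le_rfl)

theorem integrable_im_stieltjes (m : Measure ℝ) [IsFiniteMeasure m] {ε : ℝ} (hε : 0 < ε) :
    Integrable fun x : ℝ => (stieltjes m ⟨x, ε⟩).im := by
  simp only [im_stieltjes m (z := ⟨_, ε⟩) hε.ne']
  exact (integrable_prod_halfPlanePoisson hε m).integral_prod_left

/-- The limit is π/2 times the sign of y, written with indicators so that integration yields masses
of half-lines. -/
theorem tendsto_arctan_div_nhdsGT_zero (y : ℝ) :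
    Tendsto (fun n : ℕ => Real.arctan (y / (1 / (n + 1)))) atTop
      (𝓝 (Real.pi / 2 * ((Ioi (0 : ℝ)).indicator 1 y + (Ici (0 : ℝ)).indicator 1 y - 1))) := by
  have h1 : Tendsto (fun n : ℕ => (n : ℝ) + 1) atTop atTop :=
    tendsto_atTop_add_const_right _ _ tendsto_natCast_atTop_atTop
  simp only [div_div_eq_mul_div, div_one]
  rcases lt_trichotomy y 0 with hy | hy | hy
  · have := (Real.tendsto_arctan_atBot.mono_right nhdsWithin_le_nhds).comp
      (h1.const_mul_atTop_of_neg hy)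
    simpa [hy.le, hy.not_ge, hy.not_gt, Function.comp_def] using this
  · simp [hy]
  · have := (Real.tendsto_arctan_atTop.mono_right nhdsWithin_le_nhds).comp
      (h1.const_mul_atTop hy)
    simpa [hy.le, hy, Function.comp_def] using this

theorem abs_arctan_le (y : ℝ) : |Real.arctan y| ≤ Real.pi / 2 :=
  abs_le.2 ⟨(Real.neg_pi_div_two_lt_arctan y).le, (Real.arctan_lt_pi_div_two y).le⟩

/-- At an atom the smoothing converges to the midpoint of the jump, hence the sum of the open and
the closed half-line. -/
theorem tendsto_smoothed_cdf (m : Measure ℝ) [IsProbabilityMeasure m] (c : ℝ) :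
    Tendsto (fun n : ℕ => ∫ t, (Real.arctan ((c - t) / (1 / (n + 1))) + Real.pi / 2) ∂m) atTop
      (𝓝 (Real.pi / 2 * (m.real (Iio c) + m.real (Iic c)))) := by
  have hlim : Real.pi / 2 * (m.real (Iio c) + m.real (Iic c)) =
      ∫ t, (Real.pi / 2 * ((Ioi (0 : ℝ)).indicator 1 (c - t) +
        (Ici (0 : ℝ)).indicator 1 (c - t) - 1) + Real.pi / 2) ∂m := by
    have h1 : ∀ t : ℝ, Real.pi / 2 * ((Ioi (0 : ℝ)).indicator 1 (c - t) +
        (Ici (0 : ℝ)).indicator 1 (c - t) - 1) + Real.pi / 2 =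
        Real.pi / 2 * ((Iio c).indicator 1 t + (Iic c).indicator 1 t) := by
      intro t
      simp only [indicator_apply, mem_Ioi, mem_Ici, mem_Iio, mem_Iic, sub_pos, sub_nonneg,
        Pi.one_apply]
      ring
    simp only [h1]
    rw [integral_const_mul, integral_add]
    · rw [integral_indicator_one measurableSet_Iio, integral_indicator_one measurableSet_Iic]
    · exact (integrable_const (1 : ℝ)).indicator measurableSet_Iio
    · exact (integrable_const (1 : ℝ)).indicator measurableSet_Iic
  rw [hlim]
  refine tendsto_integral_of_dominated_convergence (fun _ => Real.pi)
    (fun n => ?_) (integrable_const _) (fun n => ae_of_all _ fun t => ?_)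
    (ae_of_all _ fun t => (tendsto_arctan_div_nhdsGT_zero (c - t)).add_const _)
  · exact (Continuous.add (Real.continuous_arctan.comp (by fun_prop))
      continuous_const).aestronglyMeasurable
  · refine (norm_add_le _ _).trans ?_
    rw [Real.norm_of_nonneg (by positivity : 0 ≤ Real.pi / 2)]
    have := abs_arctan_le ((c - t) / (1 / (n + 1)))
    rw [Real.norm_eq_abs]
    linarith

theorem tendsto_integral_Iic_im_stieltjes (m : Measure ℝ) [IsProbabilityMeasure m] (c : ℝ) :
    Tendsto (fun n : ℕ => ∫ x in Iic c, (stieltjes m ⟨x, 1 / (n + 1)⟩).im) atTop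
      (𝓝 (Real.pi / 2 * (m.real (Iio c) + m.real (Iic c)))) := by
  simp only [integral_Iic_im_stieltjes m (Nat.one_div_pos_of_nat)]
  exact tendsto_smoothed_cdf m c

theorem tendsto_measureReal_Iic_add (m : Measure ℝ) [IsProbabilityMeasure m] (c : ℝ) :
    Tendsto (fun n : ℕ => m.real (Iic (c + 1 / (n + 1)))) atTop (𝓝 (m.real (Iic c))) := by
  have hI : Iic c = ⋂ n : ℕ, Iic (c + 1 / ((n : ℝ) + 1)) := by
    ext t
    simp only [mem_Iic, mem_iInter]
    refine ⟨fun h n => h.trans (by linarith [Nat.one_div_pos_of_nat (α := ℝ) (n := n)]), fun h => ?_⟩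
    refine ge_of_tendsto' (x := atTop) (f := fun n : ℕ => c + 1 / ((n : ℝ) + 1)) ?_ h
    simpa using (tendsto_one_div_add_atTop_nhds_zero_nat (𝕜 := ℝ)).const_add c
  have hm : Antitone fun n : ℕ => Iic (c + 1 / ((n : ℝ) + 1)) := by
    intro i j hij
    exact Iic_subset_Iic.2 (add_le_add_right (Nat.one_div_le_one_div hij) _)
  have := tendsto_measure_iInter_atTop (μ := m) (fun n => measurableSet_Iic.nullMeasurableSet)
    hm ⟨0, measure_ne_top _ _⟩
  rw [← hI] at this
  exact (ENNReal.tendsto_toReal (measure_ne_top _ _)).comp this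

/-! ### Stochastic monotonicity under rank one perturbations -/

/-- Arithmetic-geometric mean inequality together with |1/(s - z)|² = Im (1/(s - z)) / ε. This is
the integrable majorant for Fubini's theorem. -/
theorem im_inv_mul_inv_le (s t x : ℝ) {ε : ℝ} (hε : 0 < ε) :
    ‖(((s : ℂ) - ⟨x, ε⟩)⁻¹ * ((t : ℂ) - ⟨x, ε⟩)⁻¹).im‖ ≤
      (2 * ε)⁻¹ * (halfPlanePoisson ε x s + halfPlanePoisson ε x t) := by
  have hsq : ∀ s : ℝ, ‖((s : ℂ) - ⟨x, ε⟩)⁻¹‖ ^ 2 = ε⁻¹ * halfPlanePoisson ε x s := by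
    intro s
    have h1 : (x - s) ^ 2 + ε ^ 2 ≠ 0 := by positivity
    rw [norm_inv, inv_pow, ← Complex.normSq_eq_norm_sq, Complex.normSq_apply, halfPlanePoisson]
    simp only [Complex.sub_re, Complex.ofReal_re, Complex.sub_im, Complex.ofReal_im]
    rw [show (s - x) * (s - x) + (0 - ε) * (0 - ε) = (x - s) ^ 2 + ε ^ 2 by ring]
    field_simp
  refine (Complex.abs_im_le_norm _).trans ?_
  rw [norm_mul]
  have h := two_mul_le_add_sq ‖((s : ℂ) - ⟨x, ε⟩)⁻¹‖ ‖((t : ℂ) - ⟨x, ε⟩)⁻¹‖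
  rw [hsq, hsq] at h
  rw [mul_inv]
  linarith

theorem continuous_mk_const (ε : ℝ) : Continuous fun x : ℝ => (⟨x, ε⟩ : ℂ) := by
  have : (fun x : ℝ => (⟨x, ε⟩ : ℂ)) = fun x : ℝ => (x : ℂ) + ε * Complex.I := by
    ext x
    exact Complex.mk_eq_add_mul_I x ε
  rw [this]
  fun_prop

theorem continuous_im_inv_mul_inv {ε : ℝ} (hε : 0 < ε) :
    Continuous fun p : ℝ × ℝ × ℝ =>
      (((p.2.1 : ℂ) - ⟨p.1, ε⟩)⁻¹ * ((p.2.2 : ℂ) - ⟨p.1, ε⟩)⁻¹).im := by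
  have h := (continuous_mk_const ε).comp (continuous_fst (X := ℝ) (Y := ℝ × ℝ))
  refine Complex.continuous_im.comp (Continuous.mul ?_ ?_)
  · exact Continuous.inv₀ (Continuous.sub (by fun_prop) h)
      fun p => ofReal_sub_ne_zero (z := ⟨p.1, ε⟩) hε.ne' _
  · exact Continuous.inv₀ (Continuous.sub (by fun_prop) h)
      fun p => ofReal_sub_ne_zero (z := ⟨p.1, ε⟩) hε.ne' _

theorem integrable_im_inv_mul_inv {ε : ℝ} (hε : 0 < ε) (s t : ℝ) :
    Integrable fun x : ℝ => (((s : ℂ) - ⟨x, ε⟩)⁻¹ * ((t : ℂ) - ⟨x, ε⟩)⁻¹).im := by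
  refine Integrable.mono' (((integrable_halfPlanePoisson hε s).add
    (integrable_halfPlanePoisson hε t)).const_mul (2 * ε)⁻¹) ?_
    (ae_of_all _ fun x => im_inv_mul_inv_le s t x hε)
  exact ((continuous_im_inv_mul_inv hε).comp
    (Continuous.prodMk_left (s, t))).aestronglyMeasurable

/-- For s ≠ t partial fractions turn the integral into a difference quotient of the increasing
function arctan. For s = t the integrand is the derivative of the Poisson kernel, which vanishes at
-∞ and is positive at c. -/
theorem integral_Iic_im_inv_mul_inv_nonneg {ε : ℝ} (hε : 0 < ε) (c s t : ℝ) :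
    0 ≤ ∫ x in Iic c, (((s : ℂ) - ⟨x, ε⟩)⁻¹ * ((t : ℂ) - ⟨x, ε⟩)⁻¹).im := by
  have hne : ∀ x t : ℝ, (t : ℂ) - ⟨x, ε⟩ ≠ 0 := fun x t =>
    ofReal_sub_ne_zero (z := ⟨x, ε⟩) hε.ne' t
  rcases eq_or_ne s t with rfl | hst
  · have hderiv : ∀ x : ℝ, HasDerivAt (fun x => halfPlanePoisson ε x s)
        (((s : ℂ) - ⟨x, ε⟩)⁻¹ * ((s : ℂ) - ⟨x, ε⟩)⁻¹).im x := by
      intro x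
      have h1 : (x - s) ^ 2 + ε ^ 2 ≠ 0 := by positivity
      have h := (((((hasDerivAt_id x).sub_const s).pow 2).add_const (ε ^ 2)).inv h1).const_mul ε
      refine h.congr_deriv ?_
      simp only [Complex.mul_im, Complex.inv_im, Complex.inv_re, Complex.normSq_apply,
        Complex.sub_re, Complex.ofReal_re, Complex.sub_im, Complex.ofReal_im, id]
      rw [show (s - x) * (s - x) + (0 - ε) * (0 - ε) = (x - s) ^ 2 + ε ^ 2 by ring]
      simp only [Pi.pow_apply]
      field_simp
      push_cast
      ring
    have hlim : Tendsto (fun x => halfPlanePoisson ε x s) atBot (𝓝 0) := by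
      have h1 : Tendsto (fun x : ℝ => (x - s) ^ 2) atBot atTop := by
        have := (tendsto_pow_atTop (α := ℝ) two_ne_zero).comp
          (tendsto_neg_atBot_atTop.comp (tendsto_atBot_add_const_right atBot (-s) tendsto_id))
        refine this.congr fun x => ?_
        simp only [Function.comp, id]
        ring
      exact (tendsto_atTop_add_const_right _ (ε ^ 2) h1).const_div_atTop ε
    rw [integral_Iic_of_hasDerivAt_of_tendsto' (fun x _ => hderiv x)
      (integrable_im_inv_mul_inv hε s s).integrableOn hlim, sub_zero]
    exact (halfPlanePoisson_pos hε c s).le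
  · have hts : t - s ≠ 0 := sub_ne_zero.2 hst.symm
    have h : ∀ x : ℝ, (((s : ℂ) - ⟨x, ε⟩)⁻¹ * ((t : ℂ) - ⟨x, ε⟩)⁻¹).im =
        (t - s)⁻¹ * (halfPlanePoisson ε x s - halfPlanePoisson ε x t) := by
      intro x
      have h2 : ((s : ℂ) - ⟨x, ε⟩)⁻¹ * ((t : ℂ) - ⟨x, ε⟩)⁻¹ =
          (((t - s)⁻¹ : ℝ) : ℂ) * (((s : ℂ) - ⟨x, ε⟩)⁻¹ - ((t : ℂ) - ⟨x, ε⟩)⁻¹) := by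
        have hts' : (t : ℂ) - s ≠ 0 := by exact_mod_cast hts
        have h3 := hne x s
        have h4 := hne x t
        push_cast
        field_simp
        ring
      rw [h2, Complex.im_ofReal_mul, Complex.sub_im, im_inv_ofReal_sub, im_inv_ofReal_sub]
    simp only [h]
    rw [integral_const_mul, integral_sub (integrable_halfPlanePoisson hε s).integrableOn
      (integrable_halfPlanePoisson hε t).integrableOn, integral_Iic_halfPlanePoisson hε,
      integral_Iic_halfPlanePoisson hε]
    rcases hst.lt_or_gt with hlt | hlt
    · refine mul_nonneg (inv_nonneg.2 (by linarith)) ?_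
      have : Real.arctan ((c - t) / ε) ≤ Real.arctan ((c - s) / ε) :=
        Real.arctan_strictMono.monotone (by gcongr)
      linarith
    · refine mul_nonneg_of_nonpos_of_nonpos (inv_nonpos.2 (by linarith)) ?_
      have : Real.arctan ((c - s) / ε) ≤ Real.arctan ((c - t) / ε) :=
        Real.arctan_strictMono.monotone (by gcongr)
      linarith

/-- The product of two Stieltjes transforms is a double integral of products of kernels, and
Fubini's theorem reduces the sign to that of a single pair (s, t). -/
theorem integral_Iic_im_stieltjes_mul_nonneg (m₁ m₂ : Measure ℝ) [IsFiniteMeasure m₁]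
    [IsFiniteMeasure m₂] {ε : ℝ} (hε : 0 < ε) (c : ℝ) :
    0 ≤ ∫ x in Iic c, (stieltjes m₁ ⟨x, ε⟩ * stieltjes m₂ ⟨x, ε⟩).im := by
  have h : ∀ x : ℝ, (stieltjes m₁ ⟨x, ε⟩ * stieltjes m₂ ⟨x, ε⟩).im =
      ∫ p : ℝ × ℝ, (((p.1 : ℂ) - ⟨x, ε⟩)⁻¹ * ((p.2 : ℂ) - ⟨x, ε⟩)⁻¹).im ∂(m₁.prod m₂) := by
    intro x
    unfold stieltjes
    have hi := (integrable_inv_ofReal_sub m₁ (z := ⟨x, ε⟩) hε.ne').mul_prod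
      (integrable_inv_ofReal_sub m₂ (z := ⟨x, ε⟩) hε.ne')
    rw [← integral_prod_mul, ← Complex.imCLM_apply,
      ← ContinuousLinearMap.integral_comp_comm _ hi]
    rfl
  simp only [h]
  rw [integral_integral_swap]
  · exact integral_nonneg fun p => integral_Iic_im_inv_mul_inv_nonneg hε c p.1 p.2
  · have hdom : Integrable (fun q : ℝ × ℝ × ℝ => (2 * ε)⁻¹ *
        (halfPlanePoisson ε q.1 q.2.1 + halfPlanePoisson ε q.1 q.2.2))
        (volume.prod (m₁.prod m₂)) := by
      refine Integrable.const_mul ?_ _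
      rw [integrable_prod_iff']
      · refine ⟨ae_of_all _ fun t => (integrable_halfPlanePoisson hε t.1).add
          (integrable_halfPlanePoisson hε t.2), ?_⟩
        refine (integrable_const (2 * Real.pi)).congr (ae_of_all _ fun t => ?_)
        simp only [Real.norm_of_nonneg (add_nonneg (halfPlanePoisson_pos hε _ _).le
          (halfPlanePoisson_pos hε _ _).le)]
        rw [integral_add (integrable_halfPlanePoisson hε t.1)
          (integrable_halfPlanePoisson hε t.2), integral_halfPlanePoisson hε,
          integral_halfPlanePoisson hε]
        ring
      · have h1 := (continuous_halfPlanePoisson hε).comp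
          (continuous_fst.prodMk (continuous_fst.comp continuous_snd) :
            Continuous fun q : ℝ × ℝ × ℝ => (q.1, q.2.1))
        have h2 := (continuous_halfPlanePoisson hε).comp
          (continuous_fst.prodMk (continuous_snd.comp continuous_snd) :
            Continuous fun q : ℝ × ℝ × ℝ => (q.1, q.2.2))
        exact (h1.add h2).aestronglyMeasurable
    refine Integrable.mono_measure (Integrable.mono' hdom
      (continuous_im_inv_mul_inv hε).aestronglyMeasurable
      (ae_of_all _ fun q => im_inv_mul_inv_le q.2.1 q.2.2 q.1 hε)) ?_
    exact Measure.prod_mono Measure.restrict_le_self le_rfl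

/-- If the Stieltjes transforms satisfy the resolvent identity of a nonnegative rank one
perturbation, then the perturbed measure dominates the unperturbed one stochastically. -/
theorem measure_Iic_le_of_stieltjes {m₁ m₂ : Measure ℝ} [IsProbabilityMeasure m₁]
    [IsProbabilityMeasure m₂] {δ : ℝ} (hδ : 0 ≤ δ)
    (h : ∀ z : ℂ, 0 < z.im → stieltjes m₁ z - stieltjes m₂ z =
      -(δ * (stieltjes m₁ z * stieltjes m₂ z))) (c : ℝ) :
    m₁ (Iic c) ≤ m₂ (Iic c) := by
  have h1 : ∀ c ε : ℝ, 0 < ε → ∫ x in Iic c, (stieltjes m₁ ⟨x, ε⟩).im ≤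
      ∫ x in Iic c, (stieltjes m₂ ⟨x, ε⟩).im := by
    intro c ε hε
    rw [← sub_nonpos, ← integral_sub (integrable_im_stieltjes m₁ hε).integrableOn
      (integrable_im_stieltjes m₂ hε).integrableOn]
    simp only [← Complex.sub_im, h ⟨_, ε⟩ hε, Complex.neg_im, Complex.im_ofReal_mul]
    rw [integral_neg, integral_const_mul]
    exact neg_nonpos.2 (mul_nonneg hδ (integral_Iic_im_stieltjes_mul_nonneg m₁ m₂ hε c))
  have h2 : ∀ c, m₁.real (Iio c) + m₁.real (Iic c) ≤ m₂.real (Iio c) + m₂.real (Iic c) := by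
    intro c
    have := le_of_tendsto_of_tendsto' (tendsto_integral_Iic_im_stieltjes m₁ c)
      (tendsto_integral_Iic_im_stieltjes m₂ c) fun n => h1 c _ Nat.one_div_pos_of_nat
    exact le_of_mul_le_mul_left this (by positivity)
  rw [← ENNReal.toReal_le_toReal (measure_ne_top _ _) (measure_ne_top _ _)]
  -- The limit only compares midpoints of jumps. Moving to c + 1/(n+1) puts the closed half-line up
  -- to c below both terms for m₁, and right continuity brings m₂ back to c.
  refine ge_of_tendsto' (tendsto_measureReal_Iic_add m₂ c) fun n => ?_
  have hn : (0 : ℝ) < 1 / (n + 1) := Nat.one_div_pos_of_nat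
  have h3 : m₁.real (Iic c) ≤ m₁.real (Iio (c + 1 / (n + 1))) :=
    measureReal_mono fun t (ht : t ≤ c) => by
      simp only [mem_Iio]; linarith
  have h4 : m₁.real (Iic c) ≤ m₁.real (Iic (c + 1 / (n + 1))) :=
    measureReal_mono fun t (ht : t ≤ c) => by
      simp only [mem_Iic]; linarith
  have h5 : m₂.real (Iio (c + 1 / (n + 1))) ≤ m₂.real (Iic (c + 1 / (n + 1))) :=
    measureReal_mono Iio_subset_Iic_self
  have := h2 (c + 1 / (n + 1))
  change m₁.real (Iic c) ≤ _
  linarith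

/-! ### Measurability of families of measures, and spectral averaging -/

theorem continuous_stieltjes_mk (m : Measure ℝ) [IsFiniteMeasure m] {ε : ℝ} (hε : 0 < ε) :
    Continuous fun x : ℝ => stieltjes m ⟨x, ε⟩ := by
  refine continuous_of_dominated (bound := fun _ => |ε|⁻¹) (fun x => ?_) (fun x => ?_)
    (integrable_const _) (ae_of_all _ fun t => ?_)
  · exact (continuous_inv_ofReal_sub (z := ⟨x, ε⟩) hε.ne').aestronglyMeasurable
  · exact ae_of_all _ fun t => norm_inv_ofReal_sub_le (z := ⟨x, ε⟩) hε.ne' t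
  · exact Continuous.inv₀ (continuous_const.sub (continuous_mk_const ε))
      fun x => ofReal_sub_ne_zero (z := ⟨x, ε⟩) hε.ne' t

/-- A family of probability measures is measurable as soon as its Stieltjes transforms are. -/
theorem measurable_of_measurable_stieltjes {X : Type*} [MeasurableSpace X] (κ : X → Measure ℝ)
    [∀ x, IsProbabilityMeasure (κ x)]
    (h : ∀ z : ℂ, 0 < z.im → Measurable fun x => stieltjes (κ x) z) : Measurable κ := by
  -- A function continuous in one variable and measurable in the other is jointly measurable, so its
  -- integrals over half-lines are measurable in x.
  have hjoint : ∀ ε : ℝ, 0 < ε →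
      StronglyMeasurable fun p : X × ℝ => (stieltjes (κ p.1) ⟨p.2, ε⟩).im := by
    intro ε hε
    have h1 := stronglyMeasurable_uncurry_of_continuous_of_stronglyMeasurable
      (u := fun (y : ℝ) (x : X) => (stieltjes (κ x) ⟨y, ε⟩).im)
      (fun x => Complex.continuous_im.comp (continuous_stieltjes_mk (κ x) hε))
      (fun y => (Complex.measurable_im.comp (h ⟨y, ε⟩ hε)).stronglyMeasurable)
    exact h1.comp_measurable measurable_swap
  have hmid : ∀ c : ℝ, Measurable fun x => (κ x).real (Iio c) + (κ x).real (Iic c) := by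
    intro c
    have hm : Measurable fun x => Real.pi / 2 * ((κ x).real (Iio c) + (κ x).real (Iic c)) := by
      refine measurable_of_tendsto_metrizable (f := fun (n : ℕ) x =>
        ∫ y in Iic c, (stieltjes (κ x) ⟨y, 1 / (n + 1)⟩).im) (fun n => ?_)
        (tendsto_pi_nhds.2 fun x => tendsto_integral_Iic_im_stieltjes (κ x) c)
      exact (hjoint _ Nat.one_div_pos_of_nat).integral_prod_right.measurable
    have h2 := hm.const_mul (Real.pi / 2)⁻¹
    refine (congrArg Measurable ?_).mp h2
    funext x
    rw [inv_mul_cancel_left₀ (by positivity)]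
  have hIic : ∀ c : ℝ, Measurable fun x => (κ x).real (Iic c) := by
    intro c
    -- Midpoints evaluated just to the right of c are squeezed between the values of the
    -- distribution function at c and at c + 1/(n+1), hence converge to its value at c.
    refine measurable_of_tendsto_metrizable (f := fun (n : ℕ) x =>
      2⁻¹ * ((κ x).real (Iio (c + 1 / (n + 1))) + (κ x).real (Iic (c + 1 / (n + 1)))))
      (fun n => (hmid _).const_mul _) (tendsto_pi_nhds.2 fun x => ?_)
    have hU := tendsto_measureReal_Iic_add (κ x) c
    refine tendsto_of_tendsto_of_tendsto_of_le_of_le tendsto_const_nhds hU (fun n => ?_)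
      (fun n => ?_)
    · have hn : (0 : ℝ) < 1 / (n + 1) := Nat.one_div_pos_of_nat
      have h3 : (κ x).real (Iic c) ≤ (κ x).real (Iio (c + 1 / (n + 1))) :=
        measureReal_mono fun t (ht : t ≤ c) => by
          simp only [mem_Iio]; linarith
      have h5 : (κ x).real (Iio (c + 1 / (n + 1))) ≤ (κ x).real (Iic (c + 1 / (n + 1))) :=
        measureReal_mono Iio_subset_Iic_self
      simp only
      linarith
    · have h5 : (κ x).real (Iio (c + 1 / (n + 1))) ≤ (κ x).real (Iic (c + 1 / (n + 1))) :=
        measureReal_mono Iio_subset_Iic_self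
      simp only
      linarith
  refine Measurable.measure_of_isPiSystem_of_isProbabilityMeasure
    (borel_eq_generateFrom_Iic ℝ ▸ BorelSpace.measurable_eq) isPiSystem_Iic ?_
  rintro _ ⟨c, rfl⟩
  refine (congrArg Measurable ?_).mp (hIic c).ennreal_ofReal
  funext x
  exact ofReal_measureReal

theorem stieltjes_im_pos (m : Measure ℝ) [IsProbabilityMeasure m] {z : ℂ} (hz : 0 < z.im) :
    0 < (stieltjes m z).im := by
  rw [im_stieltjes m hz.ne']
  have hc : Continuous fun t => halfPlanePoisson z.im z.re t :=
    (continuous_halfPlanePoisson hz).comp (Continuous.prodMk_right z.re)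
  rw [integral_pos_iff_support_of_nonneg (fun t => (halfPlanePoisson_pos hz _ t).le)]
  · rw [Function.support_eq_univ fun t => (halfPlanePoisson_pos hz _ t).ne']
    simp
  · refine Integrable.of_bound hc.aestronglyMeasurable z.im⁻¹ (ae_of_all _ fun t => ?_)
    rw [Real.norm_of_nonneg (halfPlanePoisson_pos hz _ t).le]
    exact halfPlanePoisson_le hz _ _

theorem tendsto_integral_Ioc_im_stieltjes (m : Measure ℝ) [IsProbabilityMeasure m] {a b : ℝ}
    (hab : a ≤ b) :
    Tendsto (fun n : ℕ => ∫ x in Ioc a b, (stieltjes m ⟨x, 1 / (n + 1)⟩).im) atTop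
      (𝓝 (Real.pi / 2 * (m.real (Iio b) + m.real (Iic b)) -
        Real.pi / 2 * (m.real (Iio a) + m.real (Iic a)))) := by
  refine ((tendsto_integral_Iic_im_stieltjes m b).sub
    (tendsto_integral_Iic_im_stieltjes m a)).congr fun n => ?_
  have hi := integrable_im_stieltjes m (ε := 1 / (n + 1)) Nat.one_div_pos_of_nat
  rw [intervalIntegral.integral_Iic_sub_Iic hi.integrableOn hi.integrableOn,
    intervalIntegral.integral_of_le hab]

/-- Spectral averaging: if the Stieltjes transforms satisfy the resolvent identity of a rank one
perturbation, the average of the measures over the coupling is at most Lebesgue measure. -/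
theorem lintegral_measure_Ioo_le_of_stieltjes (κ : ℝ → Measure ℝ)
    [∀ x, IsProbabilityMeasure (κ x)]
    (h : ∀ x y : ℝ, ∀ z : ℂ, 0 < z.im → stieltjes (κ x) z - stieltjes (κ y) z =
      -((x - y : ℝ) * (stieltjes (κ x) z * stieltjes (κ y) z))) {a b : ℝ} (hab : a < b) :
    ∫⁻ x, κ x (Ioo a b) ≤ ENNReal.ofReal (b - a) := by
  -- The identity with y = 0 reads F_x (1 + x F_0) = F_0, that is F_x = 1/(x - w). Since w has
  -- positive imaginary part, Im F_x is a Poisson kernel in the coupling x, of total mass π.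
  set w : ℂ → ℂ := fun z => -(stieltjes (κ 0) z)⁻¹
  have hne : ∀ x : ℝ, ∀ z : ℂ, 0 < z.im → stieltjes (κ x) z ≠ 0 := by
    intro x z hz h0
    have := stieltjes_im_pos (κ x) hz
    simp [h0] at this
  have hw : ∀ z : ℂ, 0 < z.im → 0 < (w z).im := by
    intro z hz
    have h1 := stieltjes_im_pos (κ 0) hz
    have h2 : 0 < Complex.normSq (stieltjes (κ 0) z) := Complex.normSq_pos.2 (hne 0 z hz)
    simp only [w, Complex.neg_im, Complex.inv_im, neg_div, neg_neg]
    positivity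
  have hG : ∀ x : ℝ, ∀ z : ℂ, 0 < z.im → stieltjes (κ x) z = ((x : ℂ) - w z)⁻¹ := by
    intro x z hz
    have h1 := h x 0 z hz
    have h2 := hne 0 z hz
    have h3 := hne x z hz
    refine eq_inv_of_mul_eq_one_left ?_
    simp only [w, sub_neg_eq_add]
    push_cast at h1
    field_simp
    linear_combination h1
  have him : ∀ x : ℝ, ∀ z : ℂ, 0 < z.im → (stieltjes (κ x) z).im =
      halfPlanePoisson (w z).im (w z).re x := by
    intro x z hz
    rw [hG x z hz, im_inv_ofReal_sub]
  have hsymm : ∀ ε x t : ℝ, halfPlanePoisson ε x t = halfPlanePoisson ε t x := by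
    intro ε x t
    unfold halfPlanePoisson
    congr 2
    ring
  have hmass : ∀ z : ℂ, 0 < z.im →
      ∫⁻ x, ENNReal.ofReal (stieltjes (κ x) z).im = ENNReal.ofReal Real.pi := by
    intro z hz
    simp only [him _ z hz, hsymm _ (w z).re]
    rw [← ofReal_integral_eq_lintegral_ofReal (integrable_halfPlanePoisson (hw z hz) _)
      (ae_of_all _ fun x => (halfPlanePoisson_pos (hw z hz) _ _).le),
      integral_halfPlanePoisson (hw z hz)]
  have hmeas : ∀ ε : ℝ, 0 < ε →
      Measurable fun p : ℝ × ℝ => ENNReal.ofReal (stieltjes (κ p.1) ⟨p.2, ε⟩).im := by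
    intro ε hε
    have hcont : Continuous fun p : ℝ × ℝ => ((p.1 : ℂ) - w ⟨p.2, ε⟩)⁻¹.im := by
      refine Complex.continuous_im.comp (Continuous.inv₀ (Continuous.sub (by fun_prop) ?_) ?_)
      · exact (Continuous.inv₀ ((continuous_stieltjes_mk (κ 0) hε).comp continuous_snd)
          fun p => hne 0 ⟨p.2, ε⟩ hε).neg
      · exact fun p => ofReal_sub_ne_zero (hw ⟨p.2, ε⟩ hε).ne' _
    refine (congrArg Measurable ?_).mp hcont.measurable.ennreal_ofReal
    funext p
    rw [hG p.1 ⟨p.2, ε⟩ hε]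
  -- The limit is a difference of midpoints of jumps at b and a, which dominates the mass of the
  -- open interval; so atoms at a and b do no harm.
  have hpt : ∀ x, κ x (Ioo a b) ≤ liminf (fun n : ℕ => ∫⁻ y in Ioc a b,
      (ENNReal.ofReal Real.pi)⁻¹ * ENNReal.ofReal (stieltjes (κ x) ⟨y, 1 / (n + 1)⟩).im) atTop := by
    intro x
    have hpi : ENNReal.ofReal Real.pi ≠ 0 := by simp [Real.pi_pos]
    have h1 := (ENNReal.tendsto_ofReal (tendsto_integral_Ioc_im_stieltjes (κ x) hab.le))
    have h2 := ENNReal.Tendsto.const_mul (a := (ENNReal.ofReal Real.pi)⁻¹) h1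
      (Or.inr (ENNReal.inv_ne_top.2 hpi))
    have h3 : ∀ n : ℕ, (ENNReal.ofReal Real.pi)⁻¹ *
        ENNReal.ofReal (∫ y in Ioc a b, (stieltjes (κ x) ⟨y, 1 / (n + 1)⟩).im) =
        ∫⁻ y in Ioc a b, (ENNReal.ofReal Real.pi)⁻¹ *
          ENNReal.ofReal (stieltjes (κ x) ⟨y, 1 / (n + 1)⟩).im := by
      intro n
      rw [lintegral_const_mul' _ _ (ENNReal.inv_ne_top.2 hpi),
        ofReal_integral_eq_lintegral_ofReal]
      · exact (integrable_im_stieltjes _ Nat.one_div_pos_of_nat).integrableOn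
      · exact ae_of_all _ fun y => (stieltjes_im_pos _ (z := ⟨y, _⟩) Nat.one_div_pos_of_nat).le
    simp only [h3] at h2
    rw [h2.liminf_eq]
    have h4 : (κ x).real (Ioo a b) = (κ x).real (Iio b) - (κ x).real (Iic a) := by
      have hs : Iic a ⊆ Iio b := fun t (ht : t ≤ a) => ht.trans_lt hab
      rw [← measureReal_sdiff hs measurableSet_Iic]
      congr 1
      ext t; simp
    have h5 : (κ x).real (Iio b) ≤ (κ x).real (Iic b) := measureReal_mono Iio_subset_Iic_self
    have h6 : (κ x).real (Iio a) ≤ (κ x).real (Iic a) := measureReal_mono Iio_subset_Iic_self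
    rw [← ENNReal.ofReal_inv_of_pos Real.pi_pos, ← ENNReal.ofReal_mul (by positivity),
      ← ofReal_measureReal (μ := κ x), h4]
    refine ENNReal.ofReal_le_ofReal ?_
    rw [← mul_sub, ← mul_assoc, show Real.pi⁻¹ * (Real.pi / 2) = 2⁻¹ by field_simp]
    linarith
  -- Fatou's lemma. After exchanging the integrals, each term of the sequence is exactly b - a, by
  -- the mass formula in x.
  refine (lintegral_mono hpt).trans ((lintegral_liminf_le fun n => ?_).trans ?_)
  · exact Measurable.lintegral_prod_right ((hmeas _ Nat.one_div_pos_of_nat).const_mul _)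
  · refine liminf_le_of_le (by isBoundedDefault) fun l hl => ?_
    obtain ⟨n, hn⟩ := hl.exists
    refine hn.trans ?_
    rw [lintegral_lintegral_swap ((hmeas _ Nat.one_div_pos_of_nat).const_mul _).aemeasurable]
    have hpi : ENNReal.ofReal Real.pi ≠ 0 := by simp [Real.pi_pos]
    have h1 : ∀ y : ℝ, ∫⁻ x, (ENNReal.ofReal Real.pi)⁻¹ *
        ENNReal.ofReal (stieltjes (κ x) ⟨y, 1 / (n + 1)⟩).im = 1 := by
      intro y
      rw [lintegral_const_mul' _ _ (ENNReal.inv_ne_top.2 hpi), hmass ⟨y, _⟩ Nat.one_div_pos_of_nat,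
        ENNReal.inv_mul_cancel hpi ENNReal.ofReal_ne_top]
    simp only [h1]
    simp

section Resolvent

/-! ### Resolvents of unbounded self-adjoint operators -/

variable {H : Type*} [NormedAddCommGroup H] [InnerProductSpace ℂ H] [CompleteSpace H]

namespace LinearPMap

variable {T : H →ₗ.[ℂ] H}

theorem inner_apply_comm (hT : IsSelfAdjoint T) (x y : T.domain) :
    inner ℂ (T x) (y : H) = inner ℂ (x : H) (T y) := by
  have h := adjoint_isFormalAdjoint hT.dense_domain
  rw [isSelfAdjoint_def.1 hT] at h
  exact h x y

theorem exists_mem_domain_apply_eq (hT : IsSelfAdjoint T) {y w : H}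
    (h : ∀ x : T.domain, inner ℂ w (x : H) = inner ℂ y (T x)) :
    ∃ hy : y ∈ T.domain, T ⟨y, hy⟩ = w := by
  have hy : y ∈ T.adjoint.domain := mem_adjoint_domain_of_exists y ⟨w, h⟩
  have h1 := adjoint_apply_eq hT.dense_domain ⟨y, hy⟩ h
  -- A free S allows the equality of the adjoint with T to be substituted although the membership
  -- proof depends on the operator.
  have h2 : ∀ S : H →ₗ.[ℂ] H, S = T → ∀ hS : y ∈ S.domain, S ⟨y, hS⟩ = w →
      ∃ hy : y ∈ T.domain, T ⟨y, hy⟩ = w := by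
    rintro S rfl hS h
    exact ⟨hS, h⟩
  exact h2 _ (isSelfAdjoint_def.1 hT) hy h1

theorem inner_self_apply_im (hT : IsSelfAdjoint T) (x : T.domain) :
    (inner ℂ (x : H) (T x)).im = 0 := by
  have h := inner_apply_comm hT x x
  rw [← inner_conj_symm] at h
  exact Complex.conj_eq_iff_im.1 h

/-- ⟨x, T x⟩ is real, so ⟨x, (T - z) x⟩ has imaginary part -Im z ‖x‖²; conclude by Cauchy-Schwarz.
-/
theorem abs_im_mul_norm_le (hT : IsSelfAdjoint T) (z : ℂ) (x : T.domain) :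
    |z.im| * ‖(x : H)‖ ≤ ‖T x - z • (x : H)‖ := by
  rcases eq_or_ne (x : H) 0 with h0 | h0
  · simp [h0]
  have h1 : (inner ℂ (x : H) (T x - z • (x : H))).im = -(z.im * ‖(x : H)‖ ^ 2) := by
    rw [inner_sub_right, inner_smul_right, Complex.sub_im, inner_self_apply_im hT,
      inner_self_eq_norm_sq_to_K]
    have : ((‖(x : H)‖ : ℂ) ^ 2) = ((‖(x : H)‖ ^ 2 : ℝ) : ℂ) := by push_cast; rfl
    simp only [Complex.coe_algebraMap]
    rw [this, Complex.im_mul_ofReal, zero_sub]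
  have h2 : |z.im| * ‖(x : H)‖ ^ 2 ≤ ‖(x : H)‖ * ‖T x - z • (x : H)‖ := by
    calc |z.im| * ‖(x : H)‖ ^ 2 = |(inner ℂ (x : H) (T x - z • (x : H))).im| := by
          rw [h1, abs_neg, abs_mul, abs_of_nonneg (sq_nonneg ‖(x : H)‖)]
      _ ≤ ‖inner ℂ (x : H) (T x - z • (x : H))‖ := Complex.abs_im_le_norm _
      _ ≤ _ := norm_inner_le_norm _ _
  have h3 : 0 < ‖(x : H)‖ := norm_pos_iff.2 h0
  nlinarith

theorem eq_zero_of_apply_eq_smul (hT : IsSelfAdjoint T) {z : ℂ} (hz : z.im ≠ 0) (x : T.domain)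
    (h : T x = z • (x : H)) : (x : H) = 0 := by
  have := abs_im_mul_norm_le hT z x
  rw [h, sub_self, norm_zero] at this
  have h3 : 0 < |z.im| := abs_pos.2 hz
  exact norm_eq_zero.1 (le_antisymm (by nlinarith [norm_nonneg (x : H)]) (norm_nonneg _))

/-- The range of T - z is closed, by the lower bound and the closed graph of T. A vector orthogonal
to it is an eigenvector of T for the conjugate of z, hence zero. -/
theorem exists_apply_sub_smul_eq (hT : IsSelfAdjoint T) {z : ℂ} (hz : z.im ≠ 0) (y : H) :
    ∃ x : T.domain, T x - z • (x : H) = y := by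
  set f : T.domain →ₗ[ℂ] H := T.toFun - z • T.domain.subtype with hf
  have hfa : ∀ x : T.domain, f x = T x - z • (x : H) := fun x => rfl
  have hzp : 0 < |z.im| := abs_pos.2 hz
  have hclosed : _root_.IsClosed (LinearMap.range f : Set H) := by
    rw [← isSeqClosed_iff_isClosed]
    intro u y hu hy
    choose x hx using hu
    have hc : CauchySeq fun n => ((x n : H)) := by
      have huc := hy.cauchySeq
      rw [Metric.cauchySeq_iff'] at huc ⊢
      intro ε hε
      obtain ⟨N, hN⟩ := huc (|z.im| * ε) (by positivity)
      refine ⟨N, fun n hn => ?_⟩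
      have h1 := hN n hn
      have h2 := abs_im_mul_norm_le hT z (x n - x N)
      rw [← hfa, _root_.map_sub, hx, hx, ← dist_eq_norm] at h2
      rw [dist_eq_norm]
      have h3 := h2.trans_lt h1
      exact lt_of_mul_lt_mul_left h3 hzp.le
    obtain ⟨a, ha⟩ := cauchySeq_tendsto_of_complete hc
    have hTx : Tendsto (fun n => T (x n)) atTop (𝓝 (y + z • a)) := by
      have := hy.add (ha.const_smul z)
      refine this.congr fun n => ?_
      rw [← hx n, hfa]
      simp
    have hg : (a, y + z • a) ∈ T.graph :=
      hT.isClosed.mem_of_tendsto (ha.prodMk_nhds hTx) (Eventually.of_forall fun n => T.mem_graph _)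
    obtain ⟨x', hx1, hx2⟩ := (LinearPMap.mem_graph_iff _).1 hg
    simp only at hx1 hx2
    refine ⟨x', ?_⟩
    rw [hfa, hx1, hx2]
    simp
  have hcomp : CompleteSpace (LinearMap.range f) := hclosed.completeSpace_coe
  have htop : LinearMap.range f = ⊤ := by
    rw [← Submodule.orthogonal_eq_bot_iff, Submodule.eq_bot_iff]
    intro w hw
    rw [Submodule.mem_orthogonal'] at hw
    have h1 : ∀ x : T.domain, inner ℂ (conj z • w) (x : H) = inner ℂ w (T x) := by
      intro x
      have := hw (f x) ⟨x, rfl⟩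
      rw [hfa, inner_sub_right, inner_smul_right, sub_eq_zero] at this
      rw [inner_smul_left, this]
      simp
    obtain ⟨hw1, hw2⟩ := exists_mem_domain_apply_eq hT h1
    exact eq_zero_of_apply_eq_smul hT (z := conj z) (by simpa using hz) ⟨w, hw1⟩ hw2
  have : y ∈ LinearMap.range f := by rw [htop]; trivial
  obtain ⟨x, hx⟩ := this
  exact ⟨x, hx⟩

theorem apply_sub_smul_injective (hT : IsSelfAdjoint T) {z : ℂ} (hz : z.im ≠ 0) (x y : T.domain)
    (h : T x - z • (x : H) = T y - z • (y : H)) : x = y := by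
  have h1 : ((x - y : T.domain) : H) = 0 := by
    refine eq_zero_of_apply_eq_smul hT hz (x - y) ?_
    rw [T.map_sub, Submodule.coe_sub, smul_sub]
    rw [sub_eq_sub_iff_sub_eq_sub] at h
    exact h
  exact sub_eq_zero.1 (Subtype.ext h1)

theorem exists_resolvent (hT : IsSelfAdjoint T) {z : ℂ} (hz : z.im ≠ 0) :
    ∃ R : H →L[ℂ] H, ∀ y, ∃ h : R y ∈ T.domain, T ⟨R y, h⟩ - z • R y = y := by
  choose g hg using exists_apply_sub_smul_eq hT hz
  let L : H →ₗ[ℂ] H :=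
    { toFun := fun y => (g y : H)
      map_add' := fun x y => by
        have : g (x + y) = g x + g y := by
          apply apply_sub_smul_injective hT hz
          rw [hg, T.map_add, Submodule.coe_add, smul_add, add_sub_add_comm, hg, hg]
        rw [this]; rfl
      map_smul' := fun c y => by
        have : g (c • y) = c • g y := by
          apply apply_sub_smul_injective hT hz
          rw [hg, T.map_smul, Submodule.coe_smul, smul_comm z c, ← smul_sub, hg]
        rw [this]; rfl }
  refine ⟨L.mkContinuous |z.im|⁻¹ fun y => ?_, fun y => ⟨(g y).2, hg y⟩⟩
  have := abs_im_mul_norm_le hT z (g y)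
  rw [hg] at this
  rw [inv_mul_eq_div, le_div_iff₀ (abs_pos.2 hz), mul_comm]
  exact this

open Classical in
/-- The resolvent `(T - z)⁻¹` of a self-adjoint operator at a non-real `z`; zero if it does not
exist. -/
noncomputable def resolvent (T : H →ₗ.[ℂ] H) (z : ℂ) : H →L[ℂ] H :=
  if h : ∃ R : H →L[ℂ] H, ∀ y, ∃ h : R y ∈ T.domain, T ⟨R y, h⟩ - z • R y = y then h.choose else 0

variable {z : ℂ}

theorem resolvent_spec (hT : IsSelfAdjoint T) (hz : z.im ≠ 0) (y : H) :
    ∃ h : T.resolvent z y ∈ T.domain, T ⟨T.resolvent z y, h⟩ - z • T.resolvent z y = y := by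
  have h := exists_resolvent hT hz
  rw [resolvent, dif_pos h]
  exact h.choose_spec y

theorem resolvent_mem (hT : IsSelfAdjoint T) (hz : z.im ≠ 0) (y : H) :
    T.resolvent z y ∈ T.domain :=
  (resolvent_spec hT hz y).1

theorem apply_resolvent (hT : IsSelfAdjoint T) (hz : z.im ≠ 0) (y : H) :
    T ⟨T.resolvent z y, resolvent_mem hT hz y⟩ = y + z • T.resolvent z y :=
  sub_eq_iff_eq_add.1 (resolvent_spec hT hz y).2

theorem resolvent_apply_sub (hT : IsSelfAdjoint T) (hz : z.im ≠ 0) (x : T.domain) :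
    T.resolvent z (T x - z • (x : H)) = x := by
  have := apply_sub_smul_injective hT hz ⟨_, resolvent_mem hT hz (T x - z • (x : H))⟩ x
    (by rw [apply_resolvent hT hz]; simp)
  exact congrArg Subtype.val this

theorem norm_resolvent_apply_le (hT : IsSelfAdjoint T) (hz : z.im ≠ 0) (y : H) :
    ‖T.resolvent z y‖ ≤ |z.im|⁻¹ * ‖y‖ := by
  have := abs_im_mul_norm_le hT z ⟨_, resolvent_mem hT hz y⟩
  rw [apply_resolvent hT hz] at this
  simp only [add_sub_cancel_right] at this
  rwa [inv_mul_eq_div, le_div_iff₀ (abs_pos.2 hz), mul_comm]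

theorem inner_resolvent_left (hT : IsSelfAdjoint T) (hz : z.im ≠ 0) (x y : H) :
    inner ℂ (T.resolvent z x) y = inner ℂ x (T.resolvent (conj z) y) := by
  have hz' : (conj z).im ≠ 0 := by simpa using hz
  have h := inner_apply_comm hT ⟨_, resolvent_mem hT hz x⟩ ⟨_, resolvent_mem hT hz' y⟩
  rw [apply_resolvent hT hz, apply_resolvent hT hz'] at h
  simp only [inner_add_left, inner_add_right, inner_smul_left, inner_smul_right] at h
  linear_combination -h

theorem adjoint_resolvent (hT : IsSelfAdjoint T) (hz : z.im ≠ 0) :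
    star (T.resolvent z) = T.resolvent (conj z) := by
  rw [ContinuousLinearMap.star_eq_adjoint, eq_comm, ContinuousLinearMap.eq_adjoint_iff]
  intro x y
  have hz' : (conj z).im ≠ 0 := by simpa using hz
  simpa using inner_resolvent_left hT hz' x y

/-- The first resolvent identity. -/
theorem resolvent_sub_resolvent (hT : IsSelfAdjoint T) (hz : z.im ≠ 0) {w : ℂ} (hw : w.im ≠ 0)
    (y : H) : T.resolvent z y - T.resolvent w y =
      (z - w) • T.resolvent z (T.resolvent w y) := by
  have h := resolvent_apply_sub hT hz ⟨_, resolvent_mem hT hw y⟩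
  rw [apply_resolvent hT hw] at h
  have h2 : y + w • T.resolvent w y - z • T.resolvent w y = y - (z - w) • T.resolvent w y := by
    rw [sub_smul]; abel
  rw [h2, _root_.map_sub, _root_.map_smul] at h
  simp only at h
  rw [sub_eq_iff_eq_add, ← sub_eq_iff_eq_add']
  exact h

/-- The adjoint is the resolvent at the conjugate point. Writing the first resolvent identity in
both orders shows that the two commute. -/
theorem isStarNormal_resolvent (hT : IsSelfAdjoint T) (hz : z.im ≠ 0) :
    IsStarNormal (T.resolvent z) := by
  refine ⟨?_⟩
  rw [adjoint_resolvent hT hz]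
  have hz' : (conj z).im ≠ 0 := by simpa using hz
  have hne : z - conj z ≠ 0 := by
    intro h
    apply hz
    have := congrArg Complex.im h
    simp at this
    linarith
  ext y
  simp only [mul_apply_eq_comp]
  have h1 := resolvent_sub_resolvent hT hz hz' y
  have h2 := resolvent_sub_resolvent hT hz' hz y
  have h3 : (z - conj z) • T.resolvent (conj z) (T.resolvent z y) =
      (z - conj z) • T.resolvent z (T.resolvent (conj z) y) := by
    rw [← h1, ← neg_sub (conj z) z, neg_smul, ← h2]
    abel
  exact smul_right_injective H hne h3

end LinearPMap

end Resolvent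

section FunctionalCalculus

/-! ### Measures and projections of a continuous functional calculus -/

variable {H : Type*} [NormedAddCommGroup H] [InnerProductSpace ℂ H] [CompleteSpace H]
variable {X : Type*} [MetricSpace X]

theorem inner_starAlgHom_star_mul (Φ : C(X, ℂ) →⋆ₐ[ℂ] (H →L[ℂ] H)) (f g : C(X, ℂ)) (x y : H) :
    inner ℂ (Φ f x) (Φ g y) = inner ℂ x (Φ (star f * g) y) := by
  rw [map_mul, map_star, mul_apply_eq_comp, ContinuousLinearMap.star_eq_adjoint,
    ContinuousLinearMap.adjoint_inner_right]

/-- The real continuous function `f`, with complex values. -/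
def ContinuousMap.toComplex (f : C(X, ℝ)) : C(X, ℂ) := ⟨fun x => (f x : ℂ), by fun_prop⟩

theorem star_toComplex (f : C(X, ℝ)) : star f.toComplex = f.toComplex := by
  ext x
  simp [ContinuousMap.toComplex]

variable [CompactSpace X] [MeasurableSpace X] [BorelSpace X]

/-- Riesz-Markov-Kakutani for the functional f ↦ ⟨x, Φ(f) x⟩ on real functions, then extension to
complex f by linearity. -/
theorem exists_measure_starAlgHom (Φ : C(X, ℂ) →⋆ₐ[ℂ] (H →L[ℂ] H)) (x : H) :
    ∃ m : Measure X, IsFiniteMeasure m ∧ m.Regular ∧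
      ∀ f : C(X, ℂ), ∫ t, f t ∂m = inner ℂ x (Φ f x) := by
  have hpos : ∀ f : C(X, ℝ), (∀ t, 0 ≤ f t) → 0 ≤ (inner ℂ x (Φ f.toComplex x)).re := by
    intro f hf
    -- With f = g², the value ⟨x, Φ(f) x⟩ is ‖Φ(g) x‖², hence nonnegative.
    set g : C(X, ℝ) := ⟨fun t => Real.sqrt (f t), by fun_prop⟩
    have hfg : f.toComplex = star g.toComplex * g.toComplex := by
      rw [star_toComplex]
      ext t
      simp only [ContinuousMap.toComplex, ContinuousMap.mul_apply, ContinuousMap.coe_mk, g]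
      rw [← Complex.ofReal_mul, Real.mul_self_sqrt (hf t)]
    rw [hfg, ← inner_starAlgHom_star_mul]
    exact inner_self_nonneg (𝕜 := ℂ)
  let L : CompactlySupportedContinuousMap X ℝ →ₗ[ℝ] ℝ :=
    { toFun := fun f => (inner ℂ x (Φ (f : C(X, ℝ)).toComplex x)).re
      map_add' := fun f g => by
        have : ((f + g : CompactlySupportedContinuousMap X ℝ) : C(X, ℝ)).toComplex =
            (f : C(X, ℝ)).toComplex + (g : C(X, ℝ)).toComplex := by
          ext t; simp [ContinuousMap.toComplex]
        rw [this, map_add, add_apply, inner_add_right, Complex.add_re]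
      map_smul' := fun c f => by
        have : ((c • f : CompactlySupportedContinuousMap X ℝ) : C(X, ℝ)).toComplex =
            (c : ℂ) • (f : C(X, ℝ)).toComplex := by
          ext t; simp [ContinuousMap.toComplex]
        rw [this, map_smul, smul_apply, inner_smul_right, Complex.re_ofReal_mul]
        rfl }
  let Λ : CompactlySupportedContinuousMap X ℝ →ₚ[ℝ] ℝ :=
    PositiveLinearMap.mk₀ L fun f hf => hpos f fun t => hf t
  have hfin : IsFiniteMeasure (RealRMK.rieszMeasure Λ) := inferInstance
  refine ⟨RealRMK.rieszMeasure Λ, hfin, inferInstance, ?_⟩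
  have hreal : ∀ f : C(X, ℝ), ((∫ t, f t ∂(RealRMK.rieszMeasure Λ) : ℝ) : ℂ) =
      inner ℂ x (Φ f.toComplex x) := by
    intro f
    have h1 := RealRMK.integral_rieszMeasure Λ (CompactlySupportedContinuousMap.continuousMapEquiv f)
    have h2 : Λ (CompactlySupportedContinuousMap.continuousMapEquiv f) =
        (inner ℂ x (Φ f.toComplex x)).re := rfl
    -- The functional L keeps only real parts; nothing is lost because Φ(f) is self-adjoint for real
    -- f.
    have h3 : (inner ℂ x (Φ f.toComplex x)).im = 0 := by
      have h4 := inner_starAlgHom_star_mul Φ f.toComplex 1 x x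
      rw [star_toComplex, mul_one, map_one, one_apply_eq_self, ← inner_conj_symm] at h4
      exact Complex.conj_eq_iff_im.1 h4
    rw [h2] at h1
    refine Complex.ext ?_ ?_
    · rw [← h1]; rfl
    · rw [h3]; rfl
  intro f
  set u : C(X, ℝ) := ⟨fun t => (f t).re, by fun_prop⟩
  set v : C(X, ℝ) := ⟨fun t => (f t).im, by fun_prop⟩
  have huv : f = u.toComplex + Complex.I • v.toComplex := by
    ext t
    simp only [ContinuousMap.toComplex, ContinuousMap.add_apply, ContinuousMap.coe_mk,
      ContinuousMap.smul_apply, smul_eq_mul, u, v]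
    rw [mul_comm, Complex.re_add_im]
  have hi : ∀ g : C(X, ℝ), Integrable g (RealRMK.rieszMeasure Λ) := fun g =>
    g.continuous.integrable_of_hasCompactSupport (HasCompactSupport.of_compactSpace g)
  have h5 : ∫ t, f t ∂(RealRMK.rieszMeasure Λ) =
      ((∫ t, u t ∂(RealRMK.rieszMeasure Λ) : ℝ) : ℂ) +
        Complex.I * ((∫ t, v t ∂(RealRMK.rieszMeasure Λ) : ℝ) : ℂ) := by
    rw [← integral_complex_ofReal, ← integral_complex_ofReal, ← integral_const_mul, ← integral_add
      (hi u).ofReal ((hi v).ofReal.const_mul _)]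
    refine integral_congr_ae (ae_of_all _ fun t => ?_)
    conv_lhs => rw [huv]
    rfl
  rw [h5, hreal, hreal]
  conv_rhs => rw [huv]
  rw [map_add, map_smul, add_apply, smul_apply,
    inner_add_right, inner_smul_right]

/-- The measure `m` with `∫ f dm = ⟨x, Φ(f) x⟩`. -/
noncomputable def calculusMeasure (Φ : C(X, ℂ) →⋆ₐ[ℂ] (H →L[ℂ] H)) (x : H) : Measure X :=
  (exists_measure_starAlgHom Φ x).choose

variable (Φ : C(X, ℂ) →⋆ₐ[ℂ] (H →L[ℂ] H)) (x y : H)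

instance : IsFiniteMeasure (calculusMeasure Φ x) := (exists_measure_starAlgHom Φ x).choose_spec.1

instance : (calculusMeasure Φ x).Regular := (exists_measure_starAlgHom Φ x).choose_spec.2.1

theorem integral_calculusMeasure (f : C(X, ℂ)) :
    ∫ t, f t ∂(calculusMeasure Φ x) = inner ℂ x (Φ f x) :=
  (exists_measure_starAlgHom Φ x).choose_spec.2.2 f

theorem norm_sq_starAlgHom (f : C(X, ℂ)) :
    ‖Φ f x‖ ^ 2 = ∫ t, ‖f t‖ ^ 2 ∂(calculusMeasure Φ x) := by
  have h := integral_calculusMeasure Φ x (star f * f)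
  rw [← inner_starAlgHom_star_mul, inner_self_eq_norm_sq_to_K] at h
  have h2 : ∀ t, (star f * f) t = ((‖f t‖ ^ 2 : ℝ) : ℂ) := by
    intro t
    simp only [ContinuousMap.mul_apply, ContinuousMap.star_apply, RCLike.star_def]
    rw [mul_comm, Complex.mul_conj, Complex.normSq_eq_norm_sq]
  simp only [h2, integral_complex_ofReal] at h
  simp only [Complex.coe_algebraMap] at h
  exact_mod_cast h.symm

theorem norm_starAlgHom_eq_norm_toLp (f : C(X, ℂ)) :
    ‖Φ f x‖ = ‖ContinuousMap.toLp 2 (calculusMeasure Φ x) ℂ f‖ := by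
  have h : ‖ContinuousMap.toLp 2 (calculusMeasure Φ x) ℂ f‖ ^ 2 = ‖Φ f x‖ ^ 2 := by
    have h1 := L2.inner_def (𝕜 := ℂ) (ContinuousMap.toLp 2 (calculusMeasure Φ x) ℂ f)
      (ContinuousMap.toLp 2 (calculusMeasure Φ x) ℂ f)
    rw [inner_self_eq_norm_sq_to_K] at h1
    have h2 : ∫ t, inner ℂ (ContinuousMap.toLp 2 (calculusMeasure Φ x) ℂ f t)
        (ContinuousMap.toLp 2 (calculusMeasure Φ x) ℂ f t) ∂(calculusMeasure Φ x) =
        ((∫ t, ‖f t‖ ^ 2 ∂(calculusMeasure Φ x) : ℝ) : ℂ) := by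
      rw [← integral_complex_ofReal]
      refine integral_congr_ae ?_
      filter_upwards [ContinuousMap.coeFn_toLp (𝕜 := ℂ) (p := 2) (calculusMeasure Φ x) f] with t ht
      rw [ht, inner_self_eq_norm_sq_to_K]
      simp
    rw [h2, ← norm_sq_starAlgHom] at h1
    simp only [Complex.coe_algebraMap] at h1
    exact_mod_cast h1
  exact ((sq_eq_sq₀ (norm_nonneg _) (norm_nonneg _)).1 h).symm

theorem denseRange_toLp_calculusMeasure :
    DenseRange (ContinuousMap.toLp 2 (calculusMeasure Φ x) ℂ : C(X, ℂ) → _) :=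
  ContinuousMap.toLp_denseRange ℂ _ ℂ (by norm_num)

/-- The isometric extension of `f ↦ Φ(f) x` to square integrable functions. -/
noncomputable def calculusIsometry : Lp ℂ 2 (calculusMeasure Φ x) →ₗᵢ[ℂ] H where
  toLinearMap := ((((ContinuousLinearMap.apply ℂ H x).toLinearMap ∘ₗ
    Φ.toAlgHom.toLinearMap).extendOfNorm
      (ContinuousMap.toLp 2 (calculusMeasure Φ x) ℂ).toLinearMap : _ →L[ℂ] H) : _ →ₗ[ℂ] H)
  norm_map' := by
    have hd := denseRange_toLp_calculusMeasure Φ x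
    refine fun g => hd.induction_on (p := fun g => ‖(((ContinuousLinearMap.apply ℂ H x).toLinearMap ∘ₗ
      Φ.toAlgHom.toLinearMap).extendOfNorm
      (ContinuousMap.toLp 2 (calculusMeasure Φ x) ℂ).toLinearMap : _ →L[ℂ] H) g‖ = ‖g‖) g
      (isClosed_eq (by fun_prop) (by fun_prop)) fun f => ?_
    have := LinearMap.extendOfNorm_eq (f := (ContinuousLinearMap.apply ℂ H x).toLinearMap ∘ₗ
      Φ.toAlgHom.toLinearMap) (e := (ContinuousMap.toLp 2 (calculusMeasure Φ x) ℂ).toLinearMap)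
      hd ⟨1, fun f => by rw [one_mul]; exact (norm_starAlgHom_eq_norm_toLp Φ x f).le⟩ f
    refine (congrArg norm this).trans ?_
    exact norm_starAlgHom_eq_norm_toLp Φ x f

theorem calculusIsometry_toLp (f : C(X, ℂ)) :
    calculusIsometry Φ x (ContinuousMap.toLp 2 (calculusMeasure Φ x) ℂ f) = Φ f x :=
  LinearMap.extendOfNorm_eq (f := (ContinuousLinearMap.apply ℂ H x).toLinearMap ∘ₗ
      Φ.toAlgHom.toLinearMap) (e := (ContinuousMap.toLp 2 (calculusMeasure Φ x) ℂ).toLinearMap)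
      (denseRange_toLp_calculusMeasure Φ x)
      ⟨1, fun f => by rw [one_mul]; exact (norm_starAlgHom_eq_norm_toLp Φ x f).le⟩ f

variable {S : Set X} (hS : MeasurableSet S)

/-- The value `1_S(x)` of the extended functional calculus. -/
noncomputable def calculusIndicator : H :=
  calculusIsometry Φ x (indicatorConstLp 2 hS (measure_ne_top (calculusMeasure Φ x) S) (1 : ℂ))

theorem inner_calculusIndicator :
    inner ℂ x (calculusIndicator Φ x hS) = ((calculusMeasure Φ x).real S : ℂ) := by
  -- The vector x is the image of the constant function 1, so the inner product can be computed in
  -- L².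
  have h1 : x = calculusIsometry Φ x
      (indicatorConstLp 2 MeasurableSet.univ (measure_ne_top (calculusMeasure Φ x) univ) (1 : ℂ)) := by
    have h := calculusIsometry_toLp Φ x 1
    rw [show Φ 1 x = x by rw [map_one]; rfl] at h
    refine h.symm.trans (congrArg _ ?_)
    refine Lp.ext ?_
    refine (ContinuousMap.coeFn_toLp (𝕜 := ℂ) (p := 2) (calculusMeasure Φ x) 1).trans ?_
    refine EventuallyEq.trans ?_ indicatorConstLp_coeFn.symm
    simp only [indicator_univ]
    rfl
  have h2 : inner ℂ x (calculusIndicator Φ x hS) = inner ℂ (calculusIsometry Φ x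
      (indicatorConstLp 2 MeasurableSet.univ (measure_ne_top (calculusMeasure Φ x) univ) (1 : ℂ)))
      (calculusIndicator Φ x hS) := by rw [← h1]
  rw [h2, calculusIndicator, LinearIsometry.inner_map_map, L2.inner_indicatorConstLp_one]
  simp only [Measure.restrict_univ]
  rw [integral_congr_ae indicatorConstLp_coeFn, integral_indicator hS]
  simp

theorem norm_sq_calculusIndicator :
    ‖calculusIndicator Φ x hS‖ ^ 2 = (calculusMeasure Φ x).real S := by
  rw [calculusIndicator, LinearIsometry.norm_map, norm_indicatorConstLp (by norm_num) (by norm_num),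
    norm_one, one_mul, ← Real.rpow_natCast, ← Real.rpow_mul measureReal_nonneg]
  norm_num

theorem norm_starAlgHom_sub_calculusIndicator (f : C(X, ℝ)) :
    ‖Φ f.toComplex x - calculusIndicator Φ x hS‖ =
      (eLpNorm (S.indicator (fun _ => (1 : ℝ)) - ⇑f) 2 (calculusMeasure Φ x)).toReal := by
  rw [← calculusIsometry_toLp, calculusIndicator, ← map_sub, LinearIsometry.norm_map, Lp.norm_def]
  congr 1
  refine eLpNorm_congr_norm_ae ?_
  filter_upwards [Lp.coeFn_sub (ContinuousMap.toLp 2 (calculusMeasure Φ x) ℂ f.toComplex)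
    (indicatorConstLp 2 hS (measure_ne_top (calculusMeasure Φ x) S) (1 : ℂ)),
    ContinuousMap.coeFn_toLp (𝕜 := ℂ) (p := 2) (calculusMeasure Φ x) f.toComplex,
    indicatorConstLp_coeFn (p := 2) (hs := hS)
      (hμs := measure_ne_top (calculusMeasure Φ x) S) (c := (1 : ℂ))] with t h1 h2 h3
  rw [h1, Pi.sub_apply, Pi.sub_apply, h2, h3, norm_sub_rev]
  by_cases ht : t ∈ S
  · simp only [ht, indicator_of_mem, ContinuousMap.toComplex, ContinuousMap.coe_mk]
    rw [← Complex.ofReal_one, ← Complex.ofReal_sub, Complex.norm_real]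
  · simp only [ht, indicator_of_notMem, ContinuousMap.toComplex, ContinuousMap.coe_mk,
      not_false_eq_true, zero_sub, norm_neg, Complex.norm_real]

include hS in
/-- Continuous functions approximate an indicator function simultaneously on three vectors. -/
theorem exists_norm_starAlgHom_sub_calculusIndicator_le (x y w : H) {ε : ℝ} (hε : 0 < ε) :
    ∃ f : C(X, ℝ), ‖Φ f.toComplex x - calculusIndicator Φ x hS‖ ≤ ε ∧
      ‖Φ f.toComplex y - calculusIndicator Φ y hS‖ ≤ ε ∧
      ‖Φ f.toComplex w - calculusIndicator Φ w hS‖ ≤ ε := by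
  set m := calculusMeasure Φ x + (calculusMeasure Φ y + calculusMeasure Φ w)
  have hm : MemLp (S.indicator fun _ => (1 : ℝ)) 2 m :=
    memLp_indicator_const 2 hS 1 (Or.inr (measure_ne_top m S))
  obtain ⟨g, hg, -⟩ := hm.exists_boundedContinuous_eLpNorm_sub_le (by norm_num)
    (ε := ENNReal.ofReal ε) (by simpa using hε)
  have key : ∀ v : H, calculusMeasure Φ v ≤ m →
      ‖Φ g.toContinuousMap.toComplex v - calculusIndicator Φ v hS‖ ≤ ε := by
    intro v hv
    rw [norm_starAlgHom_sub_calculusIndicator]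
    exact ENNReal.toReal_le_of_le_ofReal hε.le ((eLpNorm_mono_measure _ hv).trans hg)
  refine ⟨g.toContinuousMap, key x ?_, key y ?_, key w ?_⟩
  · exact Measure.le_add_right le_rfl
  · exact Measure.le_add_left (Measure.le_add_right le_rfl)
  · exact Measure.le_add_left (Measure.le_add_left le_rfl)

/-- Linearity in x is not automatic, since x, y and x + y have different L² spaces. One continuous f
close to the indicator of S for the sum of the three measures transfers the linearity of Φ(f). -/
theorem calculusIndicator_add :
    calculusIndicator Φ (x + y) hS = calculusIndicator Φ x hS + calculusIndicator Φ y hS := by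
  refine eq_of_norm_sub_le_zero (le_of_forall_pos_le_add fun ε hε => ?_)
  obtain ⟨f, h1, h2, h3⟩ := exists_norm_starAlgHom_sub_calculusIndicator_le Φ hS x y (x + y)
    (show 0 < ε / 3 by linarith)
  have h : calculusIndicator Φ (x + y) hS -
      (calculusIndicator Φ x hS + calculusIndicator Φ y hS) =
      (Φ f.toComplex x - calculusIndicator Φ x hS) + (Φ f.toComplex y - calculusIndicator Φ y hS) -
        (Φ f.toComplex (x + y) - calculusIndicator Φ (x + y) hS) := by
    rw [map_add]; abel
  rw [h]
  refine (norm_sub_le _ _).trans ?_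
  have := norm_add_le (Φ f.toComplex x - calculusIndicator Φ x hS)
    (Φ f.toComplex y - calculusIndicator Φ y hS)
  linarith

theorem calculusIndicator_smul (c : ℂ) :
    calculusIndicator Φ (c • x) hS = c • calculusIndicator Φ x hS := by
  refine eq_of_norm_sub_le_zero (le_of_forall_pos_le_add fun ε hε => ?_)
  obtain ⟨f, h1, h2, -⟩ := exists_norm_starAlgHom_sub_calculusIndicator_le Φ hS x (c • x) x
    (show 0 < ε / (‖c‖ + 1) by positivity)
  have h : calculusIndicator Φ (c • x) hS - c • calculusIndicator Φ x hS =
      c • (Φ f.toComplex x - calculusIndicator Φ x hS) -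
        (Φ f.toComplex (c • x) - calculusIndicator Φ (c • x) hS) := by
    rw [map_smul, smul_sub]; abel
  rw [h]
  refine (norm_sub_le _ _).trans ?_
  rw [norm_smul, zero_add]
  have h4 : ε = ‖c‖ * (ε / (‖c‖ + 1)) + ε / (‖c‖ + 1) := by
    field_simp
  rw [h4]
  gcongr

/-- Symmetry is inherited from Φ(f) with f real, again by simultaneous approximation. -/
theorem inner_calculusIndicator_comm :
    inner ℂ (calculusIndicator Φ x hS) y = inner ℂ x (calculusIndicator Φ y hS) := by
  refine eq_of_norm_sub_le_zero (le_of_forall_pos_le_add fun ε hε => ?_)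
  set K := ‖x‖ + ‖y‖ + 1
  have hK : 0 < K := by positivity
  obtain ⟨f, h1, h2, -⟩ := exists_norm_starAlgHom_sub_calculusIndicator_le Φ hS x y x
    (show 0 < ε / K by positivity)
  have h0 : inner ℂ (Φ f.toComplex x) y = inner ℂ x (Φ f.toComplex y) := by
    have := inner_starAlgHom_star_mul Φ f.toComplex 1 x y
    rwa [star_toComplex, mul_one, map_one, one_apply_eq_self] at this
  have h : inner ℂ (calculusIndicator Φ x hS) y - inner ℂ x (calculusIndicator Φ y hS) =
      inner ℂ x (Φ f.toComplex y - calculusIndicator Φ y hS) -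
        inner ℂ (Φ f.toComplex x - calculusIndicator Φ x hS) y := by
    rw [inner_sub_left, inner_sub_right, h0]; abel
  rw [h, zero_add]
  calc _ ≤ ‖x‖ * ‖Φ f.toComplex y - calculusIndicator Φ y hS‖ +
        ‖Φ f.toComplex x - calculusIndicator Φ x hS‖ * ‖y‖ :=
        (norm_sub_le _ _).trans (add_le_add (norm_inner_le_norm _ _) (norm_inner_le_norm _ _))
    _ ≤ ‖x‖ * (ε / K) + (ε / K) * ‖y‖ := by gcongr
    _ = (‖x‖ + ‖y‖) * (ε / K) := by ring
    _ ≤ K * (ε / K) := by gcongr; simp [K]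
    _ = ε := by field_simp

theorem measureReal_calculusMeasure_univ : (calculusMeasure Φ x).real univ = ‖x‖ ^ 2 := by
  have h := integral_calculusMeasure Φ x 1
  rw [map_one, one_apply_eq_self, inner_self_eq_norm_sq_to_K] at h
  simp only [ContinuousMap.one_apply, integral_const, Complex.coe_algebraMap] at h
  rw [Complex.real_smul, mul_one] at h
  exact_mod_cast h

open Classical in
/-- The spectral projection of the functional calculus `Φ` on the set `S`. -/
noncomputable def calculusProj (S : Set X) : H →L[ℂ] H :=
  if hS : MeasurableSet S then
    LinearMap.mkContinuous
      { toFun := fun x => calculusIndicator Φ x hS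
        map_add' := fun x y => calculusIndicator_add Φ x y hS
        map_smul' := fun c x => calculusIndicator_smul Φ x hS c } 1 (fun x => by
          rw [one_mul]
          refine (sq_le_sq₀ (norm_nonneg _) (norm_nonneg _)).1 ?_
          refine (norm_sq_calculusIndicator Φ x hS).trans_le ?_
          rw [← measureReal_calculusMeasure_univ Φ x]
          exact measureReal_mono (subset_univ _))
  else 0

theorem calculusProj_apply : calculusProj Φ S x = calculusIndicator Φ x hS := by
  simp [calculusProj, hS]

include hS in
theorem inner_calculusProj :
    inner ℂ x (calculusProj Φ S x) = ((calculusMeasure Φ x).real S : ℂ) := by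
  rw [calculusProj_apply Φ x hS, inner_calculusIndicator]

omit [CompleteSpace H] in
-- Polarization over ℂ. It reduces identities between projections to identities between scalar
-- measures.
theorem ContinuousLinearMap.ext_inner_self {A B : H →L[ℂ] H}
    (h : ∀ x, inner ℂ x (A x) = inner ℂ x (B x)) : A = B := by
  rw [← sub_eq_zero]
  have h1 := (inner_map_self_eq_zero ((A - B : H →L[ℂ] H) : H →ₗ[ℂ] H)).1 fun x => by
    rw [← inner_conj_symm]
    simp [inner_sub_right, h]
  ext x
  exact congrArg (fun L : H →ₗ[ℂ] H => L x) h1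

include hS in
-- For self-adjoint P, ⟨x, P² x⟩ = ‖P x‖², and both this and ⟨x, P x⟩ are the mass of S.
theorem isStarProjection_calculusProj : IsStarProjection (calculusProj Φ S) := by
  have hsa : IsSelfAdjoint (calculusProj Φ S) := by
    rw [IsSelfAdjoint, ContinuousLinearMap.star_eq_adjoint, eq_comm,
      ContinuousLinearMap.eq_adjoint_iff]
    intro x y
    rw [calculusProj_apply Φ x hS, calculusProj_apply Φ y hS, inner_calculusIndicator_comm]
  refine ⟨?_, hsa⟩
  refine ContinuousLinearMap.ext_inner_self fun x => ?_
  rw [mul_apply_eq_comp, inner_calculusProj Φ x hS, ← norm_sq_calculusIndicator Φ x hS,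
    calculusProj_apply Φ x hS, ← calculusProj_apply Φ _ hS,
    ← ContinuousLinearMap.adjoint_inner_left, ← ContinuousLinearMap.star_eq_adjoint, hsa.star_eq,
    calculusProj_apply Φ x hS, inner_self_eq_norm_sq_to_K]
  simp

end FunctionalCalculus

/-! ### Projection-valued measures from a functional calculus -/

section CalculusPVM

variable {H : Type*} [NormedAddCommGroup H] [InnerProductSpace ℂ H] [CompleteSpace H]
variable {X : Type*} [MetricSpace X] [CompactSpace X] [MeasurableSpace X] [BorelSpace X]
variable (Φ : C(X, ℂ) →⋆ₐ[ℂ] (H →L[ℂ] H))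

theorem norm_sq_calculusProj (x : H) {S : Set X} (hS : MeasurableSet S) :
    ‖calculusProj Φ S x‖ ^ 2 = (calculusMeasure Φ x).real S := by
  rw [calculusProj_apply Φ x hS, norm_sq_calculusIndicator]

theorem calculusProj_sdiff {S S' : Set X} (hS : MeasurableSet S) (hS' : MeasurableSet S')
    (h : S' ⊆ S) : calculusProj Φ (S \ S') = calculusProj Φ S - calculusProj Φ S' := by
  refine ContinuousLinearMap.ext_inner_self fun x => ?_
  rw [sub_apply, inner_sub_right, inner_calculusProj Φ x hS, inner_calculusProj Φ x hS',
    inner_calculusProj Φ x (hS.diff hS'), measureReal_sdiff h hS']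
  push_cast
  rfl

theorem calculusProj_biUnion_finset {ι : Type*} (s : Finset ι) {f : ι → Set X}
    (hf : ∀ i, MeasurableSet (f i)) (hd : Pairwise (Function.onFun Disjoint f)) :
    calculusProj Φ (⋃ i ∈ s, f i) = ∑ i ∈ s, calculusProj Φ (f i) := by
  refine ContinuousLinearMap.ext_inner_self fun x => ?_
  rw [inner_calculusProj Φ x (s.measurableSet_biUnion fun i _ => hf i),
    measureReal_biUnion_finset (fun i _ j _ hij => hd hij) (fun i _ => hf i)]
  rw [sum_apply, inner_sum, Complex.ofReal_sum]
  exact Finset.sum_congr rfl fun i _ => (inner_calculusProj Φ x (hf i)).symm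

/-- The squared norm of the remainder is the scalar mass of the part of the union not yet covered,
which tends to 0. -/
theorem hasSum_calculusProj {f : ℕ → Set X} (hf : ∀ i, MeasurableSet (f i))
    (hd : Pairwise (Function.onFun Disjoint f)) (x : H) :
    HasSum (fun i => calculusProj Φ (f i) x) (calculusProj Φ (⋃ i, f i) x) := by
  have h1 : HasSum (fun i => (calculusMeasure Φ x).real (f i))
      ((calculusMeasure Φ x).real (⋃ i, f i)) := by
    rw [measureReal_def, measure_iUnion hd hf,
      ENNReal.tsum_toReal_eq fun i => measure_ne_top (calculusMeasure Φ x) _]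
    exact ENNReal.hasSum_toReal (by
      rw [← measure_iUnion hd hf]; exact measure_ne_top (calculusMeasure Φ x) _)
  have h2 : ∀ s : Finset ℕ, ‖∑ i ∈ s, calculusProj Φ (f i) x - calculusProj Φ (⋃ i, f i) x‖ ^ 2 =
      (calculusMeasure Φ x).real (⋃ i, f i) - ∑ i ∈ s, (calculusMeasure Φ x).real (f i) := by
    intro s
    have hsub : (⋃ i ∈ s, f i) ⊆ ⋃ i, f i := iUnion₂_subset fun i _ => subset_iUnion f i
    have hms : MeasurableSet (⋃ i ∈ s, f i) := s.measurableSet_biUnion fun i _ => hf i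
    rw [← measureReal_biUnion_finset (fun i _ j _ hij => hd hij) (fun i _ => hf i),
      ← measureReal_sdiff hsub hms, ← norm_sq_calculusProj Φ x ((MeasurableSet.iUnion hf).diff hms),
      calculusProj_sdiff Φ (MeasurableSet.iUnion hf) hms hsub, calculusProj_biUnion_finset Φ s hf hd,
      norm_sub_rev, sub_apply, sum_apply]
  rw [HasSum, SummationFilter.unconditional_filter, tendsto_iff_norm_sub_tendsto_zero]
  have h3 : Tendsto (fun s : Finset ℕ =>
      ‖∑ i ∈ s, calculusProj Φ (f i) x - calculusProj Φ (⋃ i, f i) x‖ ^ 2) atTop (𝓝 0) := by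
    simp only [h2]
    have := (h1.const_sub ((calculusMeasure Φ x).real (⋃ i, f i)) : Tendsto _ _ _)
    simpa using this
  have h4 := h3.sqrt
  simpa [Real.sqrt_sq (norm_nonneg _)] using h4

/-- The image under a real function of the projection-valued measure of a functional calculus. -/
noncomputable def calculusPVM {τ : X → ℝ} (hτ : Measurable τ) : ProjectionValuedMeasure H where
  proj S := calculusProj Φ (τ ⁻¹' S)
  isStarProjection S hS := isStarProjection_calculusProj Φ (hτ hS)
  proj_univ := by
    refine ContinuousLinearMap.ext_inner_self fun x => ?_
    rw [preimage_univ, inner_calculusProj Φ x MeasurableSet.univ,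
      measureReal_calculusMeasure_univ, one_apply_eq_self, inner_self_eq_norm_sq_to_K]
    simp
  hasSum_iUnion f hf hd x := by
    rw [preimage_iUnion]
    exact hasSum_calculusProj Φ (fun i => hτ (hf i)) (fun i j hij => (hd hij).preimage τ) x

theorem scalarMeasure_calculusPVM {τ : X → ℝ} (hτ : Measurable τ) (x : H) :
    (calculusPVM Φ hτ).scalarMeasure x = (calculusMeasure Φ x).map τ := by
  ext S hS
  rw [ProjectionValuedMeasure.scalarMeasure_apply _ x hS, Measure.map_apply hτ hS]
  change ENNReal.ofReal (inner ℂ x (calculusProj Φ (τ ⁻¹' S) x)).re = _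
  rw [inner_calculusProj Φ x (hτ hS), Complex.ofReal_re, ofReal_measureReal]

/-- Both measures integrate a bounded continuous f to ⟨y, Φ(|g|² f) y⟩. -/
theorem calculusMeasure_starAlgHom_apply (g : C(X, ℂ)) (y : H) :
    calculusMeasure Φ (Φ g y) =
      (calculusMeasure Φ y).withDensity fun t => ENNReal.ofReal (‖g t‖ ^ 2) := by
  have hmeas : Measurable fun t => Real.toNNReal (‖g t‖ ^ 2) :=
    (g.continuous.norm.pow 2).measurable.real_toNNReal
  have hfin : IsFiniteMeasure ((calculusMeasure Φ y).withDensity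
      fun t => ENNReal.ofReal (‖g t‖ ^ 2)) := by
    refine isFiniteMeasure_withDensity_ofReal ?_
    exact ((g.continuous.norm.pow 2).integrable_of_hasCompactSupport
      (HasCompactSupport.of_compactSpace _)).2
  refine ext_of_forall_integral_eq_of_IsFiniteMeasure fun f => ?_
  have h1 := integral_calculusMeasure Φ (Φ g y) f.toContinuousMap.toComplex
  rw [← mul_apply_eq_comp, ← map_mul, inner_starAlgHom_star_mul, ← integral_calculusMeasure] at h1
  have h2 : ∀ t, (star g * (f.toContinuousMap.toComplex * g)) t =
      ((‖g t‖ ^ 2 * f t : ℝ) : ℂ) := by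
    intro t
    simp only [ContinuousMap.mul_apply, ContinuousMap.star_apply, RCLike.star_def,
      ContinuousMap.toComplex, ContinuousMap.coe_mk]
    rw [mul_left_comm, ← mul_comm (g t), Complex.mul_conj, Complex.normSq_eq_norm_sq, mul_comm]
    push_cast
    rfl
  have h3 : ∀ t, f.toContinuousMap.toComplex t = ((f t : ℝ) : ℂ) := fun t => rfl
  simp only [h2, h3, integral_complex_ofReal] at h1
  rw [Complex.ofReal_inj] at h1
  rw [h1]
  have h4 := integral_withDensity_eq_integral_smul (μ := calculusMeasure Φ y) hmeas f
  refine Eq.trans ?_ h4.symm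
  refine integral_congr_ae (ae_of_all _ fun t => ?_)
  simp only [NNReal.smul_def, smul_eq_mul]
  rw [Real.coe_toNNReal _ (by positivity)]

end CalculusPVM

section Existence

/-! ### The spectral theorem -/

variable {H : Type*} [NormedAddCommGroup H] [InnerProductSpace ℂ H] [CompleteSpace H]
  {T : H →ₗ.[ℂ] H}

namespace LinearPMap

/-- The continuous functional calculus of the resolvent at `-i`. -/
noncomputable def resolventCalculus (hT : IsSelfAdjoint T) :
    C(spectrum ℂ (T.resolvent (-Complex.I)), ℂ) →⋆ₐ[ℂ] (H →L[ℂ] H) :=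
  cfcHom (isStarNormal_resolvent hT (z := -Complex.I) (by simp))

/-- The identity function on the spectrum of the resolvent at `-i`. -/
noncomputable def resolventSymbol (T : H →ₗ.[ℂ] H) :
    C(spectrum ℂ (T.resolvent (-Complex.I)), ℂ) :=
  (ContinuousMap.id ℂ).restrict _

theorem resolventCalculus_symbol (hT : IsSelfAdjoint T) :
    resolventCalculus hT (resolventSymbol T) = T.resolvent (-Complex.I) :=
  cfcHom_id _

/-- The first resolvent identity R - R* = -2i R R*, read on the spectrum by injectivity of the
calculus. For r ≠ 0 it says Im (1/r) = 1, so 1/r = t + i with t real. -/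
theorem resolventSymbol_sub_conj (hT : IsSelfAdjoint T)
    (r : spectrum ℂ (T.resolvent (-Complex.I))) :
    (r : ℂ) - conj (r : ℂ) = -2 * Complex.I * ((r : ℂ) * conj (r : ℂ)) := by
  have hz : (-Complex.I).im ≠ 0 := by simp
  have h : resolventSymbol T - star (resolventSymbol T) =
      (-2 * Complex.I) • (resolventSymbol T * star (resolventSymbol T)) := by
    apply cfcHom_injective (isStarNormal_resolvent hT (z := -Complex.I) (by simp))
    change resolventCalculus hT _ = resolventCalculus hT _
    rw [_root_.map_sub, _root_.map_smul, map_mul, map_star, resolventCalculus_symbol,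
      adjoint_resolvent hT hz]
    ext y
    have := resolvent_sub_resolvent hT hz (w := conj (-Complex.I)) (by simp) y
    rw [_root_.sub_apply, this]
    simp only [_root_.smul_apply, mul_apply_eq_comp]
    congr 1
    rw [_root_.map_neg, Complex.conj_I]
    ring
  have := congrArg (fun f => f r) h
  exact this

/-- The coordinate of the spectrum of the resolvent at `-i`. -/
noncomputable def resolventCoord (T : H →ₗ.[ℂ] H) (r : spectrum ℂ (T.resolvent (-Complex.I))) : ℝ :=
  (r : ℂ)⁻¹.re

omit [CompleteSpace H] in
theorem measurable_resolventCoord (T : H →ₗ.[ℂ] H) : Measurable (resolventCoord T) :=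
  Complex.measurable_re.comp measurable_subtype_coe.inv

theorem inv_eq_resolventCoord (hT : IsSelfAdjoint T)
    (r : spectrum ℂ (T.resolvent (-Complex.I))) (hr : (r : ℂ) ≠ 0) :
    (r : ℂ)⁻¹ = resolventCoord T r + Complex.I := by
  have h := resolventSymbol_sub_conj hT r
  have hc : conj (r : ℂ) ≠ 0 := by simpa using hr
  have h2 : (conj (r : ℂ))⁻¹ - (r : ℂ)⁻¹ = -2 * Complex.I := by
    field_simp
    linear_combination h
  have h3 := congrArg Complex.im h2
  rw [← map_inv₀] at h3
  simp only [Complex.sub_im, Complex.conj_im, Complex.mul_im, Complex.neg_re, Complex.neg_im,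
    Complex.I_re, Complex.I_im, Complex.re_ofNat, Complex.im_ofNat] at h3
  refine Complex.ext ?_ ?_
  · simp [resolventCoord]
  · simp only [Complex.add_im, Complex.ofReal_im, Complex.I_im]
    linarith

/-- The projection-valued measure of a self-adjoint operator. -/
noncomputable def spectralPVM (hT : IsSelfAdjoint T) : ProjectionValuedMeasure H :=
  calculusPVM (resolventCalculus hT) (measurable_resolventCoord T)

/-- The coordinate t is unbounded near r = 0, but |r|² t is a continuous function of r, to which Φ
applies. -/
theorem norm_sq_mul_resolventCoord (hT : IsSelfAdjoint T)
    (r : spectrum ℂ (T.resolvent (-Complex.I))) :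
    ((‖(r : ℂ)‖ ^ 2 * resolventCoord T r : ℝ) : ℂ) =
      conj (r : ℂ) * (1 - Complex.I * (r : ℂ)) := by
  rcases eq_or_ne (r : ℂ) 0 with hr | hr
  · simp [hr]
  have h := inv_eq_resolventCoord hT r hr
  rw [← Complex.normSq_eq_norm_sq]
  push_cast
  rw [← Complex.mul_conj]
  have h2 : (r : ℂ) * resolventCoord T r = 1 - Complex.I * r := by
    rw [← sub_eq_iff_eq_add] at h
    rw [← h]
    field_simp
  linear_combination conj (r : ℂ) * h2

theorem norm_inv_sq_le_resolventCoord (hT : IsSelfAdjoint T)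
    (r : spectrum ℂ (T.resolvent (-Complex.I))) :
    ‖(r : ℂ)⁻¹‖ ^ 2 ≤ resolventCoord T r ^ 2 + 1 := by
  rcases eq_or_ne (r : ℂ) 0 with hr | hr
  · rw [hr]; simp; positivity
  rw [inv_eq_resolventCoord hT r hr, ← Complex.normSq_eq_norm_sq, Complex.normSq_apply]
  simp
  nlinarith

theorem exists_resolvent_eq (hT : IsSelfAdjoint T) (x : T.domain) :
    T.resolvent (-Complex.I) (T x + Complex.I • (x : H)) = x := by
  have := resolvent_apply_sub hT (z := -Complex.I) (by simp) x
  simpa using this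

/-- Write x = R y with y = (T + i) x. The measure of x is then |r|² times that of y, and |r|² t² ≤
1. -/
theorem isSpectralMeasureOf_domain_forward (hT : IsSelfAdjoint T) (x : T.domain) :
    ∫⁻ t, ENNReal.ofReal (t ^ 2) ∂((spectralPVM hT).scalarMeasure (x : H)) < ∞ ∧
    inner ℂ (x : H) (T x) = ((∫ t, t ∂((spectralPVM hT).scalarMeasure (x : H)) : ℝ) : ℂ) := by
  set y := T x + Complex.I • (x : H) with hy
  have hx : resolventCalculus hT (resolventSymbol T) y = x := by
    rw [resolventCalculus_symbol]
    exact exists_resolvent_eq hT x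
  have hm : (spectralPVM hT).scalarMeasure (x : H) =
      ((calculusMeasure (resolventCalculus hT) y).withDensity
        fun t => ENNReal.ofReal (‖(t : ℂ)‖ ^ 2)).map (resolventCoord T) := by
    rw [spectralPVM, scalarMeasure_calculusPVM, ← hx, calculusMeasure_starAlgHom_apply]
    rfl
  have hmeas : Measurable fun t : spectrum ℂ (T.resolvent (-Complex.I)) =>
      ENNReal.ofReal (‖(t : ℂ)‖ ^ 2) :=
    ((continuous_subtype_val.norm.pow 2).measurable).ennreal_ofReal
  have hτ := measurable_resolventCoord T
  rw [hm]
  constructor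
  · rw [lintegral_map (by fun_prop) hτ,
      lintegral_withDensity_eq_lintegral_mul _ hmeas (by fun_prop)]
    refine lt_of_le_of_lt (lintegral_mono (g := fun _ => 1) fun t => ?_) (by simp)
    simp only [Pi.mul_apply]
    rw [← ENNReal.ofReal_mul (by positivity), ← ENNReal.ofReal_one]
    refine ENNReal.ofReal_le_ofReal ?_
    have h1 : resolventCoord T t ^ 2 ≤ ‖(t : ℂ)⁻¹‖ ^ 2 := by
      rw [sq_le_sq, abs_of_nonneg (norm_nonneg _)]
      exact Complex.abs_re_le_norm _
    rw [norm_inv, inv_pow] at h1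
    calc ‖(t : ℂ)‖ ^ 2 * resolventCoord T t ^ 2 ≤ ‖(t : ℂ)‖ ^ 2 * (‖(t : ℂ)‖ ^ 2)⁻¹ := by gcongr
      _ ≤ 1 := mul_inv_le_one
  · have h1 : T x = y - Complex.I • (x : H) := by rw [hy]; abel
    have hmeas2 : Measurable fun t : spectrum ℂ (T.resolvent (-Complex.I)) =>
        Real.toNNReal (‖(t : ℂ)‖ ^ 2) :=
      (continuous_subtype_val.norm.pow 2).measurable.real_toNNReal
    rw [integral_map (f := fun t : ℝ => t) hτ.aemeasurable
      measurable_id.aestronglyMeasurable]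
    have h4 := integral_withDensity_eq_integral_smul
      (μ := calculusMeasure (resolventCalculus hT) y) hmeas2 (resolventCoord T)
    have h5 : ∫ t, resolventCoord T t ∂((calculusMeasure (resolventCalculus hT) y).withDensity
        fun t => ENNReal.ofReal (‖(t : ℂ)‖ ^ 2)) = _ := h4
    rw [h5, ← integral_complex_ofReal, h1]
    -- With x = R y and T x = (1 - i R) y the form becomes ⟨y, R* (1 - i R) y⟩, a value of the
    -- calculus at y.
    have h6 : inner ℂ (x : H) (y - Complex.I • (x : H)) =
        inner ℂ y (resolventCalculus hT (star (resolventSymbol T) *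
          (1 - Complex.I • resolventSymbol T)) y) := by
      rw [← inner_starAlgHom_star_mul, _root_.map_sub, _root_.map_smul, map_one, hx, _root_.sub_apply,
        _root_.smul_apply, hx, one_apply_eq_self]
    rw [h6, ← integral_calculusMeasure]
    refine integral_congr_ae (ae_of_all _ fun t => ?_)
    simp only [NNReal.smul_def, smul_eq_mul]
    rw [Real.coe_toNNReal _ (by positivity), norm_sq_mul_resolventCoord hT]
    rfl

/-- The point r = 0 represents t = ∞, where `resolventCoord` has the default value 0, so it must
carry no mass. Vectors of the domain have a measure with density |r|²; hence the projection on r = 0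
vanishes on a dense set. -/
theorem calculusMeasure_symbol_zero (hT : IsSelfAdjoint T) (x : H) :
    calculusMeasure (resolventCalculus hT) x {r | (r : ℂ) = 0} = 0 := by
  have hZ : MeasurableSet {r : spectrum ℂ (T.resolvent (-Complex.I)) | (r : ℂ) = 0} :=
    measurable_subtype_coe (measurableSet_singleton (0 : ℂ))
  have h1 : ∀ u ∈ (T.domain : Set H),
      calculusProj (resolventCalculus hT) {r | (r : ℂ) = 0} u = 0 := by
    intro u hu
    have h2 := exists_resolvent_eq hT ⟨u, hu⟩
    simp only at h2
    rw [← resolventCalculus_symbol hT] at h2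
    have h3 : calculusMeasure (resolventCalculus hT) u {r | (r : ℂ) = 0} = 0 := by
      rw [← h2, calculusMeasure_starAlgHom_apply, withDensity_apply _ hZ]
      refine (setLIntegral_congr_fun hZ fun t ht => ?_).trans (lintegral_zero)
      have : resolventSymbol T t = 0 := ht
      simp [this]
    have h4 := norm_sq_calculusProj (resolventCalculus hT) u hZ
    rw [measureReal_def, h3] at h4
    simpa using h4
  have h5 : calculusProj (resolventCalculus hT) {r | (r : ℂ) = 0} = 0 := by
    ext u
    have := Continuous.ext_on hT.dense_domain
      (calculusProj (resolventCalculus hT) {r | (r : ℂ) = 0}).continuous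
      (continuous_const (y := (0 : H))) h1
    exact congrFun this u
  have h4 := norm_sq_calculusProj (resolventCalculus hT) x hZ
  rw [h5] at h4
  have h6 : (calculusMeasure (resolventCalculus hT) x).real {r | (r : ℂ) = 0} = 0 := by
    simpa using h4.symm
  exact (measureReal_eq_zero_iff (measure_ne_top _ _)).1 h6

theorem mem_domain_of_bound (hT : IsSelfAdjoint T) {x : H} (C : ℝ)
    (h : ∀ u : T.domain, ‖inner ℂ x (T u)‖ ≤ C * ‖(u : H)‖) : x ∈ T.domain := by
  have hx : x ∈ T.adjoint.domain := by
    rw [mem_adjoint_domain_iff]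
    exact AddMonoidHomClass.continuous_of_bound _ C h
  rwa [isSelfAdjoint_def.1 hT] at hx

/-- Regularize 1/r by f_n = conj r / (|r|² + δ_n). Since |f_n|² ≤ 1/|r|² ≤ t² + 1 off r = 0, the
vectors Φ(f_n) x stay bounded, and R Φ(f_n) x tends to x. As T R Φ(f_n) x is bounded too, u ↦ ⟨x, T
u⟩ is bounded, so x lies in the domain of the adjoint. -/
theorem isSpectralMeasureOf_domain_backward (hT : IsSelfAdjoint T) (x : H)
    (h : ∫⁻ t, ENNReal.ofReal (t ^ 2) ∂((spectralPVM hT).scalarMeasure x) < ∞) : x ∈ T.domain := by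
  set Φ := resolventCalculus hT
  set m := calculusMeasure Φ x
  set δ : ℕ → ℝ := fun n => 1 / ((n : ℝ) + 1)
  have hδ : ∀ n, 0 < δ n := fun n => Nat.one_div_pos_of_nat
  have hτ := measurable_resolventCoord T
  rw [spectralPVM, scalarMeasure_calculusPVM, lintegral_map (by fun_prop) hτ] at h
  have hint : Integrable (fun t => resolventCoord T t ^ 2) m :=
    ⟨(hτ.pow_const 2).aestronglyMeasurable, (hasFiniteIntegral_iff_ofReal
      (ae_of_all _ fun t => sq_nonneg _)).2 h⟩
  have hden : ∀ n (t : spectrum ℂ (T.resolvent (-Complex.I))),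
      ((‖(t : ℂ)‖ ^ 2 + δ n : ℝ) : ℂ) ≠ 0 := by
    intro n t
    have := hδ n
    exact Complex.ofReal_ne_zero.2 (by positivity)
  let f : ℕ → C(spectrum ℂ (T.resolvent (-Complex.I)), ℂ) := fun n =>
    ⟨fun t => conj (t : ℂ) / ((‖(t : ℂ)‖ ^ 2 + δ n : ℝ) : ℂ),
      Continuous.div (by fun_prop) (by fun_prop) (hden n)⟩
  set C : ℝ := Real.sqrt (∫ t, (resolventCoord T t ^ 2 + 1) ∂m)
  have hbound : ∀ n, ‖Φ (f n) x‖ ≤ C := by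
    intro n
    refine Real.le_sqrt_of_sq_le ?_
    rw [norm_sq_starAlgHom]
    refine integral_mono_of_nonneg (ae_of_all _ fun t => by positivity)
      (hint.add (integrable_const _)) (ae_of_all _ fun t => ?_)
    refine le_trans ?_ (norm_inv_sq_le_resolventCoord hT t)
    have hn := hδ n
    simp only [f, ContinuousMap.coe_mk]
    gcongr
    rw [norm_div, Complex.norm_conj, Complex.norm_real, norm_inv,
      Real.norm_of_nonneg (by positivity : 0 ≤ ‖(t : ℂ)‖ ^ 2 + δ n)]
    rcases eq_or_ne (‖(t : ℂ)‖) 0 with h0 | h0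
    · simp [h0]
    · have : 0 < ‖(t : ℂ)‖ := lt_of_le_of_ne (norm_nonneg _) h0.symm
      rw [div_le_iff₀ (by positivity), inv_mul_eq_div, le_div_iff₀ this]
      nlinarith
  have hlim : Tendsto (fun n => T.resolvent (-Complex.I) (Φ (f n) x)) atTop (𝓝 x) := by
    rw [tendsto_iff_norm_sub_tendsto_zero]
    have h1 : ∀ n, ‖T.resolvent (-Complex.I) (Φ (f n) x) - x‖ ^ 2 =
        ∫ t, (δ n / (‖(t : ℂ)‖ ^ 2 + δ n)) ^ 2 ∂m := by
      intro n
      have h2 : T.resolvent (-Complex.I) (Φ (f n) x) - x =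
          Φ (resolventSymbol T * f n - 1) x := by
        rw [_root_.map_sub, map_mul, map_one, _root_.sub_apply, mul_apply_eq_comp, one_apply_eq_self]
        rw [resolventCalculus_symbol hT]
      rw [h2, norm_sq_starAlgHom]
      refine integral_congr_ae (ae_of_all _ fun t => ?_)
      have h3 : (resolventSymbol T * f n - 1) t = ((-(δ n / (‖(t : ℂ)‖ ^ 2 + δ n)) : ℝ) : ℂ) := by
        change (t : ℂ) * (conj (t : ℂ) / ((‖(t : ℂ)‖ ^ 2 + δ n : ℝ) : ℂ)) - 1 = _
        have h4 := hden n t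
        rw [← mul_div_assoc, Complex.mul_conj, Complex.normSq_eq_norm_sq]
        push_cast at h4 ⊢
        field_simp
        ring
      simp only [h3, Complex.norm_real, norm_neg, Real.norm_eq_abs, sq_abs]
    have h4 : Tendsto (fun n => ∫ t, (δ n / (‖(t : ℂ)‖ ^ 2 + δ n)) ^ 2 ∂m) atTop
        (𝓝 (∫ _, 0 ∂m)) := by
      refine tendsto_integral_of_dominated_convergence (fun _ => 1) (fun n => ?_)
        (integrable_const _) (fun n => ae_of_all _ fun t => ?_) ?_
      · have hn := hδ n
        exact (Continuous.pow (Continuous.div (by fun_prop) (by fun_prop)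
          fun t => by positivity) 2).aestronglyMeasurable
      · have hn := hδ n
        rw [Real.norm_of_nonneg (by positivity)]
        refine pow_le_one₀ (by positivity) ?_
        rw [div_le_one (by positivity)]
        linarith [sq_nonneg ‖(t : ℂ)‖]
      · have h0 : ∀ᵐ t : spectrum ℂ (T.resolvent (-Complex.I)) ∂m, (t : ℂ) ≠ 0 := by
          rw [ae_iff]
          simp only [not_not, ne_eq]
          exact calculusMeasure_symbol_zero hT x
        filter_upwards [h0] with t ht
        have hd : Tendsto δ atTop (𝓝 0) := tendsto_one_div_add_atTop_nhds_zero_nat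
        have := (hd.div (hd.const_add (‖(t : ℂ)‖ ^ 2))
          (by simpa using ht)).pow 2
        simpa using this
    simp only [integral_zero, ← h1] at h4
    simpa [Real.sqrt_sq (norm_nonneg _)] using h4.sqrt
  have hz : (-Complex.I).im ≠ 0 := by simp
  -- T R y = y - i R y and ‖R‖ ≤ 1, so each of the two terms is at most C.
  refine mem_domain_of_bound hT (C + C) fun u => ?_
  have h5 : Tendsto (fun n => ‖inner ℂ (T.resolvent (-Complex.I) (Φ (f n) x)) (T u)‖) atTop
      (𝓝 ‖inner ℂ x (T u)‖) := (hlim.inner tendsto_const_nhds).norm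
  refine le_of_tendsto' h5 fun n => ?_
  have h6 := inner_apply_comm hT ⟨_, resolvent_mem hT hz (Φ (f n) x)⟩ u
  rw [apply_resolvent hT hz] at h6
  simp only at h6
  rw [← h6]
  refine (norm_inner_le_norm _ _).trans ?_
  gcongr
  refine (norm_add_le _ _).trans (add_le_add (hbound n) ?_)
  rw [norm_smul]
  have h7 := norm_resolvent_apply_le hT hz (Φ (f n) x)
  simp only [Complex.neg_im, Complex.I_im, abs_neg, abs_one, inv_one, one_mul] at h7
  simpa using h7.trans (hbound n)

/-- The spectral theorem: a self-adjoint operator has a spectral measure. -/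
theorem isSpectralMeasureOf_spectralPVM (hT : IsSelfAdjoint T) :
    (spectralPVM hT).IsSpectralMeasureOf T :=
  ⟨fun x => ⟨fun hx => (isSpectralMeasureOf_domain_forward hT ⟨x, hx⟩).1,
    isSpectralMeasureOf_domain_backward hT x⟩,
    fun x => (isSpectralMeasureOf_domain_forward hT x).2⟩

theorem isSpectralMeasureOf_spectralMeasure (hT : IsSelfAdjoint T) :
    (spectralMeasure T).IsSpectralMeasureOf T :=
  Classical.epsilon_spec (p := fun E : ProjectionValuedMeasure H => E.IsSpectralMeasureOf T)
    ⟨_, isSpectralMeasureOf_spectralPVM hT⟩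

end LinearPMap

end Existence

section Uniqueness

/-! ### The Stieltjes transform of a spectral measure -/

variable {H : Type*} [NormedAddCommGroup H] [InnerProductSpace ℂ H] [CompleteSpace H]

namespace ProjectionValuedMeasure

variable (E : ProjectionValuedMeasure H)

instance isFiniteMeasure_scalarMeasure (x : H) : IsFiniteMeasure (E.scalarMeasure x) :=
  ⟨by rw [E.scalarMeasure_apply x MeasurableSet.univ]; exact ENNReal.ofReal_lt_top⟩

variable {S S' : Set ℝ}

theorem inner_proj_comm (hS : MeasurableSet S) (x y : H) :
    inner ℂ (E.proj S x) y = inner ℂ x (E.proj S y) := by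
  have h := ContinuousLinearMap.adjoint_inner_left (E.proj S) y x
  rwa [← ContinuousLinearMap.star_eq_adjoint, (E.isStarProjection S hS).isSelfAdjoint.star_eq] at h

theorem proj_proj_self (hS : MeasurableSet S) (x : H) :
    E.proj S (E.proj S x) = E.proj S x := by
  have := (E.isStarProjection S hS).isIdempotentElem.eq
  exact congrArg (fun A : H →L[ℂ] H => A x) this

theorem norm_sq_proj (hS : MeasurableSet S) (x : H) :
    ‖E.proj S x‖ ^ 2 = (E.scalarMeasure x).real S := by
  have h2 : inner ℂ x (E.proj S x) = inner ℂ (E.proj S x) (E.proj S x) := by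
    rw [inner_proj_comm E hS, proj_proj_self E hS]
  rw [measureReal_def, E.scalarMeasure_apply x hS, ENNReal.toReal_ofReal (E.inner_nonneg x hS), h2,
    inner_self_eq_norm_sq_to_K]
  norm_cast

theorem inner_proj (hS : MeasurableSet S) (x : H) :
    inner ℂ x (E.proj S x) = ((E.scalarMeasure x).real S : ℂ) := by
  rw [← norm_sq_proj E hS, ← proj_proj_self E hS, ← inner_proj_comm E hS, proj_proj_self E hS,
    inner_self_eq_norm_sq_to_K]
  norm_cast

theorem measureReal_scalarMeasure_univ (x : H) : (E.scalarMeasure x).real univ = ‖x‖ ^ 2 := by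
  rw [← norm_sq_proj E MeasurableSet.univ, E.proj_univ]
  rfl

theorem proj_add_proj_compl (hS : MeasurableSet S) (x : H) :
    E.proj S x + E.proj Sᶜ x = x := by
  have h : E.proj S + E.proj Sᶜ = 1 := by
    refine ContinuousLinearMap.ext_inner_self fun x => ?_
    rw [add_apply, inner_add_right, inner_proj E hS, inner_proj E hS.compl, ← Complex.ofReal_add,
      measureReal_add_measureReal_compl hS, measureReal_scalarMeasure_univ, one_apply_eq_self,
      inner_self_eq_norm_sq_to_K]
    norm_cast
  exact congrArg (fun A : H →L[ℂ] H => A x) h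

/-- The vector u = E(S') x has its whole mass ‖u‖² in S', so nothing is left for the disjoint set S.
-/
theorem proj_proj_of_disjoint (hS : MeasurableSet S) (hS' : MeasurableSet S')
    (hd : Disjoint S S') (x : H) : E.proj S (E.proj S' x) = 0 := by
  set u := E.proj S' x
  have h1 : (E.scalarMeasure u).real S + (E.scalarMeasure u).real S' ≤ ‖u‖ ^ 2 := by
    rw [← measureReal_union hd hS', ← measureReal_scalarMeasure_univ E u]
    exact measureReal_mono (subset_univ _)
  rw [← norm_sq_proj E hS' u, ← norm_sq_proj E hS u, proj_proj_self E hS'] at h1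
  have h2 : ‖E.proj S u‖ ^ 2 ≤ 0 := by linarith
  exact norm_eq_zero.1 (pow_eq_zero_iff two_ne_zero |>.1 (le_antisymm h2 (sq_nonneg _)))

theorem proj_proj_of_subset (hS : MeasurableSet S) (hS' : MeasurableSet S') (h : S' ⊆ S) (x : H) :
    E.proj S (E.proj S' x) = E.proj S' x := by
  have h1 := proj_add_proj_compl E hS (E.proj S' x)
  rwa [proj_proj_of_disjoint E hS.compl hS' (disjoint_compl_left_iff_subset.2 h), add_zero] at h1

theorem proj_inter (hS : MeasurableSet S) (hS' : MeasurableSet S') (x : H) :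
    E.proj S (E.proj S' x) = E.proj (S ∩ S') x := by
  have hadd : E.proj S' = E.proj (S ∩ S') + E.proj (S' \ S) := by
    refine ContinuousLinearMap.ext_inner_self fun x => ?_
    rw [add_apply, inner_add_right, inner_proj E hS', inner_proj E (hS.inter hS'),
      inner_proj E (hS'.diff hS), ← Complex.ofReal_add, inter_comm,
      measureReal_inter_add_sdiff hS]
  rw [hadd, add_apply, map_add, proj_proj_of_subset E hS (hS.inter hS') inter_subset_left,
    proj_proj_of_disjoint E hS (hS'.diff hS) disjoint_sdiff_right, add_zero]

theorem scalarMeasure_proj (hS : MeasurableSet S) (x : H) :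
    E.scalarMeasure (E.proj S x) = (E.scalarMeasure x).restrict S := by
  refine Measure.ext fun A hA => ?_
  rw [Measure.restrict_apply hA, ← ofReal_measureReal, ← norm_sq_proj E hA, proj_inter E hA hS,
    norm_sq_proj E (hA.inter hS), ofReal_measureReal]

theorem scalarMeasure_add_of_disjoint (hS : MeasurableSet S) (hS' : MeasurableSet S')
    (hd : Disjoint S S') {v w : H} (hv : E.proj S v = v) (hw : E.proj S' w = w) :
    E.scalarMeasure (v + w) = E.scalarMeasure v + E.scalarMeasure w := by
  refine Measure.ext fun A hA => ?_
  have h0 : inner ℂ (E.proj A v) (E.proj A w) = 0 := by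
    rw [inner_proj_comm E hA, proj_proj_self E hA, ← hv, inner_proj_comm E hS, ← hw,
      proj_inter E hA hS', proj_proj_of_disjoint E hS (hA.inter hS')
      (hd.mono_right inter_subset_right), inner_zero_right]
  rw [Measure.add_apply, ← ofReal_measureReal, ← ofReal_measureReal (μ := E.scalarMeasure v),
    ← ofReal_measureReal (μ := E.scalarMeasure w), ← ENNReal.ofReal_add measureReal_nonneg
    measureReal_nonneg, ← norm_sq_proj E hA, ← norm_sq_proj E hA, ← norm_sq_proj E hA, map_add,
    norm_add_sq (𝕜 := ℂ), h0]
  simp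

/-! ### Reduction of an operator by its spectral projections -/

namespace IsSpectralMeasureOf

variable {E} {T : H →ₗ.[ℂ] H} (hE : E.IsSpectralMeasureOf T)

include hE

theorem integrable_sq (u : T.domain) :
    Integrable (fun t : ℝ => t ^ 2) (E.scalarMeasure (u : H)) :=
  ⟨(measurable_id.pow_const 2).aestronglyMeasurable, (hasFiniteIntegral_iff_ofReal
      (ae_of_all _ fun _ => sq_nonneg _)).2 ((hE.1 u).1 u.2)⟩

theorem integrable_id (u : T.domain) :
    Integrable (fun t : ℝ => t) (E.scalarMeasure (u : H)) := by
  refine ((integrable_sq hE u).add (integrable_const (1 : ℝ))).mono'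
    measurable_id.aestronglyMeasurable (ae_of_all _ fun t => ?_)
  simp only [Pi.add_apply, Real.norm_eq_abs]
  nlinarith [sq_abs t, sq_nonneg (|t| - 1), abs_nonneg t]

theorem proj_mem_domain (hS : MeasurableSet S) {u : H} (hu : u ∈ T.domain) :
    E.proj S u ∈ T.domain := by
  rw [hE.1, scalarMeasure_proj E hS]
  exact (setLIntegral_le_lintegral _ _).trans_lt ((hE.1 u).1 hu)

theorem proj_mem_domain_of_bounded (hS : MeasurableSet S) {C : ℝ} (hC : ∀ t ∈ S, |t| ≤ C) (u : H) :
    E.proj S u ∈ T.domain := by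
  rw [hE.1, scalarMeasure_proj E hS]
  calc ∫⁻ t in S, ENNReal.ofReal (t ^ 2) ∂(E.scalarMeasure u)
      ≤ ∫⁻ t in S, ENNReal.ofReal (C ^ 2) ∂(E.scalarMeasure u) := by
        refine setLIntegral_mono measurable_const fun t ht => ENNReal.ofReal_le_ofReal ?_
        rw [← sq_abs]
        exact pow_le_pow_left₀ (abs_nonneg _) (hC t ht) 2
    _ < ∞ := by
        rw [setLIntegral_const]
        exact ENNReal.mul_lt_top ENNReal.ofReal_lt_top (measure_lt_top _ _)

/-- Only the diagonal values ⟨u, T u⟩ are prescribed. Expanding the one at v + w, whose scalar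
measure is the sum of the two, leaves 2 Re ⟨w, T v⟩ = 0. -/
theorem re_inner_apply_eq_zero (hT : IsSelfAdjoint T) (hS : MeasurableSet S)
    (hS' : MeasurableSet S') (hd : Disjoint S S') {v w : T.domain}
    (hv : E.proj S (v : H) = v) (hw : E.proj S' (w : H) = w) :
    (inner ℂ (w : H) (T v)).re = 0 := by
  have h1 := hE.2 (v + w)
  have h2 := scalarMeasure_add_of_disjoint E hS hS' hd hv hw
  rw [Submodule.coe_add, h2, integral_add_measure (integrable_id hE v) (integrable_id hE w),
    T.map_add, inner_add_left, inner_add_right, inner_add_right, hE.2 v, hE.2 w,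
    ← LinearPMap.inner_apply_comm hT v w, ← inner_conj_symm (T v)] at h1
  have h3 := congrArg Complex.re h1
  simp only [Complex.add_re, Complex.ofReal_re, Complex.conj_re] at h3
  linarith

theorem inner_apply_eq_zero (hT : IsSelfAdjoint T) (hS : MeasurableSet S)
    (hS' : MeasurableSet S') (hd : Disjoint S S') {v w : T.domain}
    (hv : E.proj S (v : H) = v) (hw : E.proj S' (w : H) = w) :
    inner ℂ (w : H) (T v) = 0 := by
  refine Complex.ext (re_inner_apply_eq_zero hE hT hS hS' hd hv hw) ?_
  have h := re_inner_apply_eq_zero hE hT hS hS' hd (w := Complex.I • w) hv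
    (by rw [Submodule.coe_smul, map_smul, hw])
  rw [Submodule.coe_smul, inner_smul_left] at h
  simpa using h

theorem proj_compl_apply_proj (hT : IsSelfAdjoint T) (hS : MeasurableSet S) (u : T.domain) :
    E.proj Sᶜ (T ⟨_, proj_mem_domain hE hS u.2⟩) = 0 := by
  refine hT.dense_domain.eq_zero_of_inner_right ℂ fun w hw => ?_
  rw [← inner_proj_comm E hS.compl]
  exact inner_apply_eq_zero hE hT hS hS.compl disjoint_compl_right
    (v := ⟨_, proj_mem_domain hE hS u.2⟩) (w := ⟨_, proj_mem_domain hE hS.compl hw⟩)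
    (proj_proj_self E hS _) (proj_proj_self E hS.compl _)

/-- The projections of a spectral measure reduce the operator. -/
theorem apply_proj (hT : IsSelfAdjoint T) (hS : MeasurableSet S) (u : T.domain) :
    T ⟨_, proj_mem_domain hE hS u.2⟩ = E.proj S (T u) := by
  have h1 : u = ⟨_, proj_mem_domain hE hS u.2⟩ + ⟨_, proj_mem_domain hE hS.compl u.2⟩ :=
    Subtype.ext (proj_add_proj_compl E hS (u : H)).symm
  have h2 : T u = T ⟨_, proj_mem_domain hE hS u.2⟩ + T ⟨_, proj_mem_domain hE hS.compl u.2⟩ := by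
    conv_lhs => rw [h1]
    rw [T.map_add]
  have h3 := proj_compl_apply_proj hE hT hS.compl u
  have h4 := proj_add_proj_compl E hS (T ⟨_, proj_mem_domain hE hS u.2⟩)
  rw [proj_compl_apply_proj hE hT hS u, add_zero] at h4
  rw [h2, map_add, h4]
  simp only [compl_compl] at h3
  rw [h3, add_zero]

theorem re_inner_apply_sub_mem {c ε : ℝ} (hS : MeasurableSet S)
    (hSc : S ⊆ Icc c (c + ε)) {v : T.domain} (hv : E.proj S (v : H) = v) :
    0 ≤ (inner ℂ (v : H) (T v)).re - c * ‖(v : H)‖ ^ 2 ∧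
      (inner ℂ (v : H) (T v)).re - c * ‖(v : H)‖ ^ 2 ≤ ε * ‖(v : H)‖ ^ 2 := by
  have h1 : (inner ℂ (v : H) (T v)).re - c * ‖(v : H)‖ ^ 2 =
      ∫ t, (t - c) ∂(E.scalarMeasure (v : H)) := by
    rw [hE.2, Complex.ofReal_re, integral_sub (integrable_id hE v) (integrable_const c),
      integral_const, measureReal_scalarMeasure_univ, smul_eq_mul, mul_comm c]
  have hae : ∀ᵐ t ∂(E.scalarMeasure (v : H)), t ∈ S := by
    rw [← hv, scalarMeasure_proj E hS]
    exact ae_restrict_mem hS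
  rw [h1]
  constructor
  · refine integral_nonneg_of_ae ?_
    filter_upwards [hae] with t ht
    simpa using (hSc ht).1
  · calc ∫ t, (t - c) ∂(E.scalarMeasure (v : H)) ≤ ∫ _, ε ∂(E.scalarMeasure (v : H)) := by
          refine integral_mono_ae ((integrable_id hE v).sub (integrable_const c))
            (integrable_const ε) ?_
          filter_upwards [hae] with t ht
          have := (hSc ht).2
          linarith
      _ = ε * ‖(v : H)‖ ^ 2 := by
          rw [integral_const, measureReal_scalarMeasure_univ, smul_eq_mul, mul_comm]

/-- On the range of the projection of a short interval the operator is almost a scalar. -/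
theorem norm_apply_sub_smul_le (hT : IsSelfAdjoint T) {c ε : ℝ} (hε : 0 < ε)
    (hS : MeasurableSet S) (hSc : S ⊆ Icc c (c + ε)) {v : T.domain}
    (hv : E.proj S (v : H) = v) : ‖T v - (c : ℂ) • (v : H)‖ ≤ ε * ‖(v : H)‖ := by
  set w : H := T v - (c : ℂ) • (v : H)
  have hv' : (⟨_, proj_mem_domain hE hS v.2⟩ : T.domain) = v := Subtype.ext hv
  have hTv : E.proj S (T v) = T v := by rw [← apply_proj hE hT hS v, hv']
  have hw : E.proj S w = w := by
    change E.proj S (T v - (c : ℂ) • (v : H)) = _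
    rw [map_sub, map_smul, hv, hTv]
  have hwd : w ∈ T.domain := by
    rw [← hw]
    refine proj_mem_domain_of_bounded hE hS (C := |c| + ε) (fun t ht => ?_) w
    have h1 := (hSc ht).1
    have h2 := (hSc ht).2
    rw [abs_le]
    constructor
    · linarith [neg_abs_le c]
    · linarith [le_abs_self c]
  -- With A = T - c and w = A v, positivity of the form of A at v - w/ε, and 0 ≤ A ≤ ε in the form
  -- sense at v and at w, give 0 ≤ ε‖v‖² - 2‖w‖²/ε + ‖w‖²/ε, which is the claim.
  have q1 := (re_inner_apply_sub_mem hE hS hSc hv).2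
  have q2 := (re_inner_apply_sub_mem hE hS hSc (v := ⟨w, hwd⟩) hw).2
  have q3 := (re_inner_apply_sub_mem hE hS hSc (v := v - ((ε⁻¹ : ℝ) : ℂ) • ⟨w, hwd⟩)
    (by rw [Submodule.coe_sub, Submodule.coe_smul, map_sub, map_smul, hv, hw])).1
  have e1 : (inner ℂ w (T v)).re - c * (inner ℂ w (v : H)).re = ‖w‖ ^ 2 := by
    have h : inner ℂ w w = inner ℂ w (T v) - c * inner ℂ w (v : H) := by
      conv_lhs => rw [show w = T v - (c : ℂ) • (v : H) from rfl]
      rw [inner_sub_right, inner_smul_right]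
    have h2 := congrArg Complex.re h
    rw [inner_self_eq_norm_sq_to_K, Complex.sub_re, Complex.re_ofReal_mul] at h2
    rw [← h2]
    norm_cast
  have e2 : (inner ℂ (v : H) (T ⟨w, hwd⟩)).re = (inner ℂ w (T v)).re := by
    rw [← LinearPMap.inner_apply_comm hT v ⟨w, hwd⟩, ← inner_conj_symm, Complex.conj_re]
  have e3 : ‖(v : H) - ((ε⁻¹ : ℝ) : ℂ) • w‖ ^ 2 =
      ‖(v : H)‖ ^ 2 - 2 * ε⁻¹ * (inner ℂ w (v : H)).re + ε⁻¹ ^ 2 * ‖w‖ ^ 2 := by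
    rw [norm_sub_sq (𝕜 := ℂ), inner_smul_right, norm_smul, Complex.norm_real,
      Real.norm_of_nonneg (inv_nonneg.2 hε.le), ← inner_conj_symm]
    simp only [RCLike.re_to_complex, Complex.re_ofReal_mul, Complex.conj_re]
    ring
  have e4 : (inner ℂ ((v - ((ε⁻¹ : ℝ) : ℂ) • ⟨w, hwd⟩ : T.domain) : H)
      (T (v - ((ε⁻¹ : ℝ) : ℂ) • ⟨w, hwd⟩))).re = (inner ℂ (v : H) (T v)).re -
        2 * ε⁻¹ * (inner ℂ w (T v)).re + ε⁻¹ ^ 2 * (inner ℂ w (T ⟨w, hwd⟩)).re := by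
    rw [T.map_sub, T.map_smul, Submodule.coe_sub, Submodule.coe_smul]
    simp only [inner_sub_left, inner_sub_right, inner_smul_left, inner_smul_right,
      Complex.sub_re, Complex.conj_ofReal, Complex.re_ofReal_mul, e2]
    ring
  rw [e4] at q3
  simp only [Submodule.coe_sub, Submodule.coe_smul] at q3 q2
  rw [e3] at q3
  have h5 : ε⁻¹ ^ 2 * ((inner ℂ w (T ⟨w, hwd⟩)).re - c * ‖w‖ ^ 2) ≤ ε⁻¹ * ‖w‖ ^ 2 := by
    calc _ ≤ ε⁻¹ ^ 2 * (ε * ‖w‖ ^ 2) := by gcongr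
      _ = ε⁻¹ * ‖w‖ ^ 2 := by field_simp
  have h6 : ε⁻¹ * ‖w‖ ^ 2 ≤ ε * ‖(v : H)‖ ^ 2 := by
    have h7 : 2 * ε⁻¹ * ((inner ℂ w (T v)).re - c * (inner ℂ w (v : H)).re) =
        2 * ε⁻¹ * ‖w‖ ^ 2 := by rw [e1]
    linarith
  refine (sq_le_sq₀ (norm_nonneg _) (by positivity)).1 ?_
  rw [inv_mul_eq_div, div_le_iff₀ hε] at h6
  linarith

/-- On the range of the projection of a short interval, `T - z` is almost the multiplication
by `t - z`, for any `t` in the interval. -/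
theorem norm_apply_sub_smul_bounds (hT : IsSelfAdjoint T) {c ε : ℝ} (hε : 0 < ε)
    (hS : MeasurableSet S) (hSc : S ⊆ Icc c (c + ε)) {z : ℂ} (hz : z.im ≠ 0) (u : T.domain)
    {t : ℝ} (ht : t ∈ S) :
    ‖E.proj S (T u - z • (u : H))‖ ≤
        (1 + 2 * ε / |z.im|) * ‖(t : ℂ) - z‖ * ‖E.proj S (u : H)‖ ∧
      max 0 (1 - 2 * ε / |z.im|) * ‖(t : ℂ) - z‖ * ‖E.proj S (u : H)‖ ≤
        ‖E.proj S (T u - z • (u : H))‖ := by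
  have hη : 0 < |z.im| := abs_pos.2 hz
  have h1 := norm_apply_sub_smul_le hE hT hε hS hSc
    (v := ⟨_, proj_mem_domain hE hS u.2⟩) (proj_proj_self E hS _)
  rw [apply_proj hE hT hS u] at h1
  simp only at h1
  have h2 : E.proj S (T u - z • (u : H)) = (E.proj S (T u) - (c : ℂ) • E.proj S (u : H)) +
      ((c : ℂ) - z) • E.proj S (u : H) := by
    rw [map_sub, map_smul, sub_smul]; abel
  have h3 : ‖(t : ℂ) - c‖ ≤ ε := by
    rw [← Complex.ofReal_sub, Complex.norm_real, Real.norm_eq_abs, abs_le]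
    constructor <;> linarith [(hSc ht).1, (hSc ht).2]
  have h4 : ‖(c : ℂ) - z‖ ≤ ‖(t : ℂ) - z‖ + ε := by
    have : (c : ℂ) - z = ((t : ℂ) - z) - ((t : ℂ) - c) := by ring
    rw [this]
    exact (norm_sub_le _ _).trans (by gcongr)
  have h5 : ‖(t : ℂ) - z‖ - ε ≤ ‖(c : ℂ) - z‖ := by
    have : (t : ℂ) - z = ((c : ℂ) - z) + ((t : ℂ) - c) := by ring
    have h := norm_add_le ((c : ℂ) - z) ((t : ℂ) - c)
    rw [← this] at h
    linarith
  have h6 : |z.im| ≤ ‖(t : ℂ) - z‖ := by simpa using Complex.abs_im_le_norm ((t : ℂ) - z)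
  -- One ε comes from replacing T by c and one from replacing c by t. As |t - z| ≥ |Im z|, the total
  -- is a relative error.
  have h7 : 2 * ε ≤ 2 * ε / |z.im| * ‖(t : ℂ) - z‖ := by
    rw [div_mul_eq_mul_div, le_div_iff₀ hη]
    gcongr
  set p := E.proj S (u : H)
  set q := E.proj S (T u) - (c : ℂ) • p
  have hp : 0 ≤ ‖p‖ := norm_nonneg _
  rw [h2]
  have h8 : ‖((c : ℂ) - z) • p‖ = ‖(c : ℂ) - z‖ * ‖p‖ := norm_smul _ _
  constructor
  · refine (norm_add_le _ _).trans ?_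
    rw [h8]
    nlinarith
  · rcases le_total (1 - 2 * ε / |z.im|) 0 with h9 | h9
    · rw [max_eq_left h9]; simp
    · rw [max_eq_right h9]
      have h10 : ‖((c : ℂ) - z) • p‖ - ‖q‖ ≤ ‖q + ((c : ℂ) - z) • p‖ := by
        rw [add_comm]
        have := norm_sub_norm_le (((c : ℂ) - z) • p) (-q)
        rwa [norm_neg, sub_neg_eq_add] at this
      rw [h8] at h10
      nlinarith

/-- The pointwise bounds hold for every t in S with the same vector norm, so they may be averaged
over S against the scalar measure of u. -/
theorem scalarMeasure_le_setLIntegral (hT : IsSelfAdjoint T) {c ε : ℝ} (hε : 0 < ε)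
    (hS : MeasurableSet S) (hSc : S ⊆ Icc c (c + ε)) {z : ℂ} (hz : z.im ≠ 0) (u : T.domain) :
    E.scalarMeasure (T u - z • (u : H)) S ≤ ENNReal.ofReal ((1 + 2 * ε / |z.im|) ^ 2) *
        ∫⁻ t in S, ENNReal.ofReal (‖(t : ℂ) - z‖ ^ 2) ∂(E.scalarMeasure (u : H)) ∧
      ENNReal.ofReal (max 0 (1 - 2 * ε / |z.im|) ^ 2) *
        ∫⁻ t in S, ENNReal.ofReal (‖(t : ℂ) - z‖ ^ 2) ∂(E.scalarMeasure (u : H)) ≤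
      E.scalarMeasure (T u - z • (u : H)) S := by
  have hb := fun t (ht : t ∈ S) => norm_apply_sub_smul_bounds hE hT hε hS hSc hz u ht
  set m := E.scalarMeasure (u : H)
  set a := E.scalarMeasure (T u - z • (u : H)) S with ha
  have hη : 0 < |z.im| := abs_pos.2 hz
  have ha' : a = ENNReal.ofReal (‖E.proj S (T u - z • (u : H))‖ ^ 2) := by
    rw [norm_sq_proj E hS, ofReal_measureReal]
  have hm' : m S = ENNReal.ofReal (‖E.proj S (u : H)‖ ^ 2) := by
    rw [norm_sq_proj E hS, ofReal_measureReal]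
  have hup : ∀ t ∈ S, a ≤ ENNReal.ofReal ((1 + 2 * ε / |z.im|) ^ 2) *
      ENNReal.ofReal (‖(t : ℂ) - z‖ ^ 2) * m S := by
    intro t ht
    rw [ha', hm', ← ENNReal.ofReal_mul (by positivity), ← ENNReal.ofReal_mul (by positivity),
      ← mul_pow, ← mul_pow]
    exact ENNReal.ofReal_le_ofReal (pow_le_pow_left₀ (norm_nonneg _) (hb t ht).1 2)
  have hlow : ∀ t ∈ S, ENNReal.ofReal (max 0 (1 - 2 * ε / |z.im|) ^ 2) *
      ENNReal.ofReal (‖(t : ℂ) - z‖ ^ 2) * m S ≤ a := by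
    intro t ht
    rw [ha', hm', ← ENNReal.ofReal_mul (by positivity), ← ENNReal.ofReal_mul (by positivity),
      ← mul_pow, ← mul_pow]
    exact ENNReal.ofReal_le_ofReal (pow_le_pow_left₀ (by positivity) (hb t ht).2 2)
  rcases S.eq_empty_or_nonempty with h0 | ⟨s, hs⟩
  · simp [ha, h0]
  have hfin : m S ≠ ∞ := measure_ne_top _ _
  rw [← lintegral_const_mul' _ _ ENNReal.ofReal_ne_top,
    ← lintegral_const_mul' _ _ ENNReal.ofReal_ne_top]
  rcases eq_or_ne (m S) 0 with hm0 | hm0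
  · have h1 := hup s hs
    rw [hm0, mul_zero, nonpos_iff_eq_zero] at h1
    rw [Measure.restrict_eq_zero.2 hm0, h1]
    simp
  have hconst : ∫⁻ _ in S, a / m S ∂m = a := by
    rw [setLIntegral_const, ENNReal.div_mul_cancel hm0 hfin]
  constructor
  · conv_lhs => rw [← hconst]
    exact setLIntegral_mono' hS fun t ht => ENNReal.div_le_of_le_mul (hup t ht)
  · conv_rhs => rw [← hconst]
    exact setLIntegral_mono' hS fun t ht =>
      (ENNReal.le_div_iff_mul_le (Or.inl hm0) (Or.inl hfin)).2 (hlow t ht)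

/-- Cut a set into cells of length ε, sum the relative bounds over the cells, and let ε tend to 0.
-/
theorem scalarMeasure_apply_sub_smul (hT : IsSelfAdjoint T) {z : ℂ} (hz : z.im ≠ 0)
    (u : T.domain) : E.scalarMeasure (T u - z • (u : H)) =
      (E.scalarMeasure (u : H)).withDensity fun t => ENNReal.ofReal (‖(t : ℂ) - z‖ ^ 2) := by
  set x := T u - z • (u : H)
  set M := (E.scalarMeasure (u : H)).withDensity fun t => ENNReal.ofReal (‖(t : ℂ) - z‖ ^ 2)
  have key : ∀ A, MeasurableSet A → ∀ ε : ℝ, 0 < ε →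
      E.scalarMeasure x A ≤ ENNReal.ofReal ((1 + 2 * ε / |z.im|) ^ 2) * M A ∧
      ENNReal.ofReal (max 0 (1 - 2 * ε / |z.im|) ^ 2) * M A ≤ E.scalarMeasure x A := by
    intro A hA ε hε
    have hsum : ∀ ρ : Measure ℝ, ρ A = ∑' k : ℤ, ρ (A ∩ Ico (k • ε) ((k + 1) • ε)) := by
      intro ρ
      rw [← measure_iUnion]
      · rw [← inter_iUnion, iUnion_Ico_zsmul hε, inter_univ]
      · exact fun i j hij => ((pairwise_disjoint_Ico_zsmul ε) hij).mono inter_subset_right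
          inter_subset_right
      · exact fun k => hA.inter measurableSet_Ico
    have hcell := fun k : ℤ => scalarMeasure_le_setLIntegral hE hT hε
      (S := A ∩ Ico (k • ε) ((k + 1) • ε)) (c := k • ε) (hA.inter measurableSet_Ico)
      (fun t ht => ⟨ht.2.1, by have := ht.2.2.le; rwa [add_smul, one_smul] at this⟩) hz u
    have hM : ∀ k : ℤ, M (A ∩ Ico (k • ε) ((k + 1) • ε)) =
        ∫⁻ t in A ∩ Ico (k • ε) ((k + 1) • ε), ENNReal.ofReal (‖(t : ℂ) - z‖ ^ 2)
          ∂(E.scalarMeasure (u : H)) := fun k => withDensity_apply _ (hA.inter measurableSet_Ico)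
    rw [hsum M, hsum (E.scalarMeasure x), ← ENNReal.tsum_mul_left, ← ENNReal.tsum_mul_left]
    simp only [hM]
    exact ⟨ENNReal.tsum_le_tsum fun k => (hcell k).1, ENNReal.tsum_le_tsum fun k => (hcell k).2⟩
  refine Measure.ext fun A hA => ?_
  have hlim : Tendsto (fun n : ℕ => 1 / ((n : ℝ) + 1)) atTop (𝓝 0) :=
    tendsto_one_div_add_atTop_nhds_zero_nat
  refine le_antisymm ?_ ?_
  · have h1 : Tendsto (fun n : ℕ => ENNReal.ofReal ((1 + 2 * (1 / ((n : ℝ) + 1)) / |z.im|) ^ 2) *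
        M A) atTop (𝓝 (1 * M A)) := by
      refine ENNReal.Tendsto.mul_const ?_ (Or.inl one_ne_zero)
      have h2 : Continuous fun ε : ℝ => ENNReal.ofReal ((1 + 2 * ε / |z.im|) ^ 2) :=
        ENNReal.continuous_ofReal.comp (by fun_prop)
      have := (h2.tendsto 0).comp hlim
      simpa [Function.comp_def] using this
    rw [one_mul] at h1
    exact ge_of_tendsto' h1 fun n => (key A hA _ Nat.one_div_pos_of_nat).1
  · have h1 : Tendsto (fun n : ℕ =>
        ENNReal.ofReal (max 0 (1 - 2 * (1 / ((n : ℝ) + 1)) / |z.im|) ^ 2) * M A) atTop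
        (𝓝 (1 * M A)) := by
      refine ENNReal.Tendsto.mul_const ?_ (Or.inl one_ne_zero)
      have h2 : Continuous fun ε : ℝ => ENNReal.ofReal (max 0 (1 - 2 * ε / |z.im|) ^ 2) :=
        ENNReal.continuous_ofReal.comp (by fun_prop)
      have := (h2.tendsto 0).comp hlim
      simpa [Function.comp_def] using this
    rw [one_mul] at h1
    exact le_of_tendsto' h1 fun n => (key A hA _ Nat.one_div_pos_of_nat).2

/-- The Stieltjes transform of a spectral measure is the resolvent. -/
theorem stieltjes_scalarMeasure (hT : IsSelfAdjoint T) {z : ℂ} (hz : z.im ≠ 0) (x : H) :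
    stieltjes (E.scalarMeasure x) z = inner ℂ x (T.resolvent z x) := by
  set u : T.domain := ⟨_, LinearPMap.resolvent_mem hT hz x⟩
  have hx : T u - z • (u : H) = x := by
    rw [LinearPMap.apply_resolvent hT hz]
    exact add_sub_cancel_right _ _
  have hm := scalarMeasure_apply_sub_smul hE hT hz u
  rw [hx] at hm
  have hmeas : Measurable fun t : ℝ => Real.toNNReal (‖(t : ℂ) - z‖ ^ 2) :=
    (Continuous.measurable (by fun_prop)).real_toNNReal
  -- Since x = (T - z) u, this is ⟨u, T u⟩ minus conj z times ‖u‖². The density |t - z|² of x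
  -- relative to u turns (t - z)⁻¹ into the same integrand.
  have h1 : inner ℂ x (u : H) = ∫ t, ((t : ℂ) - conj z) ∂(E.scalarMeasure (u : H)) := by
    rw [integral_sub (integrable_id hE u).ofReal (integrable_const _), integral_complex_ofReal,
      ← hE.2 u, integral_const, measureReal_scalarMeasure_univ]
    conv_lhs => rw [← hx]
    rw [inner_sub_left, inner_smul_left, LinearPMap.inner_apply_comm hT,
      inner_self_eq_norm_sq_to_K, Complex.real_smul, mul_comm]
    push_cast
    rfl
  have h2 : inner ℂ x (T.resolvent z x) = inner ℂ x (u : H) := rfl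
  rw [h2, h1, stieltjes, hm]
  have h4 := integral_withDensity_eq_integral_smul (μ := E.scalarMeasure (u : H)) hmeas
    (fun t : ℝ => ((t : ℂ) - z)⁻¹)
  refine Eq.trans h4 ?_
  refine integral_congr_ae (ae_of_all _ fun t => ?_)
  have h5 := ofReal_sub_ne_zero hz t
  simp only [NNReal.smul_def]
  rw [Real.coe_toNNReal _ (by positivity), Complex.real_smul, ← Complex.normSq_eq_norm_sq,
    ← Complex.mul_conj]
  field_simp
  simp

end IsSpectralMeasureOf

end ProjectionValuedMeasure

end Uniqueness

section Lattice

/-! ### Discrete Schrödinger operators -/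

variable {d : ℕ}

theorem latticeShift_apply (i n : Fin d → ℤ) (u : LatticeL2 d) :
    latticeShift i u n = u (n + i) := rfl

theorem inner_latticeShift_left (i : Fin d → ℤ) (u v : LatticeL2 d) :
    inner ℂ (latticeShift i u) v = inner ℂ u (latticeShift (-i) v) := by
  rw [lp.inner_eq_tsum, lp.inner_eq_tsum]
  conv_rhs => rw [← (Equiv.addRight i).tsum_eq]
  refine tsum_congr fun n => ?_
  simp [latticeShift_apply]

theorem norm_latticeShift (i : Fin d → ℤ) (u : LatticeL2 d) : ‖latticeShift i u‖ = ‖u‖ := by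
  have h : inner ℂ (latticeShift i u) (latticeShift i u) = inner ℂ u u := by
    rw [inner_latticeShift_left]
    congr 1
    ext n
    simp [latticeShift_apply]
  rw [inner_self_eq_norm_sq_to_K, inner_self_eq_norm_sq_to_K] at h
  have h2 : ‖latticeShift i u‖ ^ 2 = ‖u‖ ^ 2 := by exact_mod_cast h
  exact (sq_eq_sq₀ (norm_nonneg _) (norm_nonneg _)).1 h2

theorem continuous_latticeShift (i : Fin d → ℤ) :
    Continuous (latticeShift i : LatticeL2 d → LatticeL2 d) :=
  AddMonoidHomClass.continuous_of_bound _ 1 fun u => by rw [norm_latticeShift, one_mul]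

theorem latticeLaplacian_apply (u : LatticeL2 d) : latticeLaplacian d u =
    ∑ j : Fin d, (latticeShift (Pi.single j 1) u + latticeShift (-Pi.single j 1) u) := by
  simp [latticeLaplacian, LinearMap.sum_apply]

theorem continuous_latticeLaplacian :
    Continuous (latticeLaplacian d : LatticeL2 d → LatticeL2 d) := by
  have h : (latticeLaplacian d : LatticeL2 d → LatticeL2 d) = fun u =>
      ∑ j : Fin d, (latticeShift (Pi.single j 1) u + latticeShift (-Pi.single j 1) u) :=
    funext latticeLaplacian_apply
  rw [h]
  exact continuous_finsetSum _ fun j _ =>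
    (continuous_latticeShift _).add (continuous_latticeShift _)

theorem inner_latticeLaplacian_left (u v : LatticeL2 d) :
    inner ℂ (latticeLaplacian d u) v = inner ℂ u (latticeLaplacian d v) := by
  rw [latticeLaplacian_apply, latticeLaplacian_apply, sum_inner, inner_sum]
  refine Finset.sum_congr rfl fun j _ => ?_
  rw [inner_add_left, inner_add_right, inner_latticeShift_left, inner_latticeShift_left, neg_neg,
    add_comm]

theorem inner_latticeDelta_left (n : Fin d → ℤ) (u : LatticeL2 d) :
    inner ℂ (latticeDelta n) u = u n := by
  rw [latticeDelta, lp.inner_single_left]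
  simp

theorem norm_latticeDelta (n : Fin d → ℤ) : ‖latticeDelta n‖ = 1 := by
  rw [latticeDelta, lp.norm_single (by norm_num), norm_one]

theorem smul_latticeDelta_apply (n k : Fin d → ℤ) (c : ℂ) :
    (c • latticeDelta n : LatticeL2 d) k = if k = n then c else 0 := by
  have h : (c • latticeDelta n : LatticeL2 d) k = c * (latticeDelta n : LatticeL2 d) k := rfl
  rw [h, latticeDelta, lp.single_apply]
  by_cases hk : k = n
  · subst hk; simp
  · simp [hk]

theorem sum_smul_latticeDelta_apply (s : Finset (Fin d → ℤ)) (f : (Fin d → ℤ) → ℂ)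
    (k : Fin d → ℤ) :
    (∑ n ∈ s, f n • latticeDelta n : LatticeL2 d) k = if k ∈ s then f k else 0 := by
  rw [lp.coeFn_sum, Finset.sum_apply]
  simp only [smul_latticeDelta_apply]
  rw [Finset.sum_ite_eq]

theorem hasSum_smul_latticeDelta (u : LatticeL2 d) :
    HasSum (fun n => u n • latticeDelta n) u := by
  have h := lp.hasSum_single (by norm_num) u
  refine (congrArg (fun f => HasSum f u) (funext fun n => ?_)).mp h
  ext k
  rw [smul_latticeDelta_apply, lp.single_apply, Pi.single_apply]

variable (w : (Fin d → ℤ) → ℝ)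

theorem mem_diagonalOperator_domain {u : LatticeL2 d} :
    u ∈ (diagonalOperator w).domain ↔ Memℓp (fun n => (w n : ℂ) * u n) 2 := Iff.rfl

theorem smul_latticeDelta_diagonal (n : Fin d → ℤ) (c : ℂ) (k : Fin d → ℤ) :
    (w k : ℂ) * (c • latticeDelta n : LatticeL2 d) k =
      ((w n * c : ℂ) • latticeDelta n : LatticeL2 d) k := by
  rw [smul_latticeDelta_apply, smul_latticeDelta_apply]
  split_ifs with h
  · rw [h]
  · simp

theorem smul_latticeDelta_mem (n : Fin d → ℤ) (c : ℂ) :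
    c • latticeDelta n ∈ (diagonalOperator w).domain := by
  rw [mem_diagonalOperator_domain, funext (smul_latticeDelta_diagonal w n c)]
  exact lp.memℓp _

theorem diagonalOperator_smul_latticeDelta (n : Fin d → ℤ) (c : ℂ) :
    diagonalOperator w ⟨_, smul_latticeDelta_mem w n c⟩ = (w n * c : ℂ) • latticeDelta n := by
  ext k
  exact smul_latticeDelta_diagonal w n c k

/-- The discrete Schrödinger operator with potential `w`. -/
noncomputable def latticeSchrodinger : LatticeL2 d →ₗ.[ℂ] LatticeL2 d :=
  latticeLaplacian d +ᵥ diagonalOperator w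

theorem mem_latticeSchrodinger_domain {u : LatticeL2 d} :
    u ∈ (latticeSchrodinger w).domain ↔ u ∈ (diagonalOperator w).domain := Iff.rfl

theorem latticeSchrodinger_apply (u : (latticeSchrodinger w).domain) :
    latticeSchrodinger w u = latticeLaplacian d (u : LatticeL2 d) + diagonalOperator w u := rfl

theorem latticeSchrodinger_smul_latticeDelta (n : Fin d → ℤ) (c : ℂ)
    (h : c • latticeDelta n ∈ (latticeSchrodinger w).domain) :
    latticeSchrodinger w ⟨c • latticeDelta n, h⟩ =
      latticeLaplacian d (c • latticeDelta n) + (w n * c : ℂ) • latticeDelta n :=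
  congrArg (fun v => latticeLaplacian d (c • latticeDelta n) + v)
    (diagonalOperator_smul_latticeDelta w n c)

theorem dense_latticeSchrodinger_domain :
    Dense ((latticeSchrodinger w).domain : Set (LatticeL2 d)) := by
  intro u
  refine mem_closure_of_tendsto (hasSum_smul_latticeDelta u) (Eventually.of_forall fun s => ?_)
  exact Submodule.sum_mem _ fun n _ => smul_latticeDelta_mem w n (u n)

theorem inner_latticeSchrodinger_left (u v : (latticeSchrodinger w).domain) :
    inner ℂ (latticeSchrodinger w u) (v : LatticeL2 d) =
      inner ℂ (u : LatticeL2 d) (latticeSchrodinger w v) := by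
  rw [latticeSchrodinger_apply, latticeSchrodinger_apply, inner_add_left, inner_add_right,
    inner_latticeLaplacian_left]
  congr 1
  rw [lp.inner_eq_tsum, lp.inner_eq_tsum]
  refine tsum_congr fun n => ?_
  have h1 : diagonalOperator w u n = (w n : ℂ) * (u : LatticeL2 d) n := rfl
  have h2 : diagonalOperator w v n = (w n : ℂ) * (v : LatticeL2 d) n := rfl
  rw [h1, h2]
  simp only [RCLike.inner_apply, map_mul, Complex.conj_ofReal]
  ring

/-- Symmetry gives one inclusion. If y is in the domain of the adjoint, testing against δ_n shows
that w y is the adjoint applied to y minus Δy, hence in ℓ². -/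
theorem isSelfAdjoint_latticeSchrodinger : IsSelfAdjoint (latticeSchrodinger w) := by
  have hd := dense_latticeSchrodinger_domain w
  rw [LinearPMap.isSelfAdjoint_def]
  have hle : latticeSchrodinger w ≤ (latticeSchrodinger w).adjoint :=
    LinearPMap.IsFormalAdjoint.le_adjoint hd (inner_latticeSchrodinger_left w)
  refine (LinearPMap.eq_of_le_of_domain_eq hle (le_antisymm hle.1 fun y hy => ?_)).symm
  set v := (latticeSchrodinger w).adjoint ⟨y, hy⟩
  have h := LinearPMap.adjoint_isFormalAdjoint hd ⟨y, hy⟩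
  have h1 : ∀ n, v n = latticeLaplacian d y n + (w n : ℂ) * y n := by
    intro n
    have hn : (1 : ℂ) • latticeDelta n ∈ (latticeSchrodinger w).domain :=
      smul_latticeDelta_mem w n 1
    have h2 := h ⟨_, hn⟩
    rw [latticeSchrodinger_smul_latticeDelta, inner_add_right,
      ← inner_latticeLaplacian_left] at h2
    simp only [one_smul, mul_one, inner_smul_right] at h2
    rw [← inner_conj_symm, inner_latticeDelta_left, ← inner_conj_symm (latticeLaplacian d y),
      inner_latticeDelta_left, ← inner_conj_symm y, inner_latticeDelta_left] at h2
    have h3 := congrArg conj h2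
    simpa using h3
  rw [mem_latticeSchrodinger_domain, mem_diagonalOperator_domain]
  have h4 : (fun n => (w n : ℂ) * y n) = fun n => (v - latticeLaplacian d y : LatticeL2 d) n := by
    funext n
    have h5 : (v - latticeLaplacian d y : LatticeL2 d) n = v n - latticeLaplacian d y n := rfl
    rw [h5, h1]
    ring
  rw [h4]
  exact lp.memℓp _

variable {w}

/-- The hypothesis compares products with u, so it covers both potentials equal off s (the rank one
case) and vectors u supported in s with arbitrary potentials (the continuity argument). -/
theorem latticeSchrodinger_apply_of_eq_add {w' : (Fin d → ℤ) → ℝ} {s : Finset (Fin d → ℤ)}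
    (u : (latticeSchrodinger w).domain)
    (h : ∀ n ∉ s, (w' n : ℂ) * (u : LatticeL2 d) n = w n * (u : LatticeL2 d) n) :
    ∃ hu : (u : LatticeL2 d) ∈ (latticeSchrodinger w').domain,
      latticeSchrodinger w' ⟨u, hu⟩ = latticeSchrodinger w u +
        ∑ n ∈ s, ((w' n - w n : ℝ) * (u : LatticeL2 d) n : ℂ) • latticeDelta n := by
  have h1 : ∀ k, (w' k : ℂ) * (u : LatticeL2 d) k = (diagonalOperator w u +
      ∑ n ∈ s, ((w' n - w n : ℝ) * (u : LatticeL2 d) n : ℂ) • latticeDelta n : LatticeL2 d) k := by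
    intro k
    have h2 : (diagonalOperator w u +
        ∑ n ∈ s, ((w' n - w n : ℝ) * (u : LatticeL2 d) n : ℂ) • latticeDelta n : LatticeL2 d) k =
        (w k : ℂ) * (u : LatticeL2 d) k + (∑ n ∈ s,
          ((w' n - w n : ℝ) * (u : LatticeL2 d) n : ℂ) • latticeDelta n : LatticeL2 d) k := rfl
    rw [h2, sum_smul_latticeDelta_apply]
    split_ifs with hk
    · push_cast; ring
    · rw [h k hk, add_zero]
  have hu : (u : LatticeL2 d) ∈ (latticeSchrodinger w').domain := by
    rw [mem_latticeSchrodinger_domain, mem_diagonalOperator_domain, funext h1]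
    exact lp.memℓp _
  refine ⟨hu, ?_⟩
  rw [latticeSchrodinger_apply, latticeSchrodinger_apply, add_assoc]
  congr 1
  ext k
  exact h1 k

/-- The resolvent identity for a rank one perturbation. -/
theorem inner_resolvent_latticeSchrodinger_sub {w' : (Fin d → ℤ) → ℝ} {n : Fin d → ℤ}
    (h : ∀ k, k ≠ n → w' k = w k) {z : ℂ} (hz : z.im ≠ 0) :
    inner ℂ (latticeDelta n) ((latticeSchrodinger w').resolvent z (latticeDelta n)) -
      inner ℂ (latticeDelta n) ((latticeSchrodinger w).resolvent z (latticeDelta n)) =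
    -((w' n - w n : ℝ) *
      (inner ℂ (latticeDelta n) ((latticeSchrodinger w').resolvent z (latticeDelta n)) *
      inner ℂ (latticeDelta n) ((latticeSchrodinger w).resolvent z (latticeDelta n)))) := by
  have hw := isSelfAdjoint_latticeSchrodinger w
  have hw' := isSelfAdjoint_latticeSchrodinger w'
  set u : (latticeSchrodinger w).domain := ⟨_, LinearPMap.resolvent_mem hw hz (latticeDelta n)⟩
  obtain ⟨hu, h1⟩ := latticeSchrodinger_apply_of_eq_add (w' := w') (s := {n}) u
    (fun k hk => by rw [h k (by simpa using hk)])
  have h2 := LinearPMap.resolvent_apply_sub hw' hz ⟨_, hu⟩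
  rw [h1, LinearPMap.apply_resolvent hw hz, Finset.sum_singleton] at h2
  have h3 : latticeDelta n + z • (latticeSchrodinger w).resolvent z (latticeDelta n) +
      ((w' n - w n : ℝ) * (u : LatticeL2 d) n : ℂ) • latticeDelta n - z • (u : LatticeL2 d) =
      latticeDelta n + ((w' n - w n : ℝ) * (u : LatticeL2 d) n : ℂ) • latticeDelta n := by
    simp only [u]; abel
  rw [h3, map_add, map_smul] at h2
  have h4 := congrArg (inner ℂ (latticeDelta n)) h2
  rw [inner_add_right, inner_smul_right, ← inner_latticeDelta_left n (u : LatticeL2 d)] at h4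
  simp only [u] at h4
  linear_combination h4

/-- The resolvent depends continuously on the potential, for pointwise convergence. -/
theorem continuous_resolvent_latticeSchrodinger {z : ℂ} (hz : z.im ≠ 0) (x : LatticeL2 d) :
    Continuous fun w : (Fin d → ℤ) → ℝ => (latticeSchrodinger w).resolvent z x := by
  rw [continuous_iff_continuousAt]
  intro w
  have hw := isSelfAdjoint_latticeSchrodinger w
  set u : (latticeSchrodinger w).domain := ⟨_, LinearPMap.resolvent_mem hw hz x⟩
  have hux : latticeSchrodinger w u - z • (u : LatticeL2 d) = x := by
    rw [LinearPMap.apply_resolvent hw hz]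
    exact add_sub_cancel_right _ _
  -- Finite truncations of u lie in the domain for every potential and approximate u in the graph
  -- norm.
  let p : Finset (Fin d → ℤ) → (latticeSchrodinger w).domain := fun s =>
    ⟨∑ n ∈ s, (u : LatticeL2 d) n • latticeDelta n,
      Submodule.sum_mem _ fun n _ => smul_latticeDelta_mem w n _⟩
  have hlim1 : Tendsto (fun s => (p s : LatticeL2 d)) atTop (𝓝 (u : LatticeL2 d)) := by
    exact hasSum_smul_latticeDelta (u : LatticeL2 d)
  have hlim2 : Tendsto (fun s => diagonalOperator w (p s)) atTop (𝓝 (diagonalOperator w u)) := by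
    have h1 : ∀ s, diagonalOperator w (p s) =
        ∑ n ∈ s, (diagonalOperator w u) n • latticeDelta n := by
      intro s
      ext k
      have h2 : diagonalOperator w (p s) k = (w k : ℂ) *
        (∑ n ∈ s, (u : LatticeL2 d) n • latticeDelta n : LatticeL2 d) k := rfl
      rw [h2, sum_smul_latticeDelta_apply, sum_smul_latticeDelta_apply]
      split_ifs
      · rfl
      · exact mul_zero _
    simp only [h1]
    exact hasSum_smul_latticeDelta _
  have hlim3 : Tendsto (fun s => latticeSchrodinger w (p s) - z • (p s : LatticeL2 d)) atTop
      (𝓝 x) := by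
    rw [← hux]
    refine Tendsto.sub ?_ (hlim1.const_smul z)
    simp only [latticeSchrodinger_apply]
    exact ((continuous_latticeLaplacian.tendsto _).comp hlim1).add hlim2
  have hzp : 0 < |z.im| := abs_pos.2 hz
  rw [ContinuousAt, Metric.tendsto_nhds]
  intro ε hε
  -- The two errors |Im z| ε/4, from truncating and from changing the potential on s, become ε/2
  -- after the resolvent bound 1/|Im z|; the remaining ε/2 is the distance of the truncation from u.
  obtain ⟨s, hs1, hs2⟩ := ((Metric.tendsto_nhds.1 hlim1 (ε / 2) (by positivity)).and
    (Metric.tendsto_nhds.1 hlim3 (|z.im| * (ε / 4)) (by positivity))).exists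
  have hfin : Tendsto (fun w' : (Fin d → ℤ) → ℝ =>
      ∑ n ∈ s, ((w' n - w n : ℝ) * (p s : LatticeL2 d) n : ℂ) • latticeDelta n) (𝓝 w) (𝓝 0) := by
    have hc : Continuous fun w' : (Fin d → ℤ) → ℝ =>
        ∑ n ∈ s, ((w' n - w n : ℝ) * (p s : LatticeL2 d) n : ℂ) • (latticeDelta n : LatticeL2 d) := by
      refine continuous_finsetSum _ fun n _ => ?_
      have hcn : Continuous fun w' : (Fin d → ℤ) → ℝ =>
          ((w' n - w n : ℝ) * (p s : LatticeL2 d) n : ℂ) := by fun_prop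
      exact ((continuous_id.smul continuous_const :
        Continuous fun c : ℂ => c • (latticeDelta n : LatticeL2 d))).comp hcn
    have := hc.tendsto w
    simpa using this
  filter_upwards [Metric.tendsto_nhds.1 hfin (|z.im| * (ε / 4)) (by positivity)] with w' hw'
  have hsa' := isSelfAdjoint_latticeSchrodinger w'
  obtain ⟨hu', h1⟩ := latticeSchrodinger_apply_of_eq_add (w' := w') (s := s) (p s) fun n hn => by
    have h0 : (p s : LatticeL2 d) n = 0 := by
      rw [sum_smul_latticeDelta_apply, if_neg hn]
    rw [h0, mul_zero, mul_zero]
  set q := ∑ n ∈ s, ((w' n - w n : ℝ) * (p s : LatticeL2 d) n : ℂ) •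
    (latticeDelta n : LatticeL2 d)
  have h2 := LinearPMap.resolvent_apply_sub hsa' hz ⟨_, hu'⟩
  have h3 : (latticeSchrodinger w').resolvent z x - (p s : LatticeL2 d) =
      (latticeSchrodinger w').resolvent z
        (-((latticeSchrodinger w (p s) - z • (p s : LatticeL2 d) - x) + q)) := by
    conv_lhs => rw [← h2, ← map_sub, h1]
    congr 1
    abel
  have h4 : ‖(latticeSchrodinger w').resolvent z x - (p s : LatticeL2 d)‖ ≤ ε / 2 := by
    rw [h3]
    refine (LinearPMap.norm_resolvent_apply_le hsa' hz _).trans ?_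
    rw [norm_neg, inv_mul_le_iff₀ hzp]
    rw [dist_eq_norm] at hs2
    rw [dist_zero_right] at hw'
    refine (norm_add_le _ _).trans ?_
    linarith
  rw [dist_eq_norm] at hs1 ⊢
  calc ‖(latticeSchrodinger w').resolvent z x - (u : LatticeL2 d)‖
      ≤ ‖(latticeSchrodinger w').resolvent z x - (p s : LatticeL2 d)‖ +
        ‖(p s : LatticeL2 d) - (u : LatticeL2 d)‖ := norm_sub_le_norm_sub_add_norm_sub _ _ _
    _ < ε := by linarith

end Lattice

section AveragedSpectralMeasure

/-! ### Averaged spectral measures -/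

/-- The preimage of an interval of radius ε is an interval of radius ε/|a|. -/
theorem holderConst_map_mul_le (α : ℝ) (μ : Measure ℝ) {a : ℝ} (ha : a ≠ 0) :
    holderConst α (μ.map (a * ·)) ≤ ENNReal.ofReal (|a| ^ (-α)) * holderConst α μ := by
  rw [holderConst_le_iff]
  intro x ε hε
  have ha' : 0 < |a| := abs_pos.2 ha
  have hpre : (a * ·) ⁻¹' Ioo (x - ε) (x + ε) = Ioo (x / a - ε / |a|) (x / a + ε / |a|) := by
    rw [← Real.ball_eq_Ioo, ← Real.ball_eq_Ioo]
    ext t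
    rw [mem_preimage, Metric.mem_ball, Metric.mem_ball, Real.dist_eq, Real.dist_eq,
      lt_div_iff₀ ha', ← abs_mul]
    congr! 2
    field_simp
  rw [Measure.map_apply (measurable_const_mul a) measurableSet_Ioo, hpre]
  refine ((holderConst_le_iff (D := holderConst α μ)).1 le_rfl (x / a) (ε / |a|) (by positivity)).trans (le_of_eq ?_)
  have h : (2 * (ε / |a|)) ^ α = |a| ^ (-α) * (2 * ε) ^ α := by
    rw [← mul_div_assoc, Real.div_rpow (by positivity) ha'.le, Real.rpow_neg ha'.le, div_eq_inv_mul]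
  rw [h, ENNReal.ofReal_mul (by positivity), ← mul_assoc, mul_comm (holderConst α μ)]

variable {d : ℕ}

/-- The spectral measure of the discrete Schrödinger operator with potential `w` at site `n`. -/
noncomputable def siteSpectralMeasure (n : Fin d → ℤ) (w : (Fin d → ℤ) → ℝ) : Measure ℝ :=
  (spectralMeasure (latticeSchrodinger w)).scalarMeasure (latticeDelta n)

instance isProbabilityMeasure_siteSpectralMeasure (n : Fin d → ℤ) (w : (Fin d → ℤ) → ℝ) :
    IsProbabilityMeasure (siteSpectralMeasure n w) := by
  have h := ProjectionValuedMeasure.measureReal_scalarMeasure_univ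
    (spectralMeasure (latticeSchrodinger w)) (latticeDelta n)
  rw [norm_latticeDelta, one_pow] at h
  refine ⟨?_⟩
  rw [siteSpectralMeasure, ← ENNReal.ofReal_toReal (measure_ne_top _ univ)]
  exact (congrArg ENNReal.ofReal h).trans ENNReal.ofReal_one

theorem stieltjes_siteSpectralMeasure (n : Fin d → ℤ) (w : (Fin d → ℤ) → ℝ) {z : ℂ}
    (hz : z.im ≠ 0) : stieltjes (siteSpectralMeasure n w) z =
      inner ℂ (latticeDelta n) ((latticeSchrodinger w).resolvent z (latticeDelta n)) :=
  (LinearPMap.isSpectralMeasureOf_spectralMeasure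
    (isSelfAdjoint_latticeSchrodinger w)).stieltjes_scalarMeasure
    (isSelfAdjoint_latticeSchrodinger w) hz _

/-- The Stieltjes transforms are continuous in the product topology, and over countably many sites
its Borel sets form the product σ-algebra. -/
theorem measurable_siteSpectralMeasure (n : Fin d → ℤ) :
    Measurable (siteSpectralMeasure n : ((Fin d → ℤ) → ℝ) → Measure ℝ) := by
  refine measurable_of_measurable_stieltjes _ fun z hz => ?_
  simp only [stieltjes_siteSpectralMeasure n _ hz.ne']
  exact (continuous_const.inner
    (continuous_resolvent_latticeSchrodinger hz.ne' (latticeDelta n))).measurable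

theorem stieltjes_siteSpectralMeasure_update_sub (n : Fin d → ℤ) (r : (Fin d → ℤ) → ℝ) (x y : ℝ)
    {z : ℂ} (hz : z.im ≠ 0) :
    stieltjes (siteSpectralMeasure n (Function.update r n x)) z -
      stieltjes (siteSpectralMeasure n (Function.update r n y)) z =
    -((x - y : ℝ) * (stieltjes (siteSpectralMeasure n (Function.update r n x)) z *
      stieltjes (siteSpectralMeasure n (Function.update r n y)) z)) := by
  have h := inner_resolvent_latticeSchrodinger_sub (w' := Function.update r n x)
    (w := Function.update r n y) (n := n)
    (fun k hk => by rw [Function.update_of_ne hk, Function.update_of_ne hk]) hz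
  rw [Function.update_self, Function.update_self] at h
  rwa [stieltjes_siteSpectralMeasure n _ hz, stieltjes_siteSpectralMeasure n _ hz]

theorem lintegral_siteSpectralMeasure_update_le {α : ℝ} (hα : 0 < α) (hα1 : α ≤ 1)
    {μ : Measure ℝ} [SFinite μ] (hμ : holderConst α μ < ∞) (n : Fin d → ℤ)
    (r : (Fin d → ℤ) → ℝ) {b c : ℝ} (hbc : b < c) :
    ∫⁻ x, siteSpectralMeasure n (Function.update r n x) (Ioo b c) ∂μ ≤
      holderConst α μ * ENNReal.ofReal (c - b) ^ α := by
  refine lintegral_kernel_Ioo_le hα hα1 hμ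
    (fun x => siteSpectralMeasure n (Function.update r n x)) (fun t x y hxy => ?_) hbc
    (lintegral_measure_Ioo_le_of_stieltjes _ (fun x y z hz =>
      stieltjes_siteSpectralMeasure_update_sub n r x y hz.ne') hbc)
  exact measure_Iic_le_of_stieltjes (sub_nonneg.2 hxy)
    (fun z hz => stieltjes_siteSpectralMeasure_update_sub n r y x hz.ne') t

theorem measurable_update_of_forall_ne {ι X E : Type*} [DecidableEq ι] {mX : MeasurableSpace X}
    [MeasurableSpace E] {f : X → ι → E} (n : ι) (c : E)
    (hf : ∀ m, m ≠ n → Measurable fun x => f x m) :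
    Measurable fun x => Function.update (f x) n c := by
  refine measurable_pi_iff.2 fun m => ?_
  by_cases hm : m = n
  · subst hm
    simp only [Function.update_self]
    exact measurable_const
  · simpa only [Function.update_of_ne hm] using hf m hm

theorem indepFun_of_iIndepFun_of_notMem {ι Ω E : Type*} {mΩ : MeasurableSpace Ω}
    [MeasurableSpace E] {P : Measure Ω} {V : ι → Ω → E} (hV : ∀ i, Measurable (V i))
    (hindep : iIndepFun V P) (n : ι) {F : Type*} [MeasurableSpace F] {W : Ω → F}
    (hW : Measurable[⨆ i ∈ ({n}ᶜ : Set ι), MeasurableSpace.comap (V i) inferInstance] W) :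
    IndepFun (V n) W P := by
  have h := indep_iSup_of_disjoint (fun i => (hV i).comap_le) hindep
    (disjoint_compl_right (a := ({n} : Set ι)))
  exact indep_of_indep_of_le h (by simp) hW.comap_le

variable {Ω : Type*} [MeasurableSpace Ω] {P : Measure Ω} [IsProbabilityMeasure P] {μ : Measure ℝ}
  [IsProbabilityMeasure μ] {V : (Fin d → ℤ) → Ω → ℝ}

/-- Independence turns the expectation into an iterated integral whose inner variable is V(n); the
one-parameter bound holds uniformly in the frozen potential. -/
theorem lintegral_siteSpectralMeasure_le (hV : ∀ n, Measurable (V n)) (hindep : iIndepFun V P)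
    (hlaw : ∀ n, P.map (V n) = μ) {a : (Fin d → ℤ) → ℝ} (ha : ∀ n, a n ≠ 0)
    {α : ℝ} (hα : 0 < α) (hα1 : α ≤ 1) (hμ : holderConst α μ < ∞) (n : Fin d → ℤ)
    {b c : ℝ} (hbc : b < c) :
    ∫⁻ ω, siteSpectralMeasure n (fun m => a m * V m ω) (Ioo b c) ∂P ≤
      ENNReal.ofReal (|a n| ^ (-α)) * holderConst α μ * ENNReal.ofReal (c - b) ^ α := by
  -- Overwriting coordinate n by 0 makes W a function of the other sites only, hence independent of
  -- V(n); G puts the coupling a_n V(n) back.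
  let W : Ω → (Fin d → ℤ) → ℝ := fun ω => Function.update (fun m => a m * V m ω) n 0
  let G : ℝ × ((Fin d → ℤ) → ℝ) → ℝ≥0∞ := fun p =>
    siteSpectralMeasure n (Function.update p.2 n (a n * p.1)) (Ioo b c)
  have hup : Measurable fun p : ℝ × ((Fin d → ℤ) → ℝ) => Function.update p.2 n (a n * p.1) := by
    refine measurable_pi_iff.2 fun m => ?_
    by_cases hm : m = n
    · subst hm
      simp only [Function.update_self]
      fun_prop
    · simp only [Function.update_of_ne hm]
      fun_prop
  have hG : Measurable G := (Measure.measurable_coe measurableSet_Ioo).comp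
    ((measurable_siteSpectralMeasure n).comp hup)
  have hW' : Measurable[⨆ i ∈ ({n}ᶜ : Set (Fin d → ℤ)),
      MeasurableSpace.comap (V i) inferInstance] W := by
    refine measurable_update_of_forall_ne n 0 fun m hm => (measurable_const_mul (a m)).comp ?_
    exact (comap_measurable (V m)).mono
      (le_iSup₂_of_le (f := fun i (_ : i ∈ ({n}ᶜ : Set (Fin d → ℤ))) =>
        MeasurableSpace.comap (V i) inferInstance) m hm le_rfl) le_rfl
  have hW : Measurable W := hW'.mono (iSup₂_le fun i _ => (hV i).comap_le) le_rfl
  have hind := indepFun_of_iIndepFun_of_notMem hV hindep n hW'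
  have hprod := (indepFun_iff_map_prod_eq_prod_map_map (hV n).aemeasurable hW.aemeasurable).1 hind
  have : IsProbabilityMeasure (P.map W) := Measure.isProbabilityMeasure_map hW.aemeasurable
  have hmap := holderConst_map_mul_le α μ (ha n)
  have hmapfin : holderConst α (μ.map (a n * ·)) < ∞ :=
    hmap.trans_lt (ENNReal.mul_lt_top ENNReal.ofReal_lt_top hμ)
  calc ∫⁻ ω, siteSpectralMeasure n (fun m => a m * V m ω) (Ioo b c) ∂P
      = ∫⁻ ω, G (V n ω, W ω) ∂P := by
        refine lintegral_congr fun ω => ?_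
        simp only [G, W, Function.update_idem]
        rw [Function.update_eq_self n fun m => a m * V m ω]
    _ = ∫⁻ p, G p ∂(μ.prod (P.map W)) := by
        rw [← hlaw n, ← hprod, lintegral_map hG ((hV n).prodMk hW)]
    _ = ∫⁻ r, ∫⁻ x, G (x, r) ∂μ ∂(P.map W) := lintegral_prod_symm' _ hG
    _ ≤ ∫⁻ _, ENNReal.ofReal (|a n| ^ (-α)) * holderConst α μ * ENNReal.ofReal (c - b) ^ α
          ∂(P.map W) := by
        refine lintegral_mono fun r => ?_
        have hmeas : Measurable fun x : ℝ =>
            siteSpectralMeasure n (Function.update r n x) (Ioo b c) :=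
          (Measure.measurable_coe measurableSet_Ioo).comp
            ((measurable_siteSpectralMeasure n).comp (measurable_update r))
        calc ∫⁻ x, G (x, r) ∂μ
            = ∫⁻ x, siteSpectralMeasure n (Function.update r n x) (Ioo b c)
                ∂(μ.map (a n * ·)) := (lintegral_map hmeas (measurable_const_mul _)).symm
          _ ≤ holderConst α (μ.map (a n * ·)) * ENNReal.ofReal (c - b) ^ α :=
              lintegral_siteSpectralMeasure_update_le hα hα1 hmapfin n r hbc
          _ ≤ _ := by gcongr
    _ = _ := by rw [lintegral_const, measure_univ, mul_one]

end AveragedSpectralMeasure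

/-! ### The main theorem -/

theorem theorem1p2 {d : ℕ} {Ω : Type*} [MeasurableSpace Ω] (P : Measure Ω)
    [IsProbabilityMeasure P] (μ : Measure ℝ) [IsProbabilityMeasure μ]
    (V : (Fin d → ℤ) → Ω → ℝ) (hV : ∀ n, Measurable (V n)) (hindep : iIndepFun V P)
    (hlaw : ∀ n, P.map (V n) = μ)
    (a : (Fin d → ℤ) → ℝ) (ha : ∀ n, a n ≠ 0)
    (α : ℝ) (hα : 0 < α) (hα1 : α ≤ 1) (hμ : UniformlyHolder α μ) :
    let H : Ω → LatticeL2 d →ₗ.[ℂ] LatticeL2 d :=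
      fun ω => randomHamiltonian a fun n => V n ω
    let ν : (Fin d → ℤ) → Measure ℝ :=
      fun n => averagedSpectralMeasure P H (latticeDelta n)
    -- the objects are well defined
    (∀ ω, IsSelfAdjoint (H ω) ∧ (spectralMeasure (H ω)).IsSpectralMeasureOf (H ω)) ∧
    (∀ n, Measurable fun ω => (spectralMeasure (H ω)).scalarMeasure (latticeDelta n)) ∧
    -- the averaged spectral measures
    (∀ n, IsProbabilityMeasure (ν n) ∧ UniformlyHolder α (ν n) ∧
      holderConst α (ν n) ≤ ENNReal.ofReal (|a n| ^ (-α)) * holderConst α μ) ∧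
    -- their convex combinations
    (∀ β : (Fin d → ℤ) → ℝ, (∀ n, 0 ≤ β n) → HasSum β 1 →
      Summable (fun n => β n * |a n| ^ (-α)) →
        IsProbabilityMeasure (Measure.sum fun n => ENNReal.ofReal (β n) • ν n) ∧
        UniformlyHolder α (Measure.sum fun n => ENNReal.ofReal (β n) • ν n)) := by
  intro H ν
  have hμ' : holderConst α μ < ∞ := hμ.holderConst_lt_top hα
  have hsa : ∀ ω, IsSelfAdjoint (H ω) := fun ω =>
    isSelfAdjoint_latticeSchrodinger fun n => a n * V n ω
  have hpot : Measurable fun ω => fun m => a m * V m ω :=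
    measurable_pi_iff.2 fun m => (hV m).const_mul _
  have hmeas : ∀ n, Measurable fun ω => siteSpectralMeasure n fun m => a m * V m ω := fun n =>
    (measurable_siteSpectralMeasure n).comp hpot
  have hprob : ∀ n, IsProbabilityMeasure (ν n) := fun n => by
    exact isProbabilityMeasure_bind (hmeas n).aemeasurable (Eventually.of_forall fun ω =>
      isProbabilityMeasure_siteSpectralMeasure n fun m => a m * V m ω)
  have hle : ∀ n, holderConst α (ν n) ≤ ENNReal.ofReal (|a n| ^ (-α)) * holderConst α μ := by
    intro n
    rw [holderConst_le_iff]
    intro x ε hε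
    have h1 : ν n (Ioo (x - ε) (x + ε)) =
        ∫⁻ ω, siteSpectralMeasure n (fun m => a m * V m ω) (Ioo (x - ε) (x + ε)) ∂P :=
      Measure.bind_apply measurableSet_Ioo (hmeas n).aemeasurable
    rw [h1]
    refine (lintegral_siteSpectralMeasure_le hV hindep hlaw ha hα hα1 hμ' n
      (by linarith)).trans (le_of_eq ?_)
    rw [ENNReal.ofReal_rpow_of_pos (by linarith)]
    ring_nf
  refine ⟨fun ω => ⟨hsa ω, LinearPMap.isSpectralMeasureOf_spectralMeasure (hsa ω)⟩, hmeas,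
    fun n => ⟨hprob n, uniformlyHolder_of_holderConst_lt_top
      ((hle n).trans_lt (ENNReal.mul_lt_top ENNReal.ofReal_lt_top hμ')), hle n⟩, ?_⟩
  intro β hβ hβ1 hβa
  constructor
  · refine ⟨?_⟩
    rw [Measure.sum_apply _ MeasurableSet.univ]
    simp only [Measure.smul_apply, measure_univ, smul_eq_mul, mul_one]
    rw [← ENNReal.ofReal_tsum_of_nonneg hβ hβ1.summable, hβ1.tsum_eq, ENNReal.ofReal_one]
  -- The bounds for the ν_n add up with weights β_n, and the summability assumption makes the
  -- resulting constant finite.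
  · refine uniformlyHolder_of_holderConst_lt_top (lt_of_le_of_lt (b := ENNReal.ofReal
      (∑' n, β n * |a n| ^ (-α)) * holderConst α μ) ?_
      (ENNReal.mul_lt_top ENNReal.ofReal_lt_top hμ'))
    rw [holderConst_le_iff]
    intro x ε hε
    rw [Measure.sum_apply _ measurableSet_Ioo, ENNReal.ofReal_tsum_of_nonneg
      (fun n => mul_nonneg (hβ n) (by positivity)) hβa, ← ENNReal.tsum_mul_right,
      ← ENNReal.tsum_mul_right]
    refine ENNReal.tsum_le_tsum fun n => ?_
    rw [Measure.smul_apply, smul_eq_mul, ENNReal.ofReal_mul (hβ n), mul_assoc, mul_assoc,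
      ← mul_assoc (ENNReal.ofReal (|a n| ^ (-α)))]
    gcongr
    exact holderConst_le_iff.1 (hle n) x ε hε
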